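/- For a finite simple undirected graph $G=(V,E)$ with a distinguished vertex $p\in V$, a \emph{solution to MDD(max)} for $(G,p)$ is a set $S\subseteq V\setminus\{p\}$ such that $p$ is the unique vertex of maximum degree in the induced subgraph $G[V\setminus S]$. Then MDD(max) on unweighted cubic graphs can be approximated within a factor of $1.583$ in polynomial time: there are an algorithm and a polynomial $P$ such that, for every cubic (3-regular) graph $G$ with vertex set $\{0,\dots,n-1\}$, given by its adjacency matrix, and every vertex $p$ of $G$, the algorithm halts on the input $(n,G,p)$ after at most $P(n)$ steps and outputs a solution $S$ to MDD(max) for $(G,p)$ with $|S|\le 1.583\cdot|S_{\mathrm{opt}}|$, where $S_{\mathrm{opt}}$ is a solution to MDD(max) for $(G,p)$ of minimum cardinality. (Running time is measured on a random access machine with unit-cost addition and truncated subtraction of natural numbers, and without multiplication.) -/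

import Mathlib

/-! A random access machine with unit-cost addition and truncated subtraction (no multiplication),
programmed by structured programs. It has registers and finitely many (per program) unbounded
arrays, all holding natural numbers; every operation that is executed is charged one step. -/
namespace RAM

/-- The contents of the memory: `reg r` is the value of register `r`, and `arr a i` is the value of
cell `i` of array `a`. -/
structure Store where
  reg : ℕ → ℕ
  arr : ℕ → ℕ → ℕ

/-- Arithmetic expressions. `read a i` is the array access `a[i]`. -/
inductive Expr : Type
  | const (k : ℕ) : Expr
  | reg (r : ℕ) : Expr
  | read (a : ℕ) (i : Expr) : Expr
  | add (e f : Expr) : Expr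
  | sub (e f : Expr) : Expr

/-- The value of an expression; subtraction is truncated at `0`. -/
def Expr.eval (s : Store) : Expr → ℕ
  | const k => k
  | reg r => s.reg r
  | read a i => s.arr a (i.eval s)
  | add e f => e.eval s + f.eval s
  | sub e f => e.eval s - f.eval s

/-- The number of operations performed when an expression is evaluated. -/
def Expr.cost : Expr → ℕ
  | const _ => 1
  | reg _ => 1
  | read _ i => i.cost + 1
  | add e f => e.cost + f.cost + 1
  | sub e f => e.cost + f.cost + 1

/-- Programs. -/
inductive Cmd : Type
  | skip : Cmd
  /-- `r := e` -/
  | assign (r : ℕ) (e : Expr) : Cmd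
  /-- `a[i] := e` -/
  | write (a : ℕ) (i e : Expr) : Cmd
  | seq (c d : Cmd) : Cmd
  /-- if `e ≠ 0` then `c` else `d` -/
  | cond (e : Expr) (c d : Cmd) : Cmd
  /-- while `e ≠ 0` do `c` -/
  | loop (e : Expr) (c : Cmd) : Cmd

/-- The store after `r := v`. -/
def Store.setReg (s : Store) (r v : ℕ) : Store :=
  { s with reg := Function.update s.reg r v }

/-- The store after `a[i] := v`. -/
def Store.setArr (s : Store) (a i v : ℕ) : Store :=
  { s with arr := Function.update s.arr a (Function.update (s.arr a) i v) }

/-- `Exec c s t s'`: the program `c`, started on the store `s`, halts after exactly `t` steps with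
the store `s'`. -/
inductive Exec : Cmd → Store → ℕ → Store → Prop
  | skip (s : Store) : Exec Cmd.skip s 1 s
  | assign (r : ℕ) (e : Expr) (s : Store) :
      Exec (Cmd.assign r e) s (e.cost + 1) (s.setReg r (e.eval s))
  | write (a : ℕ) (i e : Expr) (s : Store) :
      Exec (Cmd.write a i e) s (i.cost + e.cost + 1) (s.setArr a (i.eval s) (e.eval s))
  | seq {c d : Cmd} {s s' s'' : Store} {t t' : ℕ} :
      Exec c s t s' → Exec d s' t' s'' → Exec (Cmd.seq c d) s (t + t') s''
  | cond_true {e : Expr} {c d : Cmd} {s s' : Store} {t : ℕ} :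
      e.eval s ≠ 0 → Exec c s t s' → Exec (Cmd.cond e c d) s (e.cost + 1 + t) s'
  | cond_false {e : Expr} {c d : Cmd} {s s' : Store} {t : ℕ} :
      e.eval s = 0 → Exec d s t s' → Exec (Cmd.cond e c d) s (e.cost + 1 + t) s'
  | loop_true {e : Expr} {c : Cmd} {s s' s'' : Store} {t t' : ℕ} :
      e.eval s ≠ 0 → Exec c s t s' → Exec (Cmd.loop e c) s' t' s'' →
      Exec (Cmd.loop e c) s (e.cost + 1 + t + t') s''
  | loop_false {e : Expr} {c : Cmd} {s : Store} :
      e.eval s = 0 → Exec (Cmd.loop e c) s (e.cost + 1) s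

/-- The machine is deterministic. -/
theorem Exec.deterministic {c : Cmd} {s s₁ s₂ : Store} {t₁ t₂ : ℕ}
    (h₁ : Exec c s t₁ s₁) (h₂ : Exec c s t₂ s₂) : t₁ = t₂ ∧ s₁ = s₂ := by
  induction h₁ generalizing t₂ s₂ with
  | skip s => cases h₂; exact ⟨rfl, rfl⟩
  | assign r e s => cases h₂; exact ⟨rfl, rfl⟩
  | write a i e s => cases h₂; exact ⟨rfl, rfl⟩
  | seq _ _ ih ih' =>
    cases h₂ with
    | seq k k' =>
      obtain ⟨rfl, rfl⟩ := ih k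
      obtain ⟨rfl, rfl⟩ := ih' k'
      exact ⟨rfl, rfl⟩
  | cond_true he _ ih =>
    cases h₂ with
    | cond_true _ k => obtain ⟨rfl, rfl⟩ := ih k; exact ⟨rfl, rfl⟩
    | cond_false k _ => exact absurd k he
  | cond_false he _ ih =>
    cases h₂ with
    | cond_true k _ => exact absurd he k
    | cond_false _ k => obtain ⟨rfl, rfl⟩ := ih k; exact ⟨rfl, rfl⟩
  | loop_true he _ _ ih ih' =>
    cases h₂ with
    | loop_true _ k k' =>
      obtain ⟨rfl, rfl⟩ := ih k
      obtain ⟨rfl, rfl⟩ := ih' k'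
      exact ⟨rfl, rfl⟩
    | loop_false k => exact absurd k he
  | loop_false he =>
    cases h₂ with
    | loop_true k _ _ => exact absurd he k
    | loop_false _ => exact ⟨rfl, rfl⟩

end RAM

open Classical in
/-- `S` is a solution to MDD(max) for the graph `G` with distinguished vertex `p`: `S` does not
contain `p`, and `p` is the unique vertex of maximum degree in the induced subgraph on the
complement of `S`. -/
def IsMDDMaxSolution {V : Type*} [Fintype V] (G : SimpleGraph V) (p : V) (S : Finset V) : Prop :=
  ∃ hp : p ∉ S, ∀ (v : V) (hv : v ∉ S), v ≠ p →
    (G.induce {u | u ∉ S}).degree ⟨v, hv⟩ < (G.induce {u | u ∉ S}).degree ⟨p, hp⟩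

open Classical in
/-- The initial store for the instance `(G, p)`: register `0` holds the number `n` of vertices,
register `1` holds `p`, array `0` holds the adjacency matrix of `G` row by row, and all other cells
are `0`. -/
noncomputable def mddInput {n : ℕ} (G : SimpleGraph (Fin n)) (p : Fin n) : RAM.Store where
  reg r := if r = 0 then n else if r = 1 then (p : ℕ) else 0
  arr a k :=
    if a = 0 ∧ ∃ i j : Fin n, G.Adj i j ∧ k = (i : ℕ) * n + j then 1 else 0

/-- The vertex set described by a final store: the set of the vertices `v` for which cell `v` of
array `1` is nonzero. -/
def mddOutput (n : ℕ) (s : RAM.Store) : Finset (Fin n) :=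
  Finset.univ.filter fun v => s.arr 1 (v : ℕ) ≠ 0

/-! The algorithm is a local search, and the ratio comes from comparing two counts. In a solution
every kept vertex other than `p` has smaller degree than `p`, hence a deleted neighbour; a deleted
vertex serves at most three of them, so every solution `T` has `n ≤ 4|T| + 1`
(`card_le_of_isMDDMaxSolution`). Conversely, if `Feasible G p` holds, a dominating set becomes a
solution after a change near `p` that costs at most nine vertices (`isMDDMaxSolution_repair`,
`card_repair_le`). It remains to find a dominating set with at most `1000n/2527` vertices:
`4000/2527 < 1.583`, and for large `n` the gap absorbs the additive constants.

Such a set is any dominating set `D` that exchanges of a few vertices make neither smaller nor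
sparser (`LocallyOptimal.card_le`). The proof is by discharging. Every vertex of `D` keeps its own
weight 1, and every vertex outside `D` distributes weight 1 among its neighbours in `D`; one shows
that each vertex of `D` ends with at least 2.527. The critical vertices of `D` are those without
external private neighbours (type A, `IsA`) and those isolated in `D` with exactly one (type B,
`IsB`). A type A vertex shares neighbours with at most one other type A vertex (`IsA.pair_unique`).
If two such vertices have the same three neighbours, they form a gadget or a pair of twins,
depending on whether one of these neighbours has a third neighbour in `D`. Gadgets, twins and
private neighbours of some type B vertices request additional weight from vertices outside `D` next
to them. If too many requests were refused, the refusing vertices would be covered by type A and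
type B vertices, and replacing these together with the requesting ones would give a forbidden
exchange (`granted_or_granted`, `Gadget.eligible_or_isB`, `Gadget.granted_of_special`,
`Twins.exists_granted`).

If `Feasible G p` fails, `p` keeps degree at most two in every solution, so other kept vertices have
two deleted neighbours and `2n ≤ 5|T| + 2`. A solution that changing three vertices cannot improve
either keeps only `p` and is optimal, or satisfies `5|S| ≤ 3n + 26`, which gives a ratio near 1.5.
For at most `threshold` vertices the search radius covers all sets, so the search finds an optimum.

On the machine, the objective and the output are written as terms with sums over the vertices. Such
terms are evaluated in polynomial time (`RAM.Term.exists_cmd`). One pass of the search consists of a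
fixed number of nested loops, and the objective is at most `60n + 1`, so there are linearly many
improving passes (`RAM.exists_search`). -/

set_option linter.unusedSectionVars false

/-! ### Exchanges in a locally optimal dominating set; vertices of types A and B. -/

namespace CubicDomination

variable {V : Type*} [Fintype V] [DecidableEq V] (G : SimpleGraph V) [DecidableRel G.Adj]

/-- `v` belongs to `D` or has a neighbour in `D`. -/
def Covered (D : Finset V) (v : V) : Prop := v ∈ D ∨ ∃ d ∈ D, G.Adj v d

/-- `D` is a dominating set. -/
def Dominates (D : Finset V) : Prop := ∀ v, Covered G D v

/-- The neighbours of `v` in `D`. -/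
def nb (D : Finset V) (v : V) : Finset V := (G.neighborFinset v).filter (· ∈ D)

/-- Twice the number of edges inside `D`. -/
def innerDeg (D : Finset V) : ℕ := ∑ v ∈ D, (nb G D v).card

/-- No exchange of at most four vertices makes the dominating set `D` smaller, and no exchange of
at most three vertices makes it sparser. -/
structure LocallyOptimal (D : Finset V) : Prop where
  dom : Dominates G D
  smaller : ∀ R Q : Finset V, R ⊆ D → R.card ≤ 4 → Q.card < R.card → ¬ Dominates G (D \ R ∪ Q)
  sparser : ∀ R Q : Finset V, R ⊆ D → R.card ≤ 3 → Q.card ≤ R.card →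
    innerDeg G (D \ R ∪ Q) < innerDeg G D → ¬ Dominates G (D \ R ∪ Q)

/-- The external private neighbours of `d`. -/
def epn (D : Finset V) (d : V) : Finset V :=
  (G.neighborFinset d).filter fun y => y ∉ D ∧ nb G D y = {d}

variable {G} {D : Finset V}

@[simp] lemma mem_nb {v d : V} : d ∈ nb G D v ↔ G.Adj v d ∧ d ∈ D := by
  simp [nb]

@[simp] lemma mem_epn {d y : V} : y ∈ epn G D d ↔ G.Adj d y ∧ y ∉ D ∧ nb G D y = {d} := by
  simp [epn]

/-- Only vertices of `R` and their neighbours can lose their cover, so only these have to be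
checked. The premises of `h` describe a vertex that the new set leaves uncovered. -/
lemma dominates_exchange (hD : Dominates G D) (R Q : Finset V)
    (h : ∀ r ∈ R, ∀ w, (w = r ∨ G.Adj r w) → w ∉ Q → (∀ q ∈ Q, ¬ G.Adj w q) →
      (∀ d ∈ D, G.Adj w d → d ∈ R) → (w ∈ D → w ∈ R) → False) :
    Dominates G (D \ R ∪ Q) := by
  intro v
  by_contra hc
  have h1 : v ∉ Q := fun hv => hc (Or.inl (by simp [hv]))
  have h2 : ∀ q ∈ Q, ¬ G.Adj v q := fun q hq ha => hc (Or.inr ⟨q, by simp [hq], ha⟩)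
  have h3 : ∀ d ∈ D, G.Adj v d → d ∈ R := fun d hd ha => by
    by_contra hr
    exact hc (Or.inr ⟨d, by simp [hd, hr], ha⟩)
  have h4 : v ∈ D → v ∈ R := fun hd => by
    by_contra hr
    exact hc (Or.inl (by simp [hd, hr]))
  rcases hD v with hv | ⟨d, hd, ha⟩
  · exact h v (h4 hv) v (Or.inl rfl) h1 h2 h3 h4
  · exact h d (h3 d hd ha) v (Or.inr ha.symm) h1 h2 h3 h4

/-- Here `v` covers both deleted vertices, so only their neighbours need care: each must be covered
by `v` or by a vertex of `D` that stays. The versions for three and four deleted vertices below work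
in the same way. -/
lemma LocallyOptimal.false_of_exchange_two {x z v : V} (h : LocallyOptimal G D) (hx : x ∈ D)
    (hz : z ∈ D) (hne : x ≠ z)
    (hxv : G.Adj v x) (hzv : G.Adj v z)
    (hx' : ∀ w, G.Adj x w → w ≠ v → ¬ G.Adj w v → ∃ d ∈ D, G.Adj w d ∧ d ≠ x ∧ d ≠ z)
    (hz' : ∀ w, G.Adj z w → w ≠ v → ¬ G.Adj w v → ∃ d ∈ D, G.Adj w d ∧ d ≠ x ∧ d ≠ z) :
    False := by
  refine h.smaller {x, z} {v} ?_ (Finset.card_le_two.trans (by omega)) ?_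
    (dominates_exchange h.dom _ _ ?_)
  · intro e; simp; rintro (rfl | rfl) <;> assumption
  · simp [Finset.card_pair hne]
  · intro r hr w hw hwQ hwq h3 h4
    simp only [Finset.mem_insert, Finset.mem_singleton, forall_eq] at hr hwQ hwq h3 h4
    rcases hw with rfl | hw
    · rcases hr with rfl | rfl
      · exact hwq hxv.symm
      · exact hwq hzv.symm
    · obtain ⟨d, h5, h6, h7, h8⟩ : ∃ d ∈ D, G.Adj w d ∧ d ≠ x ∧ d ≠ z := by
        rcases hr with rfl | rfl
        · exact hx' w hw hwQ hwq
        · exact hz' w hw hwQ hwq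
      rcases h3 d h5 h6 with h | h
      exacts [h7 h, h8 h]

lemma LocallyOptimal.false_of_exchange_three {x z a v p : V} (h : LocallyOptimal G D) (hx : x ∈ D)
    (hz : z ∈ D) (ha : a ∈ D) (hxz : x ≠ z) (hxa : x ≠ a) (hza : z ≠ a)
    (hxQ : G.Adj v x ∨ G.Adj p x) (hzQ : G.Adj v z ∨ G.Adj p z) (haQ : G.Adj v a ∨ G.Adj p a)
    (hx' : ∀ w, G.Adj x w → w ≠ v → w ≠ p → ¬ G.Adj w v → ¬ G.Adj w p →
      ∃ d ∈ D, G.Adj w d ∧ d ≠ x ∧ d ≠ z ∧ d ≠ a)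
    (hz' : ∀ w, G.Adj z w → w ≠ v → w ≠ p → ¬ G.Adj w v → ¬ G.Adj w p →
      ∃ d ∈ D, G.Adj w d ∧ d ≠ x ∧ d ≠ z ∧ d ≠ a)
    (ha' : ∀ w, G.Adj a w → w ≠ v → w ≠ p → ¬ G.Adj w v → ¬ G.Adj w p →
      ∃ d ∈ D, G.Adj w d ∧ d ≠ x ∧ d ≠ z ∧ d ≠ a) : False := by
  refine h.smaller {x, z, a} {v, p} ?_ (Finset.card_le_three.trans (by omega)) ?_
    (dominates_exchange h.dom _ _ ?_)
  · intro e; simp; rintro (rfl | rfl | rfl) <;> assumption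
  · rw [Finset.card_insert_of_notMem (s := {z, a}) (by simp [hxz, hxa]), Finset.card_pair hza]
    exact Nat.lt_of_le_of_lt Finset.card_le_two (by omega)
  · intro r hr w hw hwQ hwq h3 h4
    simp only [Finset.mem_insert, Finset.mem_singleton, forall_eq_or_imp, forall_eq, not_or]
      at hr hwQ hwq h3 h4
    rcases hw with rfl | hw
    · rcases hr with rfl | rfl | rfl
      · exact hxQ.elim (fun h => hwq.1 h.symm) fun h => hwq.2 h.symm
      · exact hzQ.elim (fun h => hwq.1 h.symm) fun h => hwq.2 h.symm
      · exact haQ.elim (fun h => hwq.1 h.symm) fun h => hwq.2 h.symm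
    · obtain ⟨d, h5, h6, h7, h8, h9⟩ : ∃ d ∈ D, G.Adj w d ∧ d ≠ x ∧ d ≠ z ∧ d ≠ a := by
        rcases hr with rfl | rfl | rfl
        · exact hx' w hw hwQ.1 hwQ.2 hwq.1 hwq.2
        · exact hz' w hw hwQ.1 hwQ.2 hwq.1 hwq.2
        · exact ha' w hw hwQ.1 hwQ.2 hwq.1 hwq.2
      rcases h3 d h5 h6 with h | h | h
      exacts [h7 h, h8 h, h9 h]

lemma LocallyOptimal.false_of_exchange_four {x z a b v p q : V} (h : LocallyOptimal G D)
    (hx : x ∈ D) (hz : z ∈ D) (ha : a ∈ D) (hb : b ∈ D) (hxz : x ≠ z) (hxa : x ≠ a) (hxb : x ≠ b)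
    (hza : z ≠ a) (hzb : z ≠ b) (hab : a ≠ b)
    (hQ : ∀ r, r = x ∨ r = z ∨ r = a ∨ r = b → G.Adj v r ∨ G.Adj p r ∨ G.Adj q r)
    (hr' : ∀ r, r = x ∨ r = z ∨ r = a ∨ r = b → ∀ w, G.Adj r w → w ≠ v → w ≠ p → w ≠ q →
      ¬ G.Adj w v → ¬ G.Adj w p → ¬ G.Adj w q →
      ∃ d ∈ D, G.Adj w d ∧ d ≠ x ∧ d ≠ z ∧ d ≠ a ∧ d ≠ b) : False := by
  refine h.smaller {x, z, a, b} {v, p, q} ?_ Finset.card_le_four ?_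
    (dominates_exchange h.dom _ _ ?_)
  · intro e; simp; rintro (rfl | rfl | rfl | rfl) <;> assumption
  · rw [Finset.card_insert_of_notMem (s := {z, a, b}) (by simp [hxz, hxa, hxb]),
      Finset.card_insert_of_notMem (s := {a, b}) (by simp [hza, hzb]), Finset.card_pair hab]
    exact Nat.lt_of_le_of_lt Finset.card_le_three (by omega)
  · intro r hr w hw hwQ hwq h3 h4
    simp only [Finset.mem_insert, Finset.mem_singleton, forall_eq_or_imp, forall_eq, not_or]
      at hr hwQ hwq h3 h4
    rcases hw with rfl | hw
    · rcases hQ w hr with h | h | h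
      exacts [hwq.1 h.symm, hwq.2.1 h.symm, hwq.2.2 h.symm]
    · obtain ⟨d, h5, h6, h7, h8, h9, h10⟩ :=
        hr' r hr w hw hwQ.1 hwQ.2.1 hwQ.2.2 hwq.1 hwq.2.1 hwq.2.2
      rcases h3 d h5 h6 with h | h | h | h
      exacts [h7 h, h8 h, h9 h, h10 h]

/-- `d` has no external private neighbour. -/
def IsA (G : SimpleGraph V) [DecidableRel G.Adj] (D : Finset V) (d : V) : Prop :=
  d ∈ D ∧ epn G D d = ∅

/-- `d` is isolated in `D` and `y` is its only external private neighbour. -/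
def IsB (G : SimpleGraph V) [DecidableRel G.Adj] (D : Finset V) (d y : V) : Prop :=
  d ∈ D ∧ nb G D d = ∅ ∧ epn G D d = {y}

/-- `d` can be deleted from `D` after `t` has been added. -/
structure Opener (G : SimpleGraph V) (D : Finset V) (d t : V) : Prop where
  mem : d ∈ D
  notMem : t ∉ D
  adj : G.Adj d t
  isolated : ∀ w, G.Adj d w → w ∉ D
  shared : ∀ w, G.Adj d w → w ≠ t → ∃ d' ∈ D, G.Adj w d' ∧ d' ≠ d

lemma exists_shared_of_notMem_epn {d w : V} (hd : d ∈ D) (hw : G.Adj d w) (hwD : w ∉ D)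
    (h : w ∉ epn G D d) : ∃ d' ∈ D, G.Adj w d' ∧ d' ≠ d := by
  by_contra hc
  push Not at hc
  apply h
  rw [mem_epn]
  refine ⟨hw, hwD, ?_⟩
  ext e
  rw [mem_nb, Finset.mem_singleton]
  exact ⟨fun he => hc e he.2 he.1, by rintro rfl; exact ⟨hw.symm, hd⟩⟩

/-- With a neighbour in `D`, the vertex `d` could simply be deleted: that neighbour covers it, and
all its neighbours outside `D` have another cover. -/
lemma IsA.isolated (h : LocallyOptimal G D) {d : V} (hd : IsA G D d) : ∀ w, G.Adj d w → w ∉ D := by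
  intro w hw hwD
  refine h.smaller {d} ∅ (by simpa using hd.1) (by simp) (by simp) (dominates_exchange h.dom _ _ ?_)
  intro r hr u hu _ _ h3 h4
  rw [Finset.mem_singleton] at hr
  subst hr
  rcases hu with rfl | hu
  · have := h3 w hwD hw
    rw [Finset.mem_singleton] at this
    exact hw.ne this.symm
  · by_cases huD : u ∈ D
    · exact hu.ne (Finset.mem_singleton.1 (h4 huD)).symm
    · obtain ⟨d', h1, h2, h5⟩ := exists_shared_of_notMem_epn hd.1 hu huD (by simp [hd.2])
      exact h5 (Finset.mem_singleton.1 (h3 d' h1 h2))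

lemma IsA.opener (h : LocallyOptimal G D) {d t : V} (hd : IsA G D d) (ht : G.Adj d t) :
    Opener G D d t where
  mem := hd.1
  notMem := hd.isolated h t ht
  adj := ht
  isolated := hd.isolated h
  shared w hw _ := exists_shared_of_notMem_epn hd.1 hw (hd.isolated h w hw) (by simp [hd.2])

lemma IsA.shared (h : LocallyOptimal G D) {d w : V} (hd : IsA G D d) (hw : G.Adj d w) :
    ∃ d' ∈ D, G.Adj w d' ∧ d' ≠ d :=
  exists_shared_of_notMem_epn hd.1 hw (hd.isolated h w hw) (by simp [hd.2])

lemma IsB.isolated {d y : V} (hd : IsB G D d y) : ∀ w, G.Adj d w → w ∉ D := by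
  intro w hw hwD
  have : w ∈ nb G D d := by simp [hw, hwD]
  simp [hd.2.1] at this

lemma IsB.spec {d y : V} (hd : IsB G D d y) : G.Adj d y ∧ y ∉ D ∧ nb G D y = {d} := by
  have : y ∈ epn G D d := by simp [hd.2.2]
  simpa using this

lemma IsB.eq_of_adj {d y e : V} (hd : IsB G D d y) (he : e ∈ D) (h : G.Adj y e) : e = d := by
  have : e ∈ nb G D y := by simp [he, h]
  simpa [hd.spec.2.2] using this

lemma IsB.opener {d y : V} (hd : IsB G D d y) : Opener G D d y where
  mem := hd.1
  notMem := hd.spec.2.1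
  adj := hd.spec.1
  isolated := hd.isolated
  shared w hw hwy := exists_shared_of_notMem_epn hd.1 hw (hd.isolated w hw) (by simp [hd.2.2, hwy])

lemma IsB.not_isA {d y : V} (hd : IsB G D d y) : ¬ IsA G D d := by
  intro h
  have := hd.2.2
  simp [h.2] at this

lemma innerDeg_eq_card (D : Finset V) :
    innerDeg G D = ((D ×ˢ D).filter fun e => G.Adj e.1 e.2).card := by
  rw [innerDeg, Finset.card_filter, Finset.sum_product]
  refine Finset.sum_congr rfl fun v _ => ?_
  rw [← Finset.card_filter]
  congr 1
  ext e
  simp [and_comm]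

/-- No edge inside `D'` is new, and the edge `de` is lost. -/
lemma innerDeg_lt {D' : Finset V} (h : ∀ u ∈ D', ∀ v ∈ D', G.Adj u v → u ∈ D ∧ v ∈ D)
    {d e : V} (hd : d ∈ D) (hd' : d ∉ D') (he : e ∈ D) (hde : G.Adj d e) :
    innerDeg G D' < innerDeg G D := by
  rw [innerDeg_eq_card, innerDeg_eq_card]
  refine Finset.card_lt_card ((Finset.ssubset_iff_of_subset ?_).2 ⟨(d, e), ?_, ?_⟩)
  · rintro ⟨u, v⟩ huv
    simp only [Finset.mem_filter, Finset.mem_product] at huv ⊢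
    exact ⟨h u huv.1.1 v huv.1.2 huv.2, huv.2⟩
  · simp [hd, he, hde]
  · simp [hd']

/-- A vertex of `D` with a neighbour in `D` has two external private neighbours. -/
lemma two_le_card_epn (h : LocallyOptimal G D) {d e : V} (hd : d ∈ D) (he : e ∈ D)
    (hde : G.Adj d e) : 2 ≤ (epn G D d).card := by
  by_contra hc
  have hlt : (epn G D d).card ≤ 1 := by omega
  have hs : ∀ a b, G.Adj a b → G.Adj b a := fun _ _ => SimpleGraph.Adj.symm
  rcases (epn G D d).eq_empty_or_nonempty with h0 | ⟨y, hy⟩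
  · exact IsA.isolated h ⟨hd, h0⟩ e hde he
  · have hy1 : ∀ w ∈ epn G D d, w = y := fun w hw => Finset.card_le_one.1 hlt w hw y hy
    have hy' := mem_epn.1 hy
    have hyd : ∀ f ∈ D, G.Adj y f → f = d := fun f hf ha => by
      have : f ∈ nb G D y := by simp [hf, ha]
      simpa [hy'.2.2] using this
    -- The only private neighbour `y` takes the place of `d`. It has no other neighbour in `D`, so
    -- no edge is created inside the set, while `de` disappears.
    refine h.sparser {d} {y} (by simpa using hd) (by simp) (by simp) ?_
      (dominates_exchange h.dom _ _ ?_)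
    · refine innerDeg_lt ?_ hd ?_ he hde
      · simp only [Finset.mem_union, Finset.mem_sdiff, Finset.mem_singleton]
        rintro u (hu | rfl) v (hv | rfl) huv
        · exact ⟨hu.1, hv.1⟩
        · exact absurd (hyd u hu.1 huv.symm) hu.2
        · exact absurd (hyd v hv.1 huv) hv.2
        · exact absurd rfl huv.ne
      · have := hy'.1.ne
        simp [this]
    · intro r hr w hw hwQ hwq h3 h4
      simp only [Finset.mem_singleton, forall_eq] at hr hwQ hwq h3 h4
      subst hr
      rcases hw with rfl | hw
      · exact hwq hy'.1
      · by_cases hwD : w ∈ D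
        · exact hw.ne (h4 hwD).symm
        · obtain ⟨d', h1, h2, h5⟩ := exists_shared_of_notMem_epn hd hw hwD (fun hm => hwQ (hy1 w hm))
          exact h5 (h3 d' h1 h2)

/-- If `x`, `z` have no external private neighbours and share a neighbour, they are the only
neighbours in `D` of two vertices. -/
lemma IsA.pair (h : LocallyOptimal G D) {x z v : V} (hx : IsA G D x) (hz : IsA G D z) (hne : x ≠ z)
    (hv : G.Adj v x) (hv' : G.Adj v z) :
    ∃ w, w ≠ v ∧ nb G D w = {x, z} := by
  by_contra hc
  push Not at hc
  have key : ∀ w, w ≠ v → w ∉ D → (∀ d ∈ D, G.Adj w d → d = x ∨ d = z) →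
      ¬ (G.Adj w x ∧ G.Adj w z) := by
    rintro w hw hwD h3 ⟨h4, h5⟩
    refine hc w hw ?_
    ext e
    simp only [mem_nb, Finset.mem_insert, Finset.mem_singleton]
    constructor
    · rintro ⟨h1, h2⟩; exact h3 e h2 h1
    · rintro (rfl | rfl); exacts [⟨h4, hx.1⟩, ⟨h5, hz.1⟩]
  -- Replacing `x` and `z` by `v` fails only at a vertex all of whose neighbours in `D` are among
  -- `x`, `z`. As neither of these has a private neighbour, it is adjacent to both.
  refine h.false_of_exchange_two hx.1 hz.1 hne hv hv' ?_ ?_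
  · intro w hw hwv _
    by_contra hcon
    push Not at hcon
    obtain ⟨d', h1, h2, h5⟩ := hx.shared h hw
    refine key w hwv (hx.isolated h w hw) (fun d hd ha => ?_) ⟨hw.symm, hcon d' h1 h2 h5 ▸ h2⟩
    by_cases hdx : d = x
    exacts [Or.inl hdx, Or.inr (hcon d hd ha hdx)]
  · intro w hw hwv _
    by_contra hcon
    obtain ⟨d', h1, h2, h5⟩ := hz.shared h hw
    have hdx : ∀ d ∈ D, G.Adj w d → d ≠ z → d = x := fun d hd ha hdz => by
      by_contra hdx
      exact hcon ⟨d, hd, ha, hdx, hdz⟩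
    refine key w hwv (hz.isolated h w hw) (fun d hd ha => ?_) ⟨hdx d' h1 h2 h5 ▸ h2, hw.symm⟩
    by_cases hdz : d = z
    exacts [Or.inr hdz, Or.inl (hdx d hd ha hdz)]

/-- The vertex `w` obtained from `v` is itself a common neighbour of `x` and `z`; applied to `w`,
the same argument gives a second one. The vertex `v` may have a third neighbour in `D`. -/
lemma IsA.pair_pair (h : LocallyOptimal G D) {x z v : V} (hx : IsA G D x) (hz : IsA G D z)
    (hne : x ≠ z) (hv : G.Adj v x) (hv' : G.Adj v z) :
    ∃ w w', w ≠ w' ∧ nb G D w = {x, z} ∧ nb G D w' = {x, z} := by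
  obtain ⟨w, -, hw⟩ := hx.pair h hz hne hv hv'
  have h1 : x ∈ nb G D w := by simp [hw]
  have h2 : z ∈ nb G D w := by simp [hw]
  rw [mem_nb] at h1 h2
  obtain ⟨w', hw', hw''⟩ := hx.pair h hz hne h1.1 h2.1
  exact ⟨w, w', hw'.symm, hw, hw''⟩

end CubicDomination

/-! ### Neighbourhoods in cubic graphs, and requests for a private neighbour of a type B vertex. -/

namespace CubicDomination
variable {V : Type*} [Fintype V] [DecidableEq V] {G : SimpleGraph V} [DecidableRel G.Adj]
variable {D : Finset V}

lemma not_four_adj (hG : G.IsRegularOfDegree 3) {x a b c d : V} (ha : G.Adj x a) (hb : G.Adj x b)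
    (hc : G.Adj x c) (hd : G.Adj x d) (h1 : a ≠ b) (h2 : a ≠ c) (h3 : a ≠ d) (h4 : b ≠ c)
    (h5 : b ≠ d) (h6 : c ≠ d) : False := by
  have h : ({a, b, c, d} : Finset V) ⊆ G.neighborFinset x := by
    intro e; simp; rintro (rfl | rfl | rfl | rfl) <;> assumption
  have := Finset.card_le_card h
  rw [SimpleGraph.card_neighborFinset_eq_degree, hG x] at this
  rw [Finset.card_insert_of_notMem (by simp [*]), Finset.card_insert_of_notMem (by simp [*]),
    Finset.card_pair h6] at this
  omega

lemma exists_two_adj (hG : G.IsRegularOfDegree 3) {x a : V} (ha : G.Adj x a) :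
    ∃ b c, b ≠ c ∧ b ≠ a ∧ c ≠ a ∧ G.Adj x b ∧ G.Adj x c ∧
      ∀ w, G.Adj x w → w = a ∨ w = b ∨ w = c := by
  have h : ((G.neighborFinset x).erase a).card = 2 := by
    rw [Finset.card_erase_of_mem (by simpa using ha), SimpleGraph.card_neighborFinset_eq_degree, hG x]
  obtain ⟨b, c, hbc, hs⟩ := Finset.card_eq_two.1 h
  have key : ∀ w, (w ≠ a ∧ G.Adj x w) ↔ (w = b ∨ w = c) := fun w => by
    have : w ∈ (G.neighborFinset x).erase a ↔ w ∈ ({b, c} : Finset V) := by rw [hs]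
    simpa using this
  have hb := (key b).2 (Or.inl rfl)
  have hc := (key c).2 (Or.inr rfl)
  refine ⟨b, c, hbc, hb.1, hc.1, hb.2, hc.2, fun w hw => ?_⟩
  by_cases hwa : w = a
  · exact Or.inl hwa
  · exact Or.inr ((key w).1 ⟨hwa, hw⟩)

lemma exists_third_adj (hG : G.IsRegularOfDegree 3) {x a b : V} (ha : G.Adj x a) (hb : G.Adj x b)
    (hab : a ≠ b) : ∃ c, c ≠ a ∧ c ≠ b ∧ G.Adj x c ∧ ∀ w, G.Adj x w → w = a ∨ w = b ∨ w = c := by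
  obtain ⟨c, d, h1, h2, h3, h4, h5, h6⟩ := exists_two_adj hG ha
  rcases h6 b hb with rfl | rfl | rfl
  · exact absurd rfl hab
  · exact ⟨d, h3, h1.symm, h5, h6⟩
  · exact ⟨c, h2, h1, h4, fun w hw => by have := h6 w hw; tauto⟩

lemma eq_of_adj_of_ne (hG : G.IsRegularOfDegree 3) {x a b c w : V} (ha : G.Adj x a)
    (hb : G.Adj x b) (hc : G.Adj x c) (hab : a ≠ b) (hac : a ≠ c) (hbc : b ≠ c) (hw : G.Adj x w) :
    w = a ∨ w = b ∨ w = c := by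
  by_contra hcon
  push Not at hcon
  exact not_four_adj hG ha hb hc hw hab hac hcon.1.symm hbc hcon.2.1.symm hcon.2.2.symm

lemma adj_iff_of_nb_eq_pair {w x z : V} (h : nb G D w = {x, z}) :
    G.Adj w x ∧ G.Adj w z ∧ ∀ d ∈ D, G.Adj w d → d = x ∨ d = z := by
  have h1 : ∀ d, d ∈ nb G D w ↔ d = x ∨ d = z := by simp [h]
  simp only [mem_nb] at h1
  exact ⟨((h1 x).2 (Or.inl rfl)).1, ((h1 z).2 (Or.inr rfl)).1, fun d hd ha => (h1 d).1 ⟨ha, hd⟩⟩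

/-- Each partner of `x` supplies two neighbours of `x` that see only `x` and that partner in `D`.
Two different partners would give `x` four neighbours. -/
lemma IsA.pair_unique (hG : G.IsRegularOfDegree 3) (h : LocallyOptimal G D) {x z z' v v' : V}
    (hx : IsA G D x) (hz : IsA G D z) (hz' : IsA G D z') (hne : x ≠ z) (hne' : x ≠ z')
    (hv : G.Adj v x) (hvz : G.Adj v z) (hv' : G.Adj v' x) (hvz' : G.Adj v' z') : z = z' := by
  obtain ⟨a, b, hab, ha, hb⟩ := hx.pair_pair h hz hne hv hvz
  obtain ⟨c, d, hcd, hc, hd⟩ := hx.pair_pair h hz' hne' hv' hvz'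
  by_contra hzz
  have ha1 := adj_iff_of_nb_eq_pair ha
  have hb1 := adj_iff_of_nb_eq_pair hb
  have hc1 := adj_iff_of_nb_eq_pair hc
  have hd1 := adj_iff_of_nb_eq_pair hd
  have key : ∀ w w', nb G D w = {x, z} → nb G D w' = {x, z'} → w ≠ w' := by
    rintro w w' h1 h2 rfl
    have h4 := (adj_iff_of_nb_eq_pair h2).2.2 z hz.1 (adj_iff_of_nb_eq_pair h1).2.1
    grind
  exact not_four_adj hG ha1.1.symm hb1.1.symm hc1.1.symm hd1.1.symm hab (key _ _ ha hc)
    (key _ _ ha hd) (key _ _ hb hc) (key _ _ hb hd) hcd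

/-- A vertex of `D` adjacent to `p` can spare a part of the weight of `p`. -/
def Granted (G : SimpleGraph V) [DecidableRel G.Adj] (D : Finset V) (p : V) : Prop :=
  ∃ d ∈ D, G.Adj p d ∧ ¬ IsA G D d ∧ ¬ IsB G D d p

lemma exists_adj_ne_of_forall_mem (hG : G.IsRegularOfDegree 3) {u z a b : V}
    (hu : ∀ w, G.Adj u w → w ∈ D) (huz : G.Adj u z) (hab : ¬ (G.Adj u a ∧ G.Adj u b)) :
    ∃ e ∈ D, G.Adj u e ∧ e ≠ z ∧ e ≠ a ∧ e ≠ b := by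
  obtain ⟨e, f, hef, he, hf, he', hf', -⟩ := exists_two_adj hG huz
  have heD := hu e he'
  have hfD := hu f hf'
  by_cases h1 : e = a ∨ e = b
  · refine ⟨f, hfD, hf', hf, ?_, ?_⟩
    · rintro rfl
      rcases h1 with rfl | rfl
      exacts [hef rfl, hab ⟨hf', he'⟩]
    · rintro rfl
      rcases h1 with rfl | rfl
      exacts [hab ⟨he', hf'⟩, hef rfl]
  · push Not at h1
    exact ⟨e, heD, he', he, h1.1, h1.2⟩

lemma IsB.eq_of_adj_of_ne (hG : G.IsRegularOfDegree 3) {z y v u : V} (hz : IsB G D z y)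
    (hzv : G.Adj z v) (hzu : G.Adj z u) (hvu : v ≠ u) (hvy : v ≠ y) (huy : u ≠ y) :
    ∀ w, G.Adj z w → w = y ∨ w = v ∨ w = u := fun _ hw =>
  CubicDomination.eq_of_adj_of_ne hG hz.spec.1 hzv hzu hvy.symm huy.symm hvu hw

/-- Two vertices without external private neighbours next to a neighbour of the external private
neighbour `y` of `z` give an improvement. -/
lemma false_of_adj_pair_of_ne (hG : G.IsRegularOfDegree 3) (h : LocallyOptimal G D)
    {z y v u x p a a' : V} (hz : IsB G D z y) (hzv : G.Adj z v) (hzu : G.Adj z u) (hvu : v ≠ u)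
    (hvy : v ≠ y) (huy : u ≠ y) (hu3 : ∀ w, G.Adj u w → w ∈ D)
    (hx : IsA G D x) (hvx : G.Adj v x) (hyp : G.Adj y p)
    (ha : IsA G D a) (ha' : IsA G D a') (haa : a ≠ a') (hpa : G.Adj p a) (hpa' : G.Adj p a')
    (hxa : x ≠ a) (hxa' : x ≠ a') : False := by
  have hxz : x ≠ z := by rintro rfl; exact hz.not_isA hx
  have haz : a ≠ z := by rintro rfl; exact hz.not_isA ha
  have hzN := hz.eq_of_adj_of_ne hG hzv hzu hvu hvy huy
  -- The unique partner of `a` is `a'`, so `x` shares no neighbour with `a`.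
  have key : ∀ w, ¬ (G.Adj w x ∧ G.Adj w a) := fun w h12 =>
    hxa' (ha.pair_unique hG h hx ha' hxa.symm haa h12.2 h12.1 hpa hpa')
  obtain ⟨e, heD, hue, hez, hex, hea⟩ := exists_adj_ne_of_forall_mem hG hu3 hzu.symm (key u)
  -- a vertex with another neighbour `d` in `D` keeps one, unless this is `z`
  have keep : ∀ w d r, d ∈ D → G.Adj w d → r ∈ D → G.Adj w r → r ≠ z → d ≠ x → d ≠ a → w ≠ v →
      ∃ d ∈ D, G.Adj w d ∧ d ≠ x ∧ d ≠ z ∧ d ≠ a := by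
    intro w d r hd hwd hr hwr hrz hdx hda hwv
    by_cases hdz : d = z
    · subst hdz
      rcases hzN w hwd.symm with rfl | rfl | rfl
      · exact absurd (hz.eq_of_adj hr hwr) hrz
      · exact absurd rfl hwv
      · exact ⟨e, heD, hue, hex, hez, hea⟩
    · exact ⟨d, hd, hwd, hdx, hdz, hda⟩
  -- The set `{x, z, a}` is replaced by `{v, p}`: `v` covers `x` and `z`, `p` covers `a` and `y`,
  -- and `u` keeps its neighbour `e`.
  refine h.false_of_exchange_three (v := v) (p := p) hx.1 hz.1 ha.1 hxz hxa haz.symm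
    (Or.inl hvx) (Or.inl hzv.symm) (Or.inr hpa) ?_ ?_ ?_
  · intro w hw hwv _ _ _
    obtain ⟨d, hd, hwd, hdx⟩ := hx.shared h hw
    exact keep w d x hd hwd hx.1 hw.symm hxz hdx (fun hda => key w ⟨hw.symm, hda ▸ hwd⟩) hwv
  · intro w hw hwv _ _ hwp
    rcases hzN w hw with rfl | rfl | rfl
    · exact absurd hyp hwp
    · exact absurd rfl hwv
    · exact ⟨e, heD, hue, hex, hez, hea⟩
  · intro w hw hwv _ _ _
    obtain ⟨d, hd, hwd, hda⟩ := ha.shared h hw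
    exact keep w d a hd hwd ha.1 hw.symm haz (fun hdx => key w ⟨hdx ▸ hwd, hw.symm⟩) hda hwv

/-- If `x` or `x'` is outside `{a, a'}`, the previous exchange applies, with the roles of `v` and
`u` switched for `x'`. Otherwise `x` and `x'` are the partners `a` and `a'`, and `{x, x', z}` can be
replaced by `{y, p2}`, where `p2` is another common neighbour: `y` covers `z` and `p`, while `v` and
`u` keep further neighbours in `D`. -/
lemma false_of_adj_pair (hG : G.IsRegularOfDegree 3) (h : LocallyOptimal G D)
    {z y v u x x' p a a' : V} (hz : IsB G D z y) (hzv : G.Adj z v) (hzu : G.Adj z u) (hvu : v ≠ u)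
    (hvy : v ≠ y) (huy : u ≠ y) (hv3 : ∀ w, G.Adj v w → w ∈ D) (hu3 : ∀ w, G.Adj u w → w ∈ D)
    (hx : IsA G D x) (hvx : G.Adj v x) (hx' : IsA G D x') (hux' : G.Adj u x')
    (hyp : G.Adj y p) (ha : IsA G D a) (ha' : IsA G D a') (haa : a ≠ a')
    (hpa : G.Adj p a) (hpa' : G.Adj p a') : False := by
  have hxz : x ≠ z := by rintro rfl; exact hz.not_isA hx
  have hxz' : x' ≠ z := by rintro rfl; exact hz.not_isA hx'
  have hyD := hz.spec.2.1
  by_cases hxa : x = a ∨ x = a'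
  swap
  · push Not at hxa
    exact false_of_adj_pair_of_ne hG h hz hzv hzu hvu hvy huy hu3 hx hvx hyp ha ha' haa hpa hpa'
      hxa.1 hxa.2
  by_cases hxa' : x' = a ∨ x' = a'
  swap
  · push Not at hxa'
    exact false_of_adj_pair_of_ne hG h hz hzu hzv hvu.symm huy hvy hv3 hx' hux' hyp ha ha' haa hpa
      hpa' hxa'.1 hxa'.2
  have hup : u ≠ p := by rintro rfl; exact hyD (hu3 y hyp.symm)
  have hvp : v ≠ p := by rintro rfl; exact hyD (hv3 y hyp.symm)
  obtain ⟨p2, hp2, hp2n⟩ := ha.pair h ha' haa hpa hpa'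
  obtain ⟨h5, h6, h7⟩ := adj_iff_of_nb_eq_pair hp2n
  have haz : z ≠ a := by rintro rfl; exact hz.not_isA ha
  have haz' : z ≠ a' := by rintro rfl; exact hz.not_isA ha'
  have hp2z : ¬ G.Adj p2 z := fun hh => (h7 z hz.1 hh).elim haz haz'
  have hp2v : v ≠ p2 := by rintro rfl; exact hp2z hzv.symm
  have hp2u : u ≠ p2 := by rintro rfl; exact hp2z hzu.symm
  have hpx : G.Adj p x ∧ G.Adj p2 x := by rcases hxa with rfl | rfl; exacts [⟨hpa, h5⟩, ⟨hpa', h6⟩]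
  have hpx' : G.Adj p x' ∧ G.Adj p2 x' := by
    rcases hxa' with rfl | rfl; exacts [⟨hpa, h5⟩, ⟨hpa', h6⟩]
  have hN : ∀ w, G.Adj x w → w = v ∨ w = p ∨ w = p2 := fun w hw =>
    eq_of_adj_of_ne hG hvx.symm hpx.1.symm hpx.2.symm hvp hp2v hp2.symm hw
  have hN' : ∀ w, G.Adj x' w → w = u ∨ w = p ∨ w = p2 := fun w hw =>
    eq_of_adj_of_ne hG hux'.symm hpx'.1.symm hpx'.2.symm hup hp2u hp2.symm hw
  have hxu : ¬ G.Adj u x := fun hh => by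
    rcases hN u hh.symm with h1 | h1 | h1
    exacts [hvu h1.symm, hup h1, hp2u h1]
  have hxv : ¬ G.Adj v x' := fun hh => by
    rcases hN' v hh.symm with h1 | h1 | h1
    exacts [hvu h1, hvp h1, hp2v h1]
  have hxx : x ≠ x' := by rintro rfl; exact hxu hux'
  obtain ⟨e, heD, hve, hez, hex, hex'⟩ :=
    exists_adj_ne_of_forall_mem (a := x) (b := x') hG hv3 hzv.symm (fun hh => hxv hh.2)
  obtain ⟨f, hfD, huf, hfz, hfx, hfx'⟩ :=
    exists_adj_ne_of_forall_mem (a := x) (b := x') hG hu3 hzu.symm (fun hh => hxu hh.1)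
  refine h.false_of_exchange_three (v := y) (p := p2) hx.1 hx'.1 hz.1 hxx hxz hxz'
    (Or.inr hpx.2) (Or.inr hpx'.2) (Or.inl hz.spec.1.symm) ?_ ?_ ?_
  · intro w hw hwy hwp2 hwy' _
    rcases hN w hw with rfl | rfl | rfl
    exacts [⟨e, heD, hve, hex, hex', hez⟩, absurd hyp.symm hwy', absurd rfl hwp2]
  · intro w hw hwy hwp2 hwy' _
    rcases hN' w hw with rfl | rfl | rfl
    exacts [⟨f, hfD, huf, hfx, hfx', hfz⟩, absurd hyp.symm hwy', absurd rfl hwp2]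
  · intro w hw hwy hwp2 hwy' _
    rcases hz.eq_of_adj_of_ne hG hzv hzu hvu hvy huy w hw with rfl | rfl | rfl
    exacts [absurd rfl hwy, ⟨e, heD, hve, hex, hex', hez⟩, ⟨f, hfD, huf, hfx, hfx', hfz⟩]

/-- If `p` is adjacent to `y` and is the external private neighbour of `d`, the vertices `x` and
`d` are joined by two vertices that block the exchanges. -/
lemma exists_two_blocking (hG : G.IsRegularOfDegree 3) (h : LocallyOptimal G D)
    {z y v u x p d : V} (hz : IsB G D z y) (hzv : G.Adj z v) (hzu : G.Adj z u) (hvu : v ≠ u)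
    (hvy : v ≠ y) (huy : u ≠ y) (hv3 : ∀ w, G.Adj v w → w ∈ D) (hu3 : ∀ w, G.Adj u w → w ∈ D)
    (hx : IsA G D x) (hvx : G.Adj v x) (hyp : G.Adj y p) (hd : IsB G D d p) (hdz : d ≠ z) :
    ∃ w w', w ≠ w' ∧ G.Adj x w ∧ G.Adj x w' ∧ G.Adj w d ∧ G.Adj w' d ∧
      (∀ e ∈ D, G.Adj w e → e = x ∨ e = z ∨ e = d) ∧
      (∀ e ∈ D, G.Adj w' e → e = x ∨ e = z ∨ e = d) := by
  by_contra hcon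
  have hxz : x ≠ z := by rintro rfl; exact hz.not_isA hx
  have hxd : x ≠ d := by rintro rfl; exact hd.not_isA hx
  have hzN := hz.eq_of_adj_of_ne hG hzv hzu hvu hvy huy
  -- These are the vertices next to both `x` and `d` that the deletion of `x`, `z` and `d` would
  -- leave without neighbours in `D`. Were there at most one of them, one of three exchanges of `{x,
  -- z, d}` for two vertices would succeed.
  set J : V → Prop := fun w => G.Adj x w ∧ G.Adj w d ∧
    ∀ e ∈ D, G.Adj w e → e = x ∨ e = z ∨ e = d with hJ
  have hone : ∀ w w', J w → J w' → w = w' := fun w w' h1 h2 => by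
    by_contra hne
    exact hcon ⟨w, w', hne, h1.1, h2.1, h1.2.1, h2.2.1, h1.2.2, h2.2.2⟩
  -- everything that could lose its last neighbour is `y`, `p` or satisfies `J`
  have full : ∀ u, G.Adj z u → (∀ w, G.Adj u w → w ∈ D) → ¬ J u →
      ∃ e ∈ D, G.Adj u e ∧ e ≠ x ∧ e ≠ z ∧ e ≠ d := by
    intro u hzu hu3 hJu
    by_contra hc
    have hall : ∀ e ∈ D, G.Adj u e → e = x ∨ e = z ∨ e = d := fun e he hue => by
      by_contra hh
      push Not at hh
      exact hc ⟨e, he, hue, hh⟩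
    obtain ⟨e, f, hef, he, hf, he', hf', -⟩ := exists_two_adj hG hzu.symm
    have h1 := hall e (hu3 e he') he'
    have h2 := hall f (hu3 f hf') hf'
    apply hJu
    rcases h1 with rfl | rfl | rfl
    · rcases h2 with rfl | rfl | rfl
      exacts [absurd rfl hef, absurd rfl hf, ⟨he'.symm, hf', hall⟩]
    · exact absurd rfl he
    · rcases h2 with rfl | rfl | rfl
      exacts [⟨hf'.symm, he', hall⟩, absurd rfl hf, absurd rfl hef]
  have keepx : ∀ w, G.Adj x w → ¬ J w → ∃ e ∈ D, G.Adj w e ∧ e ≠ x ∧ e ≠ z ∧ e ≠ d := by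
    intro w hw hJw
    by_contra hc
    have hall : ∀ e ∈ D, G.Adj w e → e = x ∨ e = z ∨ e = d := fun e he hue => by
      by_contra hh
      push Not at hh
      exact hc ⟨e, he, hue, hh⟩
    obtain ⟨f, hf, hwf, hfx⟩ := hx.shared h hw
    rcases hall f hf hwf with rfl | rfl | rfl
    · exact hfx rfl
    · rcases hzN w hwf.symm with rfl | rfl | rfl
      · exact hxz (hz.eq_of_adj hx.1 hw.symm)
      · exact hc (full _ hzv hv3 hJw)
      · exact hc (full _ hzu hu3 hJw)
    · exact hJw ⟨hw, hwf, hall⟩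
  have keepd : ∀ w, G.Adj d w → w ≠ p → ¬ J w → ∃ e ∈ D, G.Adj w e ∧ e ≠ x ∧ e ≠ z ∧ e ≠ d := by
    intro w hw hwp hJw
    by_contra hc
    have hall : ∀ e ∈ D, G.Adj w e → e = x ∨ e = z ∨ e = d := fun e he hue => by
      by_contra hh
      push Not at hh
      exact hc ⟨e, he, hue, hh⟩
    obtain ⟨f, hf, hwf, hfd⟩ := hd.opener.shared w hw hwp
    rcases hall f hf hwf with rfl | rfl | rfl
    · exact hJw ⟨hwf.symm, hw.symm, hall⟩
    · rcases hzN w hwf.symm with rfl | rfl | rfl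
      · exact hdz (hz.eq_of_adj hd.1 hw.symm)
      · exact hc (full _ hzv hv3 hJw)
      · exact hc (full _ hzu hu3 hJw)
    · exact hfd rfl
  have hpd := hd.spec.1.symm
  -- A single blocking vertex `w0` joins the new set. Its partner is `p` if `w0` covers `z`, since
  -- `d` and `y` are then left to `p`; otherwise it is `y`, which covers `z` and `p`. Without
  -- blocking vertices, `{v, p}` works.
  by_cases hex : ∃ w, J w
  · obtain ⟨w0, hw0⟩ := hex
    have hnJ : ∀ w, w ≠ w0 → ¬ J w := fun w hw hJw => hw (hone w w0 hJw hw0)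
    by_cases hw0z : G.Adj w0 z
    · refine h.false_of_exchange_three (v := w0) (p := p) hx.1 hz.1 hd.1 hxz hxd hdz.symm
        (Or.inl hw0.1.symm) (Or.inl hw0z) (Or.inr hpd) ?_ ?_ ?_
      · intro w hw h1 h2 h3 h4
        exact keepx w hw (hnJ w h1)
      · intro w hw h1 h2 h3 h4
        rcases hzN w hw with rfl | rfl | rfl
        exacts [absurd hyp h4, full _ hzv hv3 (hnJ _ h1), full _ hzu hu3 (hnJ _ h1)]
      · intro w hw h1 h2 h3 h4
        exact keepd w hw h2 (hnJ w h1)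
    · refine h.false_of_exchange_three (v := w0) (p := y) hx.1 hz.1 hd.1 hxz hxd hdz.symm
        (Or.inl hw0.1.symm) (Or.inr hz.spec.1.symm) (Or.inl hw0.2.1) ?_ ?_ ?_
      · intro w hw h1 h2 h3 h4
        exact keepx w hw (hnJ w h1)
      · intro w hw h1 h2 h3 h4
        rcases hzN w hw with rfl | rfl | rfl
        exacts [absurd rfl h2, full _ hzv hv3 (hnJ _ h1), full _ hzu hu3 (hnJ _ h1)]
      · intro w hw h1 h2 h3 h4
        exact keepd w hw (by rintro rfl; exact h4 hyp.symm) (hnJ w h1)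
  · have hnJ : ∀ w, ¬ J w := fun w hw => hex ⟨w, hw⟩
    refine h.false_of_exchange_three (v := v) (p := p) hx.1 hz.1 hd.1 hxz hxd hdz.symm
        (Or.inl hvx) (Or.inl hzv.symm) (Or.inr hpd) ?_ ?_ ?_
    · intro w hw h1 h2 h3 h4
      exact keepx w hw (hnJ w)
    · intro w hw h1 h2 h3 h4
      rcases hzN w hw with rfl | rfl | rfl
      exacts [absurd hyp h4, absurd rfl h1, full _ hzu hu3 (hnJ _)]
    · intro w hw h1 h2 h3 h4
      exact keepd w hw h2 (hnJ w)

/-- One of the two further neighbours of `y` is granted. -/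
lemma granted_or_granted (hG : G.IsRegularOfDegree 3) (h : LocallyOptimal G D)
    {z y v u x x' p q : V} (hz : IsB G D z y) (hzv : G.Adj z v) (hzu : G.Adj z u) (hvu : v ≠ u)
    (hvy : v ≠ y) (huy : u ≠ y) (hv3 : ∀ w, G.Adj v w → w ∈ D) (hu3 : ∀ w, G.Adj u w → w ∈ D)
    (hx : IsA G D x) (hvx : G.Adj v x) (hx' : IsA G D x') (hux' : G.Adj u x')
    (hyp : G.Adj y p) (hyq : G.Adj y q) (hpq : p ≠ q) (hpz : p ≠ z) (hqz : q ≠ z) :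
    Granted G D p ∨ Granted G D q := by
  by_contra hcon
  push Not at hcon
  have key : ∀ p, G.Adj y p → p ≠ z → ¬ Granted G D p → ∃ d, IsB G D d p ∧ d ≠ z := by
    intro p hyp hpz hp
    have hpD : p ∉ D := fun hpD => hpz (hz.eq_of_adj hpD hyp)
    have hall : ∀ d ∈ D, G.Adj p d → IsA G D d ∨ IsB G D d p := fun d hd hpd => by
      by_contra hh
      push Not at hh
      exact hp ⟨d, hd, hpd, hh⟩
    obtain hpD' | ⟨d, hd, hpd⟩ := h.dom p
    · exact absurd hpD' hpD
    have hB : ∀ d, IsB G D d p → d ≠ z := by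
      rintro d hd rfl
      exact hyp.ne (Finset.singleton_injective (hz.2.2.symm.trans hd.2.2))
    -- A refusing `p` has only type A neighbours and type B neighbours with private neighbour `p` in
    -- `D`. Two of type A are impossible by `false_of_adj_pair`, and one of type A is never alone.
    rcases hall d hd hpd with ha | hb
    · obtain ⟨d', hd', hpd', hne⟩ := ha.shared h hpd.symm
      rcases hall d' hd' hpd' with ha' | hb
      · exact (false_of_adj_pair hG h hz hzv hzu hvu hvy huy hv3 hu3 hx hvx hx' hux' hyp ha ha'
          hne.symm hpd hpd').elim
      · exact ⟨d', hb, hB d' hb⟩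
    · exact ⟨d, hb, hB d hb⟩
  obtain ⟨d, hd, hdz⟩ := key p hyp hpz hcon.1
  obtain ⟨d', hd', hdz'⟩ := key q hyq hqz hcon.2
  obtain ⟨a, b, hab, ha1, hb1, ha2, hb2, ha3, hb3⟩ :=
    exists_two_blocking hG h hz hzv hzu hvu hvy huy hv3 hu3 hx hvx hyp hd hdz
  obtain ⟨a', b', hab', ha1', hb1', ha2', hb2', ha3', hb3'⟩ :=
    exists_two_blocking hG h hz hzv hzu hvu hvy huy hv3 hu3 hx hvx hyq hd' hdz'
  have hdd : d ≠ d' := by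
    rintro rfl
    exact hpq (Finset.singleton_injective (hd.2.2.symm.trans hd'.2.2))
  have hxd : x ≠ d := by rintro rfl; exact hd.not_isA hx
  have hne : ∀ w w', G.Adj w d → (∀ e ∈ D, G.Adj w' e → e = x ∨ e = z ∨ e = d') → w ≠ w' := by
    rintro w w' h1 h2 rfl
    rcases h2 d hd.1 h1 with h3 | h3 | h3
    exacts [hxd h3.symm, hdz h3, hdd h3]
  -- The blocking vertices for `d` and those for `d'` are different, which makes four neighbours of
  -- `x`.
  exact not_four_adj hG ha1 hb1 ha1' hb1' hab (hne _ _ ha2 ha3') (hne _ _ ha2 hb3')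
    (hne _ _ hb2 ha3') (hne _ _ hb2 hb3') hab'

end CubicDomination

/-! ### Gadgets: two type A vertices with the same neighbours, one of which has a third neighbour in
`D`. -/

namespace CubicDomination
variable {V : Type*} [Fintype V] [DecidableEq V] {G : SimpleGraph V} [DecidableRel G.Adj]
variable {D : Finset V}

/-- Two vertices `x`, `z` without external private neighbours that have the same neighbours `v₁`,
`v₂`, `v₃`, where `v₁` and `v₂` have no further neighbour in `D` and `u` is the third neighbour of
`v₃`. -/
structure Gadget (G : SimpleGraph V) [DecidableRel G.Adj] (D : Finset V) (x z v₁ v₂ v₃ u : V) :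
    Prop where
  left : IsA G D x
  right : IsA G D z
  ne : x ≠ z
  nb₁ : nb G D v₁ = {x, z}
  nb₂ : nb G D v₂ = {x, z}
  ne₁₂ : v₁ ≠ v₂
  ne₃₁ : v₃ ≠ v₁
  ne₃₂ : v₃ ≠ v₂
  adj_left : G.Adj v₃ x
  adj_right : G.Adj v₃ z
  adj : G.Adj v₃ u
  mem : u ∈ D
  ne_left : u ≠ x
  ne_right : u ≠ z

namespace Gadget
variable {x z v₁ v₂ v₃ u : V}

lemma swap (g : Gadget G D x z v₁ v₂ v₃ u) : Gadget G D x z v₂ v₁ v₃ u :=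
  ⟨g.left, g.right, g.ne, g.nb₂, g.nb₁, g.ne₁₂.symm, g.ne₃₂, g.ne₃₁, g.adj_left, g.adj_right, g.adj,
    g.mem, g.ne_left, g.ne_right⟩

lemma adj₁ (g : Gadget G D x z v₁ v₂ v₃ u) :
    G.Adj v₁ x ∧ G.Adj v₁ z ∧ ∀ d ∈ D, G.Adj v₁ d → d = x ∨ d = z :=
  adj_iff_of_nb_eq_pair g.nb₁

lemma adj₂ (g : Gadget G D x z v₁ v₂ v₃ u) :
    G.Adj v₂ x ∧ G.Adj v₂ z ∧ ∀ d ∈ D, G.Adj v₂ d → d = x ∨ d = z :=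
  adj_iff_of_nb_eq_pair g.nb₂

lemma eq_of_adj_left (hG : G.IsRegularOfDegree 3) (g : Gadget G D x z v₁ v₂ v₃ u) {w : V}
    (hw : G.Adj x w) : w = v₁ ∨ w = v₂ ∨ w = v₃ :=
  eq_of_adj_of_ne hG g.adj₁.1.symm g.adj₂.1.symm g.adj_left.symm g.ne₁₂ g.ne₃₁.symm g.ne₃₂.symm hw

lemma eq_of_adj_right (hG : G.IsRegularOfDegree 3) (g : Gadget G D x z v₁ v₂ v₃ u) {w : V}
    (hw : G.Adj z w) : w = v₁ ∨ w = v₂ ∨ w = v₃ :=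
  eq_of_adj_of_ne hG g.adj₁.2.1.symm g.adj₂.2.1.symm g.adj_right.symm g.ne₁₂ g.ne₃₁.symm
    g.ne₃₂.symm hw

lemma eq_of_adj_mid (hG : G.IsRegularOfDegree 3) (g : Gadget G D x z v₁ v₂ v₃ u) {w : V}
    (hw : G.Adj v₃ w) : w = x ∨ w = z ∨ w = u :=
  eq_of_adj_of_ne hG g.adj_left g.adj_right g.adj g.ne g.ne_left.symm g.ne_right.symm hw

/-- The only vertices of `D` next to a neighbour of `x` or `z` are `x`, `z` and `u`. -/
lemma eq_of_adj_adj (hG : G.IsRegularOfDegree 3) (g : Gadget G D x z v₁ v₂ v₃ u) {w d : V}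
    (hw : G.Adj w x ∨ G.Adj w z) (hd : d ∈ D) (hwd : G.Adj w d) : d = x ∨ d = z ∨ d = u := by
  have : w = v₁ ∨ w = v₂ ∨ w = v₃ :=
    hw.elim (fun h => g.eq_of_adj_left hG h.symm) fun h => g.eq_of_adj_right hG h.symm
  rcases this with rfl | rfl | rfl
  · rcases g.adj₁.2.2 d hd hwd with h | h <;> simp [h]
  · rcases g.adj₂.2.2 d hd hwd with h | h <;> simp [h]
  · exact g.eq_of_adj_mid hG hwd

lemma not_isA (hG : G.IsRegularOfDegree 3) (h : LocallyOptimal G D)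
    (g : Gadget G D x z v₁ v₂ v₃ u) : ¬ IsA G D u := fun hu =>
  g.ne_right (g.left.pair_unique hG h g.right hu g.ne g.ne_left.symm g.adj_left g.adj_right
    g.adj_left g.adj).symm

lemma third_notMem (g : Gadget G D x z v₁ v₂ v₃ u) {t : V} (ht : G.Adj v₁ t) (htx : t ≠ x)
    (htz : t ≠ z) : t ∉ D := fun htD => (g.adj₁.2.2 t htD ht).elim htx htz

lemma notMem_mid (h : LocallyOptimal G D) (g : Gadget G D x z v₁ v₂ v₃ u) : v₃ ∉ D :=
  g.left.isolated h v₃ g.adj_left.symm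

lemma notMem₁ (h : LocallyOptimal G D) (g : Gadget G D x z v₁ v₂ v₃ u) : v₁ ∉ D :=
  g.left.isolated h v₁ g.adj₁.1.symm

/-- Otherwise `v₁` alone could replace `x` and `z`: it would cover `v₂`, and `v₃` keeps `u`. -/
lemma not_adj₁₂ (hG : G.IsRegularOfDegree 3) (h : LocallyOptimal G D)
    (g : Gadget G D x z v₁ v₂ v₃ u) : ¬ G.Adj v₁ v₂ := by
  intro h12
  refine h.false_of_exchange_two (v := v₁) g.left.1 g.right.1 g.ne g.adj₁.1 g.adj₁.2.1 ?_ ?_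
  · intro w hw hwv hwv'
    rcases g.eq_of_adj_left hG hw with rfl | rfl | rfl
    exacts [absurd rfl hwv, absurd h12.symm hwv', ⟨u, g.mem, g.adj, g.ne_left, g.ne_right⟩]
  · intro w hw hwv hwv'
    rcases g.eq_of_adj_right hG hw with rfl | rfl | rfl
    exacts [absurd rfl hwv, absurd h12.symm hwv', ⟨u, g.mem, g.adj, g.ne_left, g.ne_right⟩]

/-- A vertex next to `v₁` or `v₂`, but not among `x`, `z`, is not adjacent to `x` or `z`. -/
lemma third_not_adj (hG : G.IsRegularOfDegree 3) (h : LocallyOptimal G D)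
    (g : Gadget G D x z v₁ v₂ v₃ u) {t : V} (ht : G.Adj v₁ t) :
    ¬ G.Adj t x ∧ ¬ G.Adj t z := by
  have key : ¬ (t = v₁ ∨ t = v₂ ∨ t = v₃) := by
    rintro (rfl | rfl | rfl)
    · exact ht.ne rfl
    · exact g.not_adj₁₂ hG h ht
    · have hD := g.notMem₁ h
      rcases g.eq_of_adj_mid hG ht.symm with rfl | rfl | rfl
      exacts [hD g.left.1, hD g.right.1, hD g.mem]
  exact ⟨fun hh => key (g.eq_of_adj_left hG hh.symm), fun hh => key (g.eq_of_adj_right hG hh.symm)⟩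

/-- The set `{x, z, d}` could be replaced by `{v₂, t}`: `v₂` covers `x` and `z`, `t` covers `d` and
`v₁`, and `v₃` keeps `u`. Adding `t` makes `d` superfluous, and the other neighbours of `d` do not
depend on `x` or `z`. -/
lemma false_of_opener (hG : G.IsRegularOfDegree 3) (h : LocallyOptimal G D)
    (g : Gadget G D x z v₁ v₂ v₃ u) {t d : V} (ht : G.Adj v₁ t)
    (hd : Opener G D d t) (hdu : d ≠ u) : False := by
  obtain ⟨hnx, hnz⟩ := g.third_not_adj hG h ht
  have hdx : x ≠ d := by rintro rfl; exact hnx hd.adj.symm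
  have hdz : z ≠ d := by rintro rfl; exact hnz hd.adj.symm
  have hu : ∃ e ∈ D, G.Adj v₃ e ∧ e ≠ x ∧ e ≠ z ∧ e ≠ d :=
    ⟨u, g.mem, g.adj, g.ne_left, g.ne_right, hdu.symm⟩
  refine h.false_of_exchange_three (v := v₂) (p := t) g.left.1 g.right.1 hd.mem g.ne hdx hdz
    (Or.inl g.adj₂.1) (Or.inl g.adj₂.2.1) (Or.inr hd.adj.symm) ?_ ?_ ?_
  · intro w hw h1 h2 h3 h4
    rcases g.eq_of_adj_left hG hw with rfl | rfl | rfl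
    exacts [absurd ht h4, absurd rfl h1, hu]
  · intro w hw h1 h2 h3 h4
    rcases g.eq_of_adj_right hG hw with rfl | rfl | rfl
    exacts [absurd ht h4, absurd rfl h1, hu]
  · intro w hw h1 h2 h3 h4
    obtain ⟨d', hd', hwd', hne⟩ := hd.shared w hw h2
    refine ⟨d', hd', hwd', ?_, ?_, hne⟩
    · rintro rfl
      rcases g.eq_of_adj_adj hG (Or.inl hwd') hd.mem hw.symm with rfl | rfl | rfl
      exacts [hdx rfl, hdz rfl, hdu rfl]
    · rintro rfl
      rcases g.eq_of_adj_adj hG (Or.inr hwd') hd.mem hw.symm with rfl | rfl | rfl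
      exacts [hdx rfl, hdz rfl, hdu rfl]

end Gadget

/-- The neighbours of a vertex of `D` that has a neighbour `e` in `D`. -/
lemma exists_epn_of_adj_mem (hG : G.IsRegularOfDegree 3) (h : LocallyOptimal G D) {d e t : V}
    (hd : d ∈ D) (he : e ∈ D) (hde : G.Adj d e) (hdt : G.Adj d t) (ht : t ≠ e) :
    t ∈ epn G D d ∧ ∃ t', t' ≠ t ∧ t' ∈ epn G D d ∧ ∀ w, G.Adj d w → w = e ∨ w = t ∨ w = t' := by
  obtain ⟨t', h1, h2, h3, h4⟩ := exists_third_adj hG hde hdt ht.symm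
  have hsub : epn G D d ⊆ {t, t'} := by
    intro w hw
    have hw' := mem_epn.1 hw
    rcases h4 w hw'.1 with rfl | rfl | rfl
    · exact absurd he hw'.2.1
    · simp
    · simp
  have heq : epn G D d = {t, t'} :=
    Finset.eq_of_subset_of_card_le hsub
      ((Finset.card_le_two).trans (two_le_card_epn h hd he hde))
  exact ⟨by simp [heq], t', h2, by simp [heq], h4⟩

namespace Gadget
variable {x z v₁ v₂ v₃ u : V}

/-- If `d` had a neighbour in `D`, its other two neighbours `t` and `t'` would be private. This
allows an exchange that either saves a vertex or removes edges inside `D`. -/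
lemma isolated_of_adj_third (hG : G.IsRegularOfDegree 3) (h : LocallyOptimal G D)
    (g : Gadget G D x z v₁ v₂ v₃ u) {t d : V} (ht : G.Adj v₁ t) (htD : t ∉ D)
    (hd : d ∈ D) (htd : G.Adj t d) : nb G D d = ∅ := by
  rw [Finset.eq_empty_iff_forall_notMem]
  intro e he
  rw [mem_nb] at he
  have hte : t ≠ e := by rintro rfl; exact htD he.2
  obtain ⟨htn, t', htt, ht', hN⟩ := exists_epn_of_adj_mem hG h hd he.2 he.1 htd.symm hte
  rw [mem_epn] at htn ht'
  obtain ⟨hnx, hnz⟩ := g.third_not_adj hG h ht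
  have hdx : x ≠ d := by rintro rfl; exact hnx htd
  have hdz : z ≠ d := by rintro rfl; exact hnz htd
  have hex : e ≠ x := by rintro rfl; exact g.left.isolated h d he.1.symm hd
  have hez : e ≠ z := by rintro rfl; exact g.right.isolated h d he.1.symm hd
  have honly : ∀ f ∈ D, G.Adj t' f → f = d := fun f hf hadj => by
    have : f ∈ nb G D t' := by simp [hf, hadj]
    simpa [ht'.2.2] using this
  have hv₃D := g.notMem_mid h
  have hv₁D := g.notMem₁ h
  have hv₂D := g.swap.notMem₁ h
  have hud : u ≠ d := by
    rintro rfl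
    rcases hN v₃ g.adj.symm with rfl | rfl | rfl
    · exact hv₃D he.2
    · exact hnx g.adj_left
    · exact hdx (honly x g.left.1 g.adj_left)
  have hRD : ({x, z, d} : Finset V) ⊆ D := by
    intro f; simp; rintro (rfl | rfl | rfl); exacts [g.left.1, g.right.1, hd]
  have hcard : ({x, z, d} : Finset V).card = 3 := by
    rw [Finset.card_insert_of_notMem (by simp [g.ne, hdx]), Finset.card_pair hdz]
  have hded : e ≠ d := he.1.ne.symm
  -- If `t'` covers `v₂`, then `{v₁, t'}` replaces `{x, z, d}`, with `v₁` covering `t`. Otherwise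
  -- `v₂` is added too; the cardinality need not drop, but the new vertices have no neighbours in
  -- the new set, so the edge `de` is lost without compensation.
  by_cases h2 : G.Adj v₂ t'
  · refine h.smaller {x, z, d} {v₁, t'} hRD (by omega)
      (by rw [hcard]; exact Nat.lt_of_le_of_lt Finset.card_le_two (by omega))
      (dominates_exchange h.dom _ _ ?_)
    intro r hr w hw hwQ hwq h3 h4
    simp only [Finset.mem_insert, Finset.mem_singleton, forall_eq_or_imp, forall_eq, not_or]
      at hr hwQ hwq h3 h4
    rcases hw with rfl | hw
    · rcases hr with rfl | rfl | rfl
      exacts [hwq.1 g.adj₁.1.symm, hwq.1 g.adj₁.2.1.symm, hwq.2 ht'.1]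
    · have hv : ¬ (w = v₁ ∨ w = v₂ ∨ w = v₃) := by
        rintro (rfl | rfl | rfl)
        · exact hwQ.1 rfl
        · exact hwq.2 h2
        · rcases h3 u g.mem g.adj with h | h | h
          exacts [g.ne_left h, g.ne_right h, hud h]
      rcases hr with rfl | rfl | rfl
      · exact hv (g.eq_of_adj_left hG hw)
      · exact hv (g.eq_of_adj_right hG hw)
      · rcases hN w hw with rfl | rfl | rfl
        · rcases h4 he.2 with h | h | h
          exacts [hex h, hez h, hded h]
        · exact hwq.1 ht.symm
        · exact hwQ.2 rfl
  · have hN₁ : ∀ w, G.Adj v₁ w → w = x ∨ w = z ∨ w = t := fun w hw =>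
      eq_of_adj_of_ne hG g.adj₁.1 g.adj₁.2.1 ht g.ne (by rintro rfl; exact htD g.left.1)
        (by rintro rfl; exact htD g.right.1) hw
    have hv₁₂ := g.not_adj₁₂ hG h
    have htx : t' ≠ x := by rintro rfl; exact ht'.2.1 g.left.1
    have htz : t' ≠ z := by rintro rfl; exact ht'.2.1 g.right.1
    have hv₁t : ¬ G.Adj v₁ t' := fun hh => by
      rcases hN₁ t' hh with h | h | h
      exacts [htx h, htz h, htt h]
    have hloop : ∀ a ∈ ({v₁, v₂, t'} : Finset V), ∀ b ∈ D \ {x, z, d} ∪ {v₁, v₂, t'},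
        ¬ G.Adj a b := by
      intro a ha b hb hab
      simp only [Finset.mem_insert, Finset.mem_singleton, Finset.mem_union, Finset.mem_sdiff,
        not_or] at ha hb
      rcases hb with ⟨hbD, hbx, hbz, hbd⟩ | hb
      · rcases ha with rfl | rfl | rfl
        · rcases g.adj₁.2.2 b hbD hab with h | h
          exacts [hbx h, hbz h]
        · rcases g.adj₂.2.2 b hbD hab with h | h
          exacts [hbx h, hbz h]
        · exact hbd (honly b hbD hab)
      · rcases ha with rfl | rfl | rfl <;> rcases hb with rfl | rfl | rfl
        exacts [hab.ne rfl, hv₁₂ hab, hv₁t hab, hv₁₂ hab.symm, hab.ne rfl, h2 hab, hv₁t hab.symm,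
          h2 hab.symm, hab.ne rfl]
    refine h.sparser {x, z, d} {v₁, v₂, t'} hRD (by omega) (by rw [hcard]; exact Finset.card_le_three)
      (innerDeg_lt ?_ hd ?_ he.2 he.1) (dominates_exchange h.dom _ _ ?_)
    · intro a ha b hb hab
      constructor
      · rcases Finset.mem_union.1 ha with ha | ha
        · exact (Finset.mem_sdiff.1 ha).1
        · exact absurd hab (hloop a ha b hb)
      · rcases Finset.mem_union.1 hb with hb | hb
        · exact (Finset.mem_sdiff.1 hb).1
        · exact absurd hab.symm (hloop b hb a ha)
    · have h1 : d ≠ v₁ := by rintro rfl; exact hv₁D hd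
      have h2 : d ≠ v₂ := by rintro rfl; exact hv₂D hd
      simp [h1, h2, ht'.1.ne]
    · intro r hr w hw hwQ hwq h3 h4
      simp only [Finset.mem_insert, Finset.mem_singleton, forall_eq_or_imp, forall_eq, not_or]
        at hr hwQ hwq h3 h4
      rcases hw with rfl | hw
      · rcases hr with rfl | rfl | rfl
        exacts [hwq.1 g.adj₁.1.symm, hwq.1 g.adj₁.2.1.symm, hwq.2.2 ht'.1]
      · have hv : ¬ (w = v₁ ∨ w = v₂ ∨ w = v₃) := by
          rintro (rfl | rfl | rfl)
          · exact hwQ.1 rfl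
          · exact hwQ.2.1 rfl
          · rcases h3 u g.mem g.adj with h | h | h
            exacts [g.ne_left h, g.ne_right h, hud h]
        rcases hr with rfl | rfl | rfl
        · exact hv (g.eq_of_adj_left hG hw)
        · exact hv (g.eq_of_adj_right hG hw)
        · rcases hN w hw with rfl | rfl | rfl
          · rcases h4 he.2 with h | h | h
            exacts [hex h, hez h, hded h]
          · exact hwq.1 ht.symm
          · exact hwQ.2.2 rfl

end Gadget

/-- All vertices of `D` adjacent to `p` can spare a larger part of the weight of `p`. -/
def Eligible (G : SimpleGraph V) [DecidableRel G.Adj] (D : Finset V) (p : V) : Prop :=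
  ∀ d ∈ D, G.Adj p d → ¬ IsA G D d ∧ ¬ IsB G D d p ∧ nb G D d = ∅

namespace Gadget
variable {x z v₁ v₂ v₃ u : V}

/-- A type A neighbour of `t`, or a type B neighbour with private neighbour `t`, is an opener
through `t`, which `false_of_opener` excludes unless it is `u`; and `u` is not of type A. Thus only
`u` can cause a refusal. -/
lemma eligible_or_isB (hG : G.IsRegularOfDegree 3) (h : LocallyOptimal G D)
    (g : Gadget G D x z v₁ v₂ v₃ u) {t : V} (ht : G.Adj v₁ t) (htx : t ≠ x) (htz : t ≠ z) :
    Eligible G D t ∨ IsB G D u t := by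
  by_contra hcon
  push Not at hcon
  refine hcon.1 fun d hd htd => ⟨fun hA => ?_, fun hB => ?_, ?_⟩
  · exact g.false_of_opener hG h ht (hA.opener h htd.symm)
      (by rintro rfl; exact g.not_isA hG h hA)
  · exact g.false_of_opener hG h ht hB.opener (by rintro rfl; exact hcon.2 hB)
  · exact g.isolated_of_adj_third hG h ht (g.third_notMem ht htx htz) hd htd

/-- If `y` covered both `v₁` and `v₂`, then `{y, v₃}` could replace `{x, z, u}`. Hence at most one
of the two requests of a gadget is refused. -/
lemma not_adj_both (hG : G.IsRegularOfDegree 3) (h : LocallyOptimal G D)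
    (g : Gadget G D x z v₁ v₂ v₃ u) {y : V} (hu : IsB G D u y) (h1 : G.Adj v₁ y) :
    ¬ G.Adj v₂ y := by
  intro h2
  refine h.false_of_exchange_three (v := y) (p := v₃) g.left.1 g.right.1 hu.1 g.ne
    g.ne_left.symm g.ne_right.symm (Or.inr g.adj_left) (Or.inr g.adj_right) (Or.inr g.adj) ?_ ?_ ?_
  · intro w hw hw1 hw2 hw3 hw4
    rcases g.eq_of_adj_left hG hw with rfl | rfl | rfl
    exacts [absurd h1 hw3, absurd h2 hw3, absurd rfl hw2]
  · intro w hw hw1 hw2 hw3 hw4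
    rcases g.eq_of_adj_right hG hw with rfl | rfl | rfl
    exacts [absurd h1 hw3, absurd h2 hw3, absurd rfl hw2]
  · intro w hw hw1 hw2 hw3 hw4
    obtain ⟨d, hd, hwd, hne⟩ := hu.opener.shared w hw hw1
    have hv : w = v₁ ∨ w = v₂ ∨ w = v₃ → False := by
      rintro (rfl | rfl | rfl)
      exacts [hw3 h1, hw3 h2, hw2 rfl]
    refine ⟨d, hd, hwd, ?_, ?_, hne⟩
    · rintro rfl; exact hv (g.eq_of_adj_left hG hwd.symm)
    · rintro rfl; exact hv (g.eq_of_adj_right hG hwd.symm)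

/-- If the external private neighbour `y` of `u` is adjacent to `v₁`, the last neighbour `w` of `u`
is shared with vertices that have external private neighbours. -/
lemma not_isA_of_special (hG : G.IsRegularOfDegree 3) (h : LocallyOptimal G D)
    (g : Gadget G D x z v₁ v₂ v₃ u) {y w a : V} (hu : IsB G D u y) (h1 : G.Adj v₁ y)
    (hw : G.Adj u w) (hwv : w ≠ v₃) (hwa : G.Adj w a) : ¬ IsA G D a := by
  intro ha
  have hv₃y : v₃ ≠ y := by
    rintro rfl
    exact g.ne_left.symm (hu.eq_of_adj g.left.1 g.adj_left)
  have hau : a ≠ u := by rintro rfl; exact hu.not_isA ha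
  have hwy : w ≠ y := by rintro rfl; exact hau (hu.eq_of_adj ha.1 hwa)
  have hwx : ¬ G.Adj w x ∧ ¬ G.Adj w z := by
    have key : ¬ (w = v₁ ∨ w = v₂ ∨ w = v₃) := by
      rintro (rfl | rfl | rfl)
      · exact (g.adj₁.2.2 u hu.1 hw.symm).elim g.ne_left g.ne_right
      · exact (g.adj₂.2.2 u hu.1 hw.symm).elim g.ne_left g.ne_right
      · exact hwv rfl
    exact ⟨fun hh => key (g.eq_of_adj_left hG hh.symm),
      fun hh => key (g.eq_of_adj_right hG hh.symm)⟩
  have hax : a ≠ x := by rintro rfl; exact hwx.1 hwa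
  have haz : a ≠ z := by rintro rfl; exact hwx.2 hwa
  have hN := hu.eq_of_adj_of_ne hG g.adj.symm hw hwv.symm hv₃y hwy
  have hz : ∀ w, G.Adj w z → ∃ d ∈ D, G.Adj w d ∧ d ≠ a ∧ d ≠ u ∧ d ≠ x := fun w hw =>
    ⟨z, g.right.1, hw, haz.symm, g.ne_right.symm, g.ne.symm⟩
  -- The set `{a, u, x}` is replaced by `{w, v₁}`: `w` covers `a` and `u`, `v₁` covers `x` and `y`,
  -- while `v₂` and `v₃` keep `z`.
  refine h.false_of_exchange_three (v := w) (p := v₁) ha.1 hu.1 g.left.1 hau hax g.ne_left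
    (Or.inl hwa) (Or.inl hw.symm) (Or.inr g.adj₁.1) ?_ ?_ ?_
  · intro s hs hs1 hs2 hs3 hs4
    obtain ⟨d, hd, hsd, hne⟩ := ha.shared h hs
    refine ⟨d, hd, hsd, hne, ?_, ?_⟩
    · rintro rfl
      rcases hN s hsd.symm with rfl | rfl | rfl
      · exact hau (hu.eq_of_adj ha.1 hs.symm)
      · rcases g.eq_of_adj_mid hG hs.symm with h | h | h
        exacts [hax h, haz h, hau h]
      · exact hs1 rfl
    · rintro rfl
      rcases g.eq_of_adj_adj hG (Or.inl hsd) ha.1 hs.symm with h | h | h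
      exacts [hax h, haz h, hau h]
  · intro s hs hs1 hs2 hs3 hs4
    rcases hN s hs with rfl | rfl | rfl
    exacts [absurd h1.symm hs4, hz _ g.adj_right, absurd rfl hs1]
  · intro s hs hs1 hs2 hs3 hs4
    rcases g.eq_of_adj_left hG hs with rfl | rfl | rfl
    exacts [absurd rfl hs2, hz _ g.adj₂.2.1, hz _ g.adj_right]

/-- If `q` granted nothing, some opener `d` through `q` would cover it, and `{v₃, q}` could replace
`{x, u, d}`: `q` covers `y` and `d`, `v₁` and `v₂` keep `z`, and `w` keeps a third neighbour in `D`.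
This compensates `u` for the weight that it gives up at `v₃`. -/
lemma granted_of_special (hG : G.IsRegularOfDegree 3) (h : LocallyOptimal G D)
    (g : Gadget G D x z v₁ v₂ v₃ u) {y w q : V} (hu : IsB G D u y) (h1 : G.Adj v₁ y)
    (hw : G.Adj u w) (hwv : w ≠ v₃) (hwy : w ≠ y) (hw3 : ∀ e, G.Adj w e → e ∈ D)
    (hyq : G.Adj y q) (hqu : q ≠ u) (hqv : q ≠ v₁) : Granted G D q := by
  have hv₃y : v₃ ≠ y := by
    rintro rfl
    exact g.ne_left.symm (hu.eq_of_adj g.left.1 g.adj_left)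
  have hwx : ¬ G.Adj w x := by
    intro hh
    rcases g.eq_of_adj_left hG hh.symm with rfl | rfl | rfl
    · exact (g.adj₁.2.2 u hu.1 hw.symm).elim g.ne_left g.ne_right
    · exact (g.adj₂.2.2 u hu.1 hw.symm).elim g.ne_left g.ne_right
    · exact hwv rfl
  have hN := hu.eq_of_adj_of_ne hG g.adj.symm hw hwv.symm hv₃y hwy
  have hqD : q ∉ D := fun hq => hqu (hu.eq_of_adj hq hyq)
  have hqxz : ¬ G.Adj q x ∧ ¬ G.Adj q z := by
    have key : ¬ (q = v₁ ∨ q = v₂ ∨ q = v₃) := by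
      rintro (rfl | rfl | rfl)
      · exact hqv rfl
      · exact g.not_adj_both hG h hu h1 hyq.symm
      · have hyD := hu.spec.2.1
        rcases g.eq_of_adj_mid hG hyq.symm with rfl | rfl | rfl
        exacts [hyD g.left.1, hyD g.right.1, hyD g.mem]
    exact ⟨fun hh => key (g.eq_of_adj_left hG hh.symm),
      fun hh => key (g.eq_of_adj_right hG hh.symm)⟩
  obtain hq | ⟨d, hd, hqd⟩ := h.dom q
  · exact absurd hq hqD
  refine ⟨d, hd, hqd, ?_⟩
  by_contra hcon
  have hop : Opener G D d q ∧ d ≠ u := by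
    by_cases hA : IsA G D d
    · exact ⟨hA.opener h hqd.symm, by rintro rfl; exact hu.not_isA hA⟩
    · have hB : IsB G D d q := by tauto
      refine ⟨hB.opener, ?_⟩
      rintro rfl
      exact hyq.ne (Finset.singleton_injective (hu.2.2.symm.trans hB.2.2))
  obtain ⟨hop, hdu⟩ := hop
  have hdx : x ≠ d := by rintro rfl; exact hqxz.1 hqd
  have hdz : z ≠ d := by rintro rfl; exact hqxz.2 hqd
  have hz : ∀ w, G.Adj w z → ∃ e ∈ D, G.Adj w e ∧ e ≠ x ∧ e ≠ u ∧ e ≠ d := fun w hw =>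
    ⟨z, g.right.1, hw, g.ne.symm, g.ne_right.symm, hdz⟩
  have hwf : ∃ e ∈ D, G.Adj w e ∧ e ≠ x ∧ e ≠ u ∧ e ≠ d := by
    obtain ⟨e, he, hwe, h1, h2, h3⟩ :=
      exists_adj_ne_of_forall_mem (a := x) (b := d) hG hw3 hw.symm (fun hh => hwx hh.1)
    exact ⟨e, he, hwe, h2, h1, h3⟩
  refine h.false_of_exchange_three (v := v₃) (p := q) g.left.1 hu.1 hd g.ne_left.symm hdx hdu.symm
    (Or.inl g.adj_left) (Or.inl g.adj) (Or.inr hqd) ?_ ?_ ?_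
  · intro s hs hs1 hs2 hs3 hs4
    rcases g.eq_of_adj_left hG hs with rfl | rfl | rfl
    exacts [hz _ g.adj₁.2.1, hz _ g.adj₂.2.1, absurd rfl hs1]
  · intro s hs hs1 hs2 hs3 hs4
    rcases hN s hs with rfl | rfl | rfl
    exacts [absurd hyq hs4, absurd rfl hs1, hwf]
  · intro s hs hs1 hs2 hs3 hs4
    obtain ⟨d', hd', hsd', hne⟩ := hop.shared s hs hs2
    by_cases hdu' : d' = u
    · subst hdu'
      rcases hN s hsd'.symm with rfl | rfl | rfl
      · exact absurd (hu.eq_of_adj hd hs.symm) hdu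
      · exact absurd rfl hs1
      · exact hwf
    · refine ⟨d', hd', hsd', ?_, hdu', hne⟩
      rintro rfl
      rcases g.eq_of_adj_adj hG (Or.inl hsd') hd hs.symm with h | h | h
      exacts [hdx h.symm, hdz h.symm, hdu h]

end Gadget
end CubicDomination

/-! ### Twins: two type A vertices whose common neighbours see nothing else in `D`. -/

namespace CubicDomination
variable {V : Type*} [Fintype V] [DecidableEq V] {G : SimpleGraph V} [DecidableRel G.Adj]
variable {D : Finset V}

/-- Every neighbour of `d` has a neighbour outside `D`. -/
def Loose (G : SimpleGraph V) (D : Finset V) (d : V) : Prop :=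
  ∀ w, G.Adj d w → ∃ c, c ∉ D ∧ G.Adj w c

/-- Two vertices `x`, `z` without external private neighbours that have the same neighbours, none
of which has a further neighbour in `D`. -/
structure Twins (G : SimpleGraph V) [DecidableRel G.Adj] (D : Finset V) (x z v₁ v₂ v₃ : V) :
    Prop where
  left : IsA G D x
  right : IsA G D z
  ne : x ≠ z
  nb₁ : nb G D v₁ = {x, z}
  nb₂ : nb G D v₂ = {x, z}
  nb₃ : nb G D v₃ = {x, z}
  ne₁₂ : v₁ ≠ v₂
  ne₁₃ : v₁ ≠ v₃
  ne₂₃ : v₂ ≠ v₃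

/-- `p` can spare a part of its weight for a pair of twins. -/
def TwinGranted (G : SimpleGraph V) [DecidableRel G.Adj] (D : Finset V) (p : V) : Prop :=
  Granted G D p ∨ ∃ d, IsB G D d p ∧ Loose G D d

namespace Twins
variable {x z v₁ v₂ v₃ : V}

lemma rotate (g : Twins G D x z v₁ v₂ v₃) : Twins G D x z v₂ v₃ v₁ :=
  ⟨g.left, g.right, g.ne, g.nb₂, g.nb₃, g.nb₁, g.ne₂₃, g.ne₁₂.symm, g.ne₁₃.symm⟩

lemma swap (g : Twins G D x z v₁ v₂ v₃) : Twins G D x z v₂ v₁ v₃ :=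
  ⟨g.left, g.right, g.ne, g.nb₂, g.nb₁, g.nb₃, g.ne₁₂.symm, g.ne₂₃, g.ne₁₃⟩

lemma adj₁ (g : Twins G D x z v₁ v₂ v₃) :
    G.Adj v₁ x ∧ G.Adj v₁ z ∧ ∀ d ∈ D, G.Adj v₁ d → d = x ∨ d = z :=
  adj_iff_of_nb_eq_pair g.nb₁

lemma eq_of_adj_left (hG : G.IsRegularOfDegree 3) (g : Twins G D x z v₁ v₂ v₃) {w : V}
    (hw : G.Adj x w) : w = v₁ ∨ w = v₂ ∨ w = v₃ :=
  eq_of_adj_of_ne hG g.adj₁.1.symm g.rotate.adj₁.1.symm g.rotate.rotate.adj₁.1.symm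
    g.ne₁₂ g.ne₁₃ g.ne₂₃ hw

lemma eq_of_adj_right (hG : G.IsRegularOfDegree 3) (g : Twins G D x z v₁ v₂ v₃) {w : V}
    (hw : G.Adj z w) : w = v₁ ∨ w = v₂ ∨ w = v₃ :=
  eq_of_adj_of_ne hG g.adj₁.2.1.symm g.rotate.adj₁.2.1.symm g.rotate.rotate.adj₁.2.1.symm
    g.ne₁₂ g.ne₁₃ g.ne₂₃ hw

lemma eq_of_adj_adj (hG : G.IsRegularOfDegree 3) (g : Twins G D x z v₁ v₂ v₃) {w d : V}
    (hw : G.Adj w x ∨ G.Adj w z) (hd : d ∈ D) (hwd : G.Adj w d) : d = x ∨ d = z := by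
  have : w = v₁ ∨ w = v₂ ∨ w = v₃ :=
    hw.elim (fun h => g.eq_of_adj_left hG h.symm) fun h => g.eq_of_adj_right hG h.symm
  rcases this with rfl | rfl | rfl
  exacts [g.adj₁.2.2 d hd hwd, g.rotate.adj₁.2.2 d hd hwd, g.rotate.rotate.adj₁.2.2 d hd hwd]

lemma exists_third (hG : G.IsRegularOfDegree 3) (g : Twins G D x z v₁ v₂ v₃) :
    ∃ t, t ≠ x ∧ t ≠ z ∧ G.Adj v₁ t ∧ t ∉ D ∧ ∀ w, G.Adj v₁ w → w = x ∨ w = z ∨ w = t := by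
  obtain ⟨t, h1, h2, h3, h4⟩ := exists_third_adj hG g.adj₁.1 g.adj₁.2.1 g.ne
  exact ⟨t, h1, h2, h3, fun ht => (g.adj₁.2.2 t ht h3).elim h1 h2, h4⟩

/-- After the deletion of `x`, `z` and other vertices, a neighbour of `d` keeps a neighbour if it
has one that is neither `d` nor deleted. -/
lemma ne_of_adj (hG : G.IsRegularOfDegree 3) (g : Twins G D x z v₁ v₂ v₃) {w d d' : V}
    (hd : d ∈ D) (hw : G.Adj d w) (hwd' : G.Adj w d') (hdx : x ≠ d) (hdz : z ≠ d) :
    d' ≠ x ∧ d' ≠ z := by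
  constructor
  · rintro rfl
    rcases g.eq_of_adj_adj hG (Or.inl hwd') hd hw.symm with h | h
    exacts [hdx h.symm, hdz h.symm]
  · rintro rfl
    rcases g.eq_of_adj_adj hG (Or.inr hwd') hd hw.symm with h | h
    exacts [hdx h.symm, hdz h.symm]

/-- The set `{x, z, d}` is replaced by `{p, t}`. Other neighbours of `d` have another cover, which
is not `x` or `z` because the neighbours of the twins see only the twins in `D`. -/
lemma false_of_exchange (hG : G.IsRegularOfDegree 3) (h : LocallyOptimal G D)
    (g : Twins G D x z v₁ v₂ v₃) {t d p : V} (hd : Opener G D d t) (hdx : x ≠ d) (hdz : z ≠ d)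
    (hp : G.Adj p x ∧ G.Adj p z ∨ G.Adj t x ∧ G.Adj t z)
    (h1 : ∀ w, w = v₁ ∨ w = v₂ ∨ w = v₃ → w = p ∨ w = t ∨ G.Adj w p ∨ G.Adj w t) : False := by
  have hv : ∀ w, w = v₁ ∨ w = v₂ ∨ w = v₃ → w ≠ p → w ≠ t → ¬ G.Adj w p → ¬ G.Adj w t → False :=
    fun w hw h2 h3 h4 h5 => by rcases h1 w hw with h | h | h | h; exacts [h2 h, h3 h, h4 h, h5 h]
  refine h.false_of_exchange_three (v := p) (p := t) g.left.1 g.right.1 hd.mem g.ne hdx hdz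
    (hp.imp And.left And.left) (hp.imp And.right And.right) (Or.inr hd.adj.symm) ?_ ?_ ?_
  · intro w hw h2 h3 h4 h5
    exact (hv w (g.eq_of_adj_left hG hw) h2 h3 h4 h5).elim
  · intro w hw h2 h3 h4 h5
    exact (hv w (g.eq_of_adj_right hG hw) h2 h3 h4 h5).elim
  · intro w hw h2 h3 h4 h5
    obtain ⟨d', hd', hwd', hne⟩ := hd.shared w hw h3
    obtain ⟨h6, h7⟩ := g.ne_of_adj hG hd.mem hw hwd' hdx hdz
    exact ⟨d', hd', hwd', h6, h7, hne⟩

/-- Replacing `{x, z, d, d'}` by `{v₃, t, t'}` must fail, and it can fail only at a vertex whose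
neighbours in `D` are exactly `d` and `d'`. -/
lemma exists_blocking (hG : G.IsRegularOfDegree 3) (h : LocallyOptimal G D)
    (g : Twins G D x z v₁ v₂ v₃) {t t' d d' : V} (ht : G.Adj v₁ t) (ht' : G.Adj v₂ t')
    (hd : Opener G D d t) (hd' : Opener G D d' t') (hdx : x ≠ d) (hdz : z ≠ d) (hdx' : x ≠ d')
    (hdz' : z ≠ d') (hne : d ≠ d') :
    ∃ w, w ≠ t ∧ w ≠ t' ∧ G.Adj w d ∧ G.Adj w d' ∧ ∀ e ∈ D, G.Adj w e → e = d ∨ e = d' := by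
  by_contra hcon
  have key : ∀ w, w ≠ t → w ≠ t' → (∃ e ∈ D, G.Adj w e ∧ e ≠ d) → (∃ e ∈ D, G.Adj w e ∧ e ≠ d') →
      ∃ e ∈ D, G.Adj w e ∧ e ≠ d ∧ e ≠ d' := by
    rintro w hw1 hw2 ⟨e, he, hwe, hed⟩ ⟨f, hf, hwf, hfd⟩
    by_contra hc
    have hall : ∀ e ∈ D, G.Adj w e → e = d ∨ e = d' := fun e he hwe => by
      by_contra hh
      push Not at hh
      exact hc ⟨e, he, hwe, hh⟩
    refine hcon ⟨w, hw1, hw2, ?_, ?_, hall⟩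
    · rcases hall f hf hwf with rfl | rfl
      exacts [hwf, absurd rfl hfd]
    · rcases hall e he hwe with rfl | rfl
      exacts [absurd rfl hed, hwe]
  have g3 := g.rotate.rotate.adj₁
  refine h.false_of_exchange_four (v := v₃) (p := t) (q := t') g.left.1 g.right.1 hd.mem hd'.mem
    g.ne hdx hdx' hdz hdz' hne ?_ ?_
  · rintro r (rfl | rfl | rfl | rfl)
    exacts [Or.inl g3.1, Or.inl g3.2.1, Or.inr (Or.inl hd.adj.symm), Or.inr (Or.inr hd'.adj.symm)]
  · rintro r hr w hw h1 h2 h3 h4 h5 h6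
    have hv : w = v₁ ∨ w = v₂ ∨ w = v₃ → False := by
      rintro (rfl | rfl | rfl)
      exacts [h5 ht, h6 ht', h1 rfl]
    rcases hr with rfl | rfl | rfl | rfl
    · exact (hv (g.eq_of_adj_left hG hw)).elim
    · exact (hv (g.eq_of_adj_right hG hw)).elim
    · obtain ⟨e, he, hwe, h7, h8⟩ := key w h2 h3 (hd.shared w hw h2) ⟨r, hd.mem, hw.symm, hne⟩
      obtain ⟨h9, h10⟩ := g.ne_of_adj hG hd.mem hw hwe hdx hdz
      exact ⟨e, he, hwe, h9, h10, h7, h8⟩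
    · obtain ⟨e, he, hwe, h7, h8⟩ := key w h2 h3 ⟨r, hd'.mem, hw.symm, hne.symm⟩ (hd'.shared w hw h3)
      obtain ⟨h9, h10⟩ := g.ne_of_adj hG hd'.mem hw hwe hdx' hdz'
      exact ⟨e, he, hwe, h9, h10, h7, h8⟩

/-- The vertex `d` blocks all exchanges through the same vertex. -/
lemma eq_of_isB (hG : G.IsRegularOfDegree 3) {t d d' d'' w w' : V} (hd : IsB G D d t) (hl : ¬ Loose G D d) (htD : ∃ c, c ∉ D ∧ G.Adj t c)
    (hd' : d' ∈ D) (hdd' : d' ≠ d) (hw : G.Adj w d) (hwt : w ≠ t) (hwd : G.Adj w d')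
    (hall : ∀ e ∈ D, G.Adj w e → e = d ∨ e = d') (hw' : G.Adj w' d) (hwt' : w' ≠ t)
    (hwd' : G.Adj w' d'') (hall' : ∀ e ∈ D, G.Adj w' e → e = d ∨ e = d'') : d' = d'' := by
  have hfree : ∀ w d', G.Adj w d → (∀ e ∈ D, G.Adj w e → e = d ∨ e = d') →
      ∃ c, c ∉ D ∧ G.Adj w c := by
    intro w d' hw hall
    obtain ⟨b, c, hbc, hb, hc, hwb, hwc, -⟩ := exists_two_adj hG hw
    by_cases hbD : b ∈ D
    · refine ⟨c, fun hcD => ?_, hwc⟩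
      have h1 := (hall b hbD hwb).resolve_left hb
      have h2 := (hall c hcD hwc).resolve_left hc
      exact hbc (h1.trans h2.symm)
    · exact ⟨b, hbD, hwb⟩
  -- Both vertices have at most two neighbours in `D`, hence one outside, and so does `t`. If they
  -- were different, `t`, `w`, `w'` would be all neighbours of `d` and `d` would be loose.
  have hww : w = w' := by
    by_contra hne
    apply hl
    intro s hs
    rcases eq_of_adj_of_ne hG hd.spec.1 hw.symm hw'.symm hwt.symm hwt'.symm hne hs with rfl | rfl | rfl
    exacts [htD, hfree _ _ hw hall, hfree _ _ hw' hall']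
  subst hww
  exact (hall' d' hd' hwd).resolve_left hdd'

/-- A neighbour of one of the three common neighbours can spare a part of its weight. -/
lemma exists_granted (hG : G.IsRegularOfDegree 3) (h : LocallyOptimal G D)
    (g : Twins G D x z v₁ v₂ v₃) :
    ∃ v t, (v = v₁ ∨ v = v₂ ∨ v = v₃) ∧ G.Adj v t ∧ t ∉ D ∧ TwinGranted G D t := by
  by_contra hcon
  have hno : ∀ v t, (v = v₁ ∨ v = v₂ ∨ v = v₃) → G.Adj v t → t ∉ D → ¬ TwinGranted G D t :=
    fun v t h1 h2 h3 h4 => hcon ⟨v, t, h1, h2, h3, h4⟩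
  obtain ⟨t₁, ht₁x, ht₁z, ht₁, ht₁D, hN₁⟩ := g.exists_third hG
  obtain ⟨t₂, ht₂x, ht₂z, ht₂, ht₂D, hN₂⟩ := g.rotate.exists_third hG
  obtain ⟨t₃, ht₃x, ht₃z, ht₃, ht₃D, hN₃⟩ := g.rotate.rotate.exists_third hG
  have hn₁ := hno v₁ t₁ (by simp) ht₁ ht₁D
  have hn₂ := hno v₂ t₂ (by simp) ht₂ ht₂D
  have hn₃ := hno v₃ t₃ (by simp) ht₃ ht₃D
  have hv₁D := g.left.isolated h v₁ g.adj₁.1.symm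
  have hv₂D := g.left.isolated h v₂ g.rotate.adj₁.1.symm
  have hv₃D := g.left.isolated h v₃ g.rotate.rotate.adj₁.1.symm
  -- the neighbours in `D` of a vertex that is not granted
  have hdom : ∀ t, t ∉ D → ¬ TwinGranted G D t → (∃ d ∈ D, G.Adj t d) ∧
      ∀ d ∈ D, G.Adj t d → IsA G D d ∨ (IsB G D d t ∧ ¬ Loose G D d) := by
    intro t htD hn
    refine ⟨(h.dom t).resolve_left htD, fun d hd htd => ?_⟩
    rw [TwinGranted, not_or] at hn
    by_contra hh
    push Not at hh
    by_cases hB : IsB G D d t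
    · exact hn.2 ⟨d, hB, hh.2 hB⟩
    · exact hn.1 ⟨d, hd, htd, hh.1, hB⟩
  -- Since `t` grants nothing, each of its neighbours in `D` becomes superfluous once `t` is added.
  have hopen : ∀ t d, t ∉ D → ¬ TwinGranted G D t → d ∈ D → G.Adj t d → Opener G D d t := by
    intro t d htD hn hd htd
    rcases (hdom t htD hn).2 d hd htd with hA | hB
    exacts [hA.opener h htd.symm, hB.1.opener]
  have hne : ∀ t d, ¬ (t = v₁ ∨ t = v₂ ∨ t = v₃) → G.Adj t d → x ≠ d ∧ z ≠ d := by
    intro t d ht htd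
    constructor
    · rintro rfl; exact ht (g.eq_of_adj_left hG htd.symm)
    · rintro rfl; exact ht (g.eq_of_adj_right hG htd.symm)
  -- two of the common neighbours are adjacent
  have hadj : ∀ v v' v'' t, Twins G D x z v v' v'' → ¬ G.Adj v'' v → ¬ G.Adj v'' v' → t ∉ D →
      G.Adj v'' t → ¬ TwinGranted G D t → ¬ G.Adj v v' := by
    intro v v' v'' t g hv hv' htD ht hn hvv
    obtain ⟨⟨d, hd, htd⟩, -⟩ := hdom t htD hn
    have htv : ¬ (t = v ∨ t = v' ∨ t = v'') := by
      rintro (rfl | rfl | rfl)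
      exacts [hv ht, hv' ht, ht.ne rfl]
    have hdx : x ≠ d := by rintro rfl; exact htv (g.eq_of_adj_left hG htd.symm)
    have hdz : z ≠ d := by rintro rfl; exact htv (g.eq_of_adj_right hG htd.symm)
    refine g.false_of_exchange hG h (hopen t d htD hn hd htd) hdx hdz
      (Or.inl ⟨g.adj₁.1, g.adj₁.2.1⟩) ?_
    rintro w (rfl | rfl | rfl)
    exacts [Or.inl rfl, Or.inr (Or.inr (Or.inl hvv.symm)), Or.inr (Or.inr (Or.inr ht))]
  have hvx : ∀ v ∉ D, v ≠ x ∧ v ≠ z := fun v hv =>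
    ⟨by rintro rfl; exact hv g.left.1, by rintro rfl; exact hv g.right.1⟩
  have hone₁ : ∀ v v', v ∉ D → v' ∉ D → G.Adj v₁ v → G.Adj v₁ v' → v = v' := fun v v' hv hv' h1 h2 => by
    have a1 := hN₁ v h1; have a2 := hN₁ v' h2; have := hvx v hv; have := hvx v' hv'; grind
  have hone₂ : ∀ v v', v ∉ D → v' ∉ D → G.Adj v₂ v → G.Adj v₂ v' → v = v' := fun v v' hv hv' h1 h2 => by
    have a1 := hN₂ v h1; have a2 := hN₂ v' h2; have := hvx v hv; have := hvx v' hv'; grind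
  have hone₃ : ∀ v v', v ∉ D → v' ∉ D → G.Adj v₃ v → G.Adj v₃ v' → v = v' := fun v v' hv hv' h1 h2 => by
    have a1 := hN₃ v h1; have a2 := hN₃ v' h2; have := hvx v hv; have := hvx v' hv'; grind
  have h12 : ¬ G.Adj v₁ v₂ := fun hh =>
    hadj v₁ v₂ v₃ t₃ g (fun h3 => g.ne₂₃ (hone₁ v₂ v₃ hv₂D hv₃D hh h3.symm))
      (fun h3 => g.ne₁₃ (hone₂ v₁ v₃ hv₁D hv₃D hh.symm h3.symm)) ht₃D ht₃ hn₃ hh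
  have h23 : ¬ G.Adj v₂ v₃ := fun hh =>
    hadj v₂ v₃ v₁ t₁ g.rotate (fun h3 => h12 h3)
      (fun h3 => g.ne₁₂ (hone₃ v₁ v₂ hv₁D hv₂D h3.symm hh.symm)) ht₁D ht₁ hn₁ hh
  have h13 : ¬ G.Adj v₃ v₁ := fun hh =>
    hadj v₃ v₁ v₂ t₂ g.rotate.rotate (fun h3 => h23 h3) (fun h3 => h12 h3.symm) ht₂D ht₂ hn₂ hh
  have hv₁ : ¬ (t₁ = v₁ ∨ t₁ = v₂ ∨ t₁ = v₃) := by
    rintro (rfl | rfl | rfl); exacts [ht₁.ne rfl, h12 ht₁, h13 ht₁.symm]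
  have hv₂ : ¬ (t₂ = v₁ ∨ t₂ = v₂ ∨ t₂ = v₃) := by
    rintro (rfl | rfl | rfl); exacts [h12 ht₂.symm, ht₂.ne rfl, h23 ht₂]
  have hv₃ : ¬ (t₃ = v₁ ∨ t₃ = v₂ ∨ t₃ = v₃) := by
    rintro (rfl | rfl | rfl); exacts [h13 ht₃, h23 ht₃.symm, ht₃.ne rfl]
  -- the further neighbours are different
  have hsame : ∀ v v' v'' t, Twins G D x z v v' v'' → t ∉ D → G.Adj v t → G.Adj v' t →
      ¬ (t = v ∨ t = v' ∨ t = v'') → ¬ TwinGranted G D t → False := by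
    intro v v' v'' t g htD h1 h2 htv hn
    obtain ⟨⟨d, hd, htd⟩, -⟩ := hdom t htD hn
    have hdx : x ≠ d := by rintro rfl; exact htv (g.eq_of_adj_left hG htd.symm)
    have hdz : z ≠ d := by rintro rfl; exact htv (g.eq_of_adj_right hG htd.symm)
    refine g.false_of_exchange hG h (hopen t d htD hn hd htd) hdx hdz
      (Or.inl ⟨g.rotate.rotate.adj₁.1, g.rotate.rotate.adj₁.2.1⟩) ?_
    rintro w (rfl | rfl | rfl)
    exacts [Or.inr (Or.inr (Or.inr h1)), Or.inr (Or.inr (Or.inr h2)), Or.inl rfl]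
  have ht12 : t₁ ≠ t₂ := by
    rintro rfl
    exact hsame v₁ v₂ v₃ t₁ g ht₁D ht₁ ht₂ hv₁ hn₁
  have ht23 : t₂ ≠ t₃ := by
    rintro rfl
    exact hsame v₂ v₃ v₁ t₂ g.rotate ht₂D ht₂ ht₃ (by tauto) hn₂
  have ht13 : t₁ ≠ t₃ := by
    rintro rfl
    exact hsame v₃ v₁ v₂ t₁ g.rotate.rotate ht₁D ht₃ ht₁ (by tauto) hn₁
  -- blocking vertices
  have hblock : ∀ v v' v'' t t' d d', Twins G D x z v v' v'' → t ∉ D → t' ∉ D → G.Adj v t →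
      G.Adj v' t' → ¬ (t = v₁ ∨ t = v₂ ∨ t = v₃) → ¬ (t' = v₁ ∨ t' = v₂ ∨ t' = v₃) →
      ¬ TwinGranted G D t → ¬ TwinGranted G D t' → d ∈ D → d' ∈ D → G.Adj t d → G.Adj t' d' →
      d ≠ d' → ∃ w, w ≠ t ∧ w ≠ t' ∧ G.Adj w d ∧ G.Adj w d' ∧
        ∀ e ∈ D, G.Adj w e → e = d ∨ e = d' := by
    intro v v' v'' t t' d d' g htD htD' ht ht' hv hv' hn hn' hd hd' htd htd' hdd
    have h1 := hne t d hv htd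
    have h2 := hne t' d' hv' htd'
    exact g.exists_blocking hG h ht ht' (hopen t d htD hn hd htd) (hopen t' d' htD' hn' hd' htd')
      h1.1 h1.2 h2.1 h2.2 hdd
  -- no neighbour has an external private neighbour
  have hnoB : ∀ u u' u'' t t' t'', Twins G D x z u u' u'' → t ∉ D → t' ∉ D → t'' ∉ D → G.Adj u t →
      G.Adj u' t' → G.Adj u'' t'' → ¬ (t = v₁ ∨ t = v₂ ∨ t = v₃) →
      ¬ (t' = v₁ ∨ t' = v₂ ∨ t' = v₃) → ¬ (t'' = v₁ ∨ t'' = v₂ ∨ t'' = v₃) →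
      ¬ TwinGranted G D t → ¬ TwinGranted G D t' → ¬ TwinGranted G D t'' → t ≠ t' → t ≠ t'' →
      t' ≠ t'' → ∀ d ∈ D, G.Adj t d → IsA G D d := by
    intro u u' u'' t t' t'' g htD htD' htD'' ht ht' ht'' hv hv' hv'' hn hn' hn'' h1 h2 h3 d hd htd
    by_contra hA
    obtain ⟨hB, hl⟩ := ((hdom t htD hn).2 d hd htd).resolve_left hA
    have htc : ∃ c, c ∉ D ∧ G.Adj t c := ⟨u, g.left.isolated h u g.adj₁.1.symm, ht.symm⟩
    have hneB : ∀ s e, s ≠ t → s ∉ D → ¬ TwinGranted G D s → G.Adj s e → e ∈ D → d ≠ e := by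
      rintro s e hst hsD hns hse he rfl
      rcases (hdom s hsD hns).2 d he hse with hA' | hB'
      · exact hA hA'
      · exact hst (Finset.singleton_injective (hB'.1.2.2.symm.trans hB.2.2))
    -- The blocking vertices for `d, e` and for `d, f` coincide by `eq_of_isB`. So `t'` and `t''`
    -- would have the same single neighbour in `D`, which can be neither of type A nor of type B
    -- with both as its private neighbour.
    have heq : ∀ e ∈ D, ∀ f ∈ D, G.Adj t' e → G.Adj t'' f → e = f := by
      intro e he f hf hte htf
      have hde := hneB t' e h1.symm htD' hn' hte he
      have hdf := hneB t'' f h2.symm htD'' hn'' htf hf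
      obtain ⟨w, hw1, -, hw3, hw4, hw5⟩ :=
        hblock u u' u'' t t' d e g htD htD' ht ht' hv hv' hn hn' hd he htd hte hde
      obtain ⟨w', hw1', -, hw3', hw4', hw5'⟩ :=
        hblock u u'' u' t t'' d f g.swap.rotate htD htD'' ht ht'' hv hv'' hn hn'' hd hf
          htd htf hdf
      exact eq_of_isB hG hB hl htc he hde.symm hw3 hw1 hw4 hw5 hw3' hw1' hw4' hw5'
    obtain ⟨⟨e, he, hte⟩, he'⟩ := hdom t' htD' hn'
    obtain ⟨⟨f, hf, htf⟩, hf'⟩ := hdom t'' htD'' hn''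
    have hef := heq e he f hf hte htf
    subst hef
    rcases he' e he hte with hA' | hB'
    · obtain ⟨e', h4, h5, h6⟩ := hA'.shared h hte.symm
      exact h6 (heq e' h4 e he h5 htf)
    · rcases hf' e he htf with hA'' | hB''
      · exact hB'.1.not_isA hA''
      · exact h3 (Finset.singleton_injective (hB'.1.2.2.symm.trans hB''.1.2.2))
  have hA₁ := hnoB v₁ v₂ v₃ t₁ t₂ t₃ g ht₁D ht₂D ht₃D ht₁ ht₂ ht₃ hv₁ hv₂ hv₃ hn₁ hn₂ hn₃
    ht12 ht13 ht23
  have hA₂ := hnoB v₂ v₃ v₁ t₂ t₃ t₁ g.rotate ht₂D ht₃D ht₁D ht₂ ht₃ ht₁ hv₂ hv₃ hv₁ hn₂ hn₃ hn₁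
    ht23 ht12.symm ht13.symm
  have hA₃ := hnoB v₃ v₁ v₂ t₃ t₁ t₂ g.rotate.rotate ht₃D ht₁D ht₂D ht₃ ht₁ ht₂ hv₃ hv₁ hv₂
    hn₃ hn₁ hn₂ ht13.symm ht23.symm ht12
  obtain ⟨⟨a, ha, hta⟩, -⟩ := hdom t₁ ht₁D hn₁
  have haA := hA₁ a ha hta
  obtain ⟨a', ha', hta', hne'⟩ := haA.shared h hta.symm
  have haA' := hA₁ a' ha' hta'
  -- All vertices involved are now of type A, so the blocking vertices show them to be partners.
  -- Consequently `t₁`, `t₂`, `t₃` are exactly the neighbours of both `a` and `a'`.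
  have hpair : ∀ b, IsA G D b → (∃ w, G.Adj w a ∧ G.Adj w b) → a ≠ b → b = a' := by
    rintro b hb ⟨w, hwa, hwb⟩ hab
    exact haA.pair_unique hG h hb haA' hab hne'.symm hwa hwb hta hta'
  have htwo : ∀ t, t ∉ D → ¬ TwinGranted G D t → (∀ b ∈ D, G.Adj t b → IsA G D b) →
      (∀ b ∈ D, G.Adj t b → a ≠ b → ∃ w, G.Adj w a ∧ G.Adj w b) → G.Adj t a ∧ G.Adj t a' := by
    intro t htD hn hA hb
    obtain ⟨⟨b, hbD, htb⟩, -⟩ := hdom t htD hn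
    obtain ⟨c, hcD, htc, hcb⟩ := (hA b hbD htb).shared h htb.symm
    have key : ∀ b ∈ D, G.Adj t b → b = a ∨ b = a' := fun b hbD htb => by
      by_cases hab : a = b
      · exact Or.inl hab.symm
      · exact Or.inr (hpair b (hA b hbD htb) (hb b hbD htb hab) hab)
    rcases key b hbD htb with rfl | rfl <;> rcases key c hcD htc with rfl | rfl
    exacts [absurd rfl hcb, ⟨htb, htc⟩, ⟨htc, htb⟩, absurd rfl hcb]
  obtain ⟨h2a, h2a'⟩ := htwo t₂ ht₂D hn₂ hA₂ fun b hb htb hab => by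
    obtain ⟨w, -, -, h1, h2, -⟩ := hblock v₁ v₂ v₃ t₁ t₂ a b g ht₁D ht₂D ht₁ ht₂ hv₁ hv₂ hn₁ hn₂ ha
      hb hta htb hab
    exact ⟨w, h1, h2⟩
  obtain ⟨h3a, h3a'⟩ := htwo t₃ ht₃D hn₃ hA₃ fun b hb htb hab => by
    obtain ⟨w, -, -, h1, h2, -⟩ := hblock v₁ v₃ v₂ t₁ t₃ a b g.swap.rotate ht₁D ht₃D ht₁
      ht₃ hv₁ hv₃ hn₁ hn₃ ha hb hta htb hab
    exact ⟨w, h1, h2⟩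
  have hxa := hne t₁ a hv₁ hta
  have hxa' := hne t₁ a' hv₁ hta'
  -- The set `{x, z, a, a'}` is replaced by `{v₁, t₂, v₃}`: `v₁` and `v₃` cover the twins, `t₁` and
  -- `t₃`, and `t₂` covers `a`, `a'` and `v₂`.
  refine h.false_of_exchange_four (v := v₁) (p := t₂) (q := v₃) g.left.1 g.right.1 ha ha' g.ne
    hxa.1 hxa'.1 hxa.2 hxa'.2 hne'.symm ?_ ?_
  · rintro r (rfl | rfl | rfl | rfl)
    exacts [Or.inl g.adj₁.1, Or.inl g.adj₁.2.1, Or.inr (Or.inl h2a), Or.inr (Or.inl h2a')]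
  · rintro r hr w hw h1 h2 h3 h4 h5 h6
    exfalso
    have hv : ¬ (w = v₁ ∨ w = v₂ ∨ w = v₃) := by
      rintro (rfl | rfl | rfl); exacts [h1 rfl, h5 ht₂, h3 rfl]
    have ht : ¬ (w = t₁ ∨ w = t₂ ∨ w = t₃) := by
      rintro (rfl | rfl | rfl); exacts [h4 ht₁.symm, h2 rfl, h6 ht₃.symm]
    rcases hr with rfl | rfl | rfl | rfl
    · exact hv (g.eq_of_adj_left hG hw)
    · exact hv (g.eq_of_adj_right hG hw)
    · exact ht (eq_of_adj_of_ne hG hta.symm h2a.symm h3a.symm ht12 ht13 ht23 hw)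
    · exact ht (eq_of_adj_of_ne hG hta'.symm h2a'.symm h3a'.symm ht12 ht13 ht23 hw)

end Twins
end CubicDomination

/-! ### The discharging rules and their balance. -/

namespace CubicDomination
variable {V : Type*} [Fintype V] [DecidableEq V] {G : SimpleGraph V} [DecidableRel G.Adj]
variable {D : Finset V}

/-- The number of neighbours of `v` in `D` without external private neighbours. -/
noncomputable def countA (G : SimpleGraph V) [DecidableRel G.Adj] (D : Finset V) (v : V) : ℕ :=
  open Classical in ((nb G D v).filter (IsA G D)).card

/-- `g` is the external private neighbour of a vertex whose other neighbours have all their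
neighbours in `D`. -/
def Needy (G : SimpleGraph V) [DecidableRel G.Adj] (D : Finset V) (g : V) : Prop :=
  ∃ z, IsB G D z g ∧ ∀ w, G.Adj z w → w ≠ g → ∀ e, G.Adj w e → e ∈ D

/-- `v` is the middle of a gadget one of whose requests is refused. -/
def Special (G : SimpleGraph V) [DecidableRel G.Adj] (D : Finset V) (v : V) : Prop :=
  ∃ x z v₁ v₂ u y, Gadget G D x z v₁ v₂ v u ∧ IsB G D u y ∧ G.Adj v₁ y

/-- The weight that `g` requests from `p` and `p` grants. -/
noncomputable def request (G : SimpleGraph V) [DecidableRel G.Adj] (D : Finset V) (g p : V) : ℝ :=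
  open Classical in
  if G.Adj g p ∧ g ∉ D ∧ p ∉ D then
    -- The amounts decrease from case to case, so a vertex that qualifies for several requests
    -- receives at least what each of them asks for.
    if (∃ x z v₂ v₃ u, Gadget G D x z g v₂ v₃ u) ∧ Eligible G D p then 1 / 6
    else if Needy G D g ∧ Granted G D p then 108 / 1000
    else if (∃ x z v₂ v₃, Twins G D x z g v₂ v₃) ∧ TwinGranted G D p then 54 / 1000
    else 0
  else 0

/-- The weight that `v` receives. -/
noncomputable def inflow (G : SimpleGraph V) [DecidableRel G.Adj] (D : Finset V) (v : V) : ℝ :=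
  ∑ p, request G D v p

/-- The weight that `v` grants. -/
noncomputable def outflow (G : SimpleGraph V) [DecidableRel G.Adj] (D : Finset V) (v : V) : ℝ :=
  ∑ g, request G D g v

/-- The part of the weight `1` of `v` for its neighbour `d` in `D`, before requests. -/
noncomputable def base (G : SimpleGraph V) [DecidableRel G.Adj] (D : Finset V) (v d : V) : ℝ :=
  open Classical in
  -- A type A vertex needs 1.527 from its neighbours. If two of them give it 1/2 each, the third
  -- must give 0.527; this fixes 527/1000, and the remainder goes to the other neighbours in `D`. At
  -- a special middle both type A vertices get 11/160 more, and the third vertex pays 11/80.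
  if (nb G D v).card = 3 ∧ countA G D v = 1 then
    if IsA G D d then 527 / 1000 else 473 / 2000
  else if (nb G D v).card = 3 ∧ countA G D v = 2 then
    if IsA G D d then 3 / 8 + (if Special G D v then 11 / 160 else 0)
    else 1 / 4 - (if Special G D v then 11 / 80 else 0)
  else if (nb G D v).card = 2 ∧ countA G D v = 1 then
    if IsA G D d then 527 / 1000 else 473 / 1000
  else 1 / ((nb G D v).card : ℝ)

/-- The part of the flow through `v` that is charged to its neighbour `d` in `D`. -/
noncomputable def split (G : SimpleGraph V) [DecidableRel G.Adj] (D : Finset V) (v d : V) : ℝ :=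
  open Classical in
  -- All of the flow is charged to the neighbour that is not of type A, so that the type A neighbour
  -- keeps its 0.527.
  if (nb G D v).card = 2 ∧ countA G D v = 1 then if IsA G D d then 0 else 1
  else 1 / ((nb G D v).card : ℝ)

/-- The weight that `d` gets from its neighbour `v`. -/
noncomputable def share (G : SimpleGraph V) [DecidableRel G.Adj] (D : Finset V) (v d : V) : ℝ :=
  base G D v d + (inflow G D v - outflow G D v) * split G D v d

lemma request_nonneg (g p : V) : 0 ≤ request G D g p := by
  unfold request
  split_ifs <;> norm_num

lemma inflow_nonneg (v : V) : 0 ≤ inflow G D v := Finset.sum_nonneg fun _ _ => request_nonneg _ _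

lemma request_le_inflow (g p : V) : request G D g p ≤ inflow G D g :=
  Finset.single_le_sum (f := fun p => request G D g p) (fun _ _ => request_nonneg _ _)
    (Finset.mem_univ p)

lemma sum_inflow_eq_sum_outflow : ∑ v, inflow G D v = ∑ v, outflow G D v := Finset.sum_comm

lemma request_eq_zero {g p : V} (h : g ∈ D ∨ p ∈ D) : request G D g p = 0 := by
  unfold request
  rw [if_neg (by tauto)]

lemma inflow_of_mem {v : V} (hv : v ∈ D) : inflow G D v = 0 :=
  Finset.sum_eq_zero fun _ _ => request_eq_zero (Or.inl hv)

lemma outflow_of_mem {v : V} (hv : v ∈ D) : outflow G D v = 0 :=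
  Finset.sum_eq_zero fun _ _ => request_eq_zero (Or.inr hv)

lemma sum_ite_isA (v : V) (α β : ℝ) :
    (open Classical in ∑ d ∈ nb G D v, if IsA G D d then α else β) =
      countA G D v * α + ((nb G D v).card - countA G D v) * β := by
  classical
  have h := Finset.card_filter_add_card_filter_not (s := nb G D v) (IsA G D)
  have h' : ((nb G D v).card : ℝ) = ((nb G D v).filter (IsA G D)).card +
      ((nb G D v).filter fun d => ¬ IsA G D d).card := by exact_mod_cast h.symm
  have h2 : countA G D v = ((nb G D v).filter (IsA G D)).card := by unfold countA; congr
  rw [Finset.sum_ite, Finset.sum_const, Finset.sum_const, h2, h']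
  simp only [nsmul_eq_mul]
  ring

lemma sum_base {v : V} (hv : (nb G D v).Nonempty) : ∑ d ∈ nb G D v, base G D v d = 1 := by
  classical
  have hpos : ((nb G D v).card : ℝ) ≠ 0 := by
    have := Finset.card_pos.2 hv
    positivity
  unfold base
  by_cases h1 : (nb G D v).card = 3 ∧ countA G D v = 1
  · simp only [if_pos h1]
    rw [sum_ite_isA, h1.1, h1.2]; norm_num
  simp only [if_neg h1]
  by_cases h2 : (nb G D v).card = 3 ∧ countA G D v = 2
  · simp only [if_pos h2]
    rw [sum_ite_isA, h2.1, h2.2]; split_ifs <;> norm_num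
  simp only [if_neg h2]
  by_cases h3 : (nb G D v).card = 2 ∧ countA G D v = 1
  · simp only [if_pos h3]
    rw [sum_ite_isA, h3.1, h3.2]; norm_num
  simp only [if_neg h3]
  rw [Finset.sum_const, nsmul_eq_mul, mul_one_div_cancel hpos]

lemma sum_split {v : V} (hv : (nb G D v).Nonempty) : ∑ d ∈ nb G D v, split G D v d = 1 := by
  classical
  have hpos : ((nb G D v).card : ℝ) ≠ 0 := by
    have := Finset.card_pos.2 hv
    positivity
  unfold split
  by_cases h3 : (nb G D v).card = 2 ∧ countA G D v = 1
  · simp only [if_pos h3]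
    rw [sum_ite_isA, h3.1, h3.2]; norm_num
  simp only [if_neg h3]
  rw [Finset.sum_const, nsmul_eq_mul, mul_one_div_cancel hpos]

lemma sum_share {v : V} (hv : (nb G D v).Nonempty) :
    ∑ d ∈ nb G D v, share G D v d = 1 + (inflow G D v - outflow G D v) := by
  unfold share
  rw [Finset.sum_add_distrib, sum_base hv, ← Finset.mul_sum, sum_split hv, mul_one]

/-- The weight that `d` gets in total. -/
noncomputable def total (G : SimpleGraph V) [DecidableRel G.Adj] (D : Finset V) (d : V) : ℝ :=
  1 + ∑ v ∈ (G.neighborFinset d).filter (· ∉ D), share G D v d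

/-- The shares of a vertex outside `D` add up to 1 plus its inflow minus its outflow, and every
request is counted once as inflow and once as outflow. -/
lemma sum_total (h : Dominates G D) : ∑ d ∈ D, total G D d = Fintype.card V := by
  have hne : ∀ v ∉ D, (nb G D v).Nonempty := fun v hv => by
    obtain ⟨d, hd, hvd⟩ := (h v).resolve_left hv
    exact ⟨d, by simp [hd, hvd]⟩
  have h1 : ∑ d ∈ D, ∑ v ∈ (G.neighborFinset d).filter (· ∉ D), share G D v d =
      ∑ v ∈ Dᶜ, ∑ d ∈ nb G D v, share G D v d := by
    refine Finset.sum_comm' fun d v => ?_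
    simp only [Finset.mem_filter, SimpleGraph.mem_neighborFinset, mem_nb, Finset.mem_compl]
    rw [G.adj_comm]; tauto
  have h2 : ∑ v ∈ Dᶜ, ∑ d ∈ nb G D v, share G D v d =
      ∑ v ∈ Dᶜ, (1 + (inflow G D v - outflow G D v)) :=
    Finset.sum_congr rfl fun v hv => sum_share (hne v (Finset.mem_compl.1 hv))
  have h3 : ∑ v ∈ Dᶜ, (inflow G D v - outflow G D v) = 0 := by
    have h4 : ∑ v ∈ D, (inflow G D v - outflow G D v) = 0 :=
      Finset.sum_eq_zero fun v hv => by rw [inflow_of_mem hv, outflow_of_mem hv, sub_zero]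
    have h5 := Finset.sum_add_sum_compl D fun v => inflow G D v - outflow G D v
    rw [h4, zero_add] at h5
    rw [h5, Finset.sum_sub_distrib, sum_inflow_eq_sum_outflow, sub_self]
  unfold total
  rw [Finset.sum_add_distrib, h1, h2, Finset.sum_add_distrib, h3, Finset.sum_const,
    Finset.sum_const, nsmul_eq_mul, nsmul_eq_mul, mul_one, mul_one, add_zero]
  exact_mod_cast Finset.card_add_card_compl D

lemma total_eq {d a b c : V} (hG : G.IsRegularOfDegree 3) (ha : G.Adj d a) (hb : G.Adj d b)
    (hc : G.Adj d c) (hab : a ≠ b) (hac : a ≠ c) (hbc : b ≠ c) (haD : a ∉ D) (hbD : b ∉ D)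
    (hcD : c ∉ D) : total G D d = 1 + (share G D a d + share G D b d + share G D c d) := by
  have h : (G.neighborFinset d).filter (· ∉ D) = {a, b, c} := by
    ext w
    simp only [Finset.mem_filter, SimpleGraph.mem_neighborFinset, Finset.mem_insert,
      Finset.mem_singleton]
    constructor
    · rintro ⟨h1, -⟩; exact eq_of_adj_of_ne hG ha hb hc hab hac hbc h1
    · rintro (rfl | rfl | rfl); exacts [⟨ha, haD⟩, ⟨hb, hbD⟩, ⟨hc, hcD⟩]
  rw [total, h, Finset.sum_insert (by simp [hab, hac]), Finset.sum_pair hbc, add_assoc]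

lemma card_nb_eq (hG : G.IsRegularOfDegree 3) {v d b c : V} (hd : G.Adj v d) (hb : G.Adj v b)
    (hc : G.Adj v c) (hbd : b ≠ d) (hcd : c ≠ d) (hbc : b ≠ c) (hdD : d ∈ D) :
    (nb G D v).card = 1 + (if b ∈ D then 1 else 0) + (if c ∈ D then 1 else 0) := by
  have h : nb G D v = ({d, b, c} : Finset V).filter (· ∈ D) := by
    ext w
    simp only [mem_nb, Finset.mem_filter, Finset.mem_insert, Finset.mem_singleton]
    constructor
    · rintro ⟨h1, h2⟩; exact ⟨eq_of_adj_of_ne hG hd hb hc hbd.symm hcd.symm hbc h1, h2⟩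
    · rintro ⟨rfl | rfl | rfl, h2⟩; exacts [⟨hd, h2⟩, ⟨hb, h2⟩, ⟨hc, h2⟩]
  rw [h, Finset.card_filter, Finset.sum_insert (by simp [hbd.symm, hcd.symm]), Finset.sum_pair hbc,
    if_pos hdD, add_assoc]

lemma countA_eq (hG : G.IsRegularOfDegree 3) {v d b c : V} (hd : G.Adj v d) (hb : G.Adj v b)
    (hc : G.Adj v c) (hbd : b ≠ d) (hcd : c ≠ d) (hbc : b ≠ c) :
    countA G D v = (open Classical in (if IsA G D d then 1 else 0) + (if IsA G D b then 1 else 0) +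
      (if IsA G D c then 1 else 0)) := by
  classical
  have h : (nb G D v).filter (IsA G D) = ({d, b, c} : Finset V).filter (IsA G D) := by
    ext w
    simp only [mem_nb, Finset.mem_filter, Finset.mem_insert, Finset.mem_singleton]
    constructor
    · rintro ⟨⟨h1, -⟩, h2⟩; exact ⟨eq_of_adj_of_ne hG hd hb hc hbd.symm hcd.symm hbc h1, h2⟩
    · rintro ⟨rfl | rfl | rfl, h2⟩; exacts [⟨⟨hd, h2.1⟩, h2⟩, ⟨⟨hb, h2.1⟩, h2⟩, ⟨⟨hc, h2.1⟩, h2⟩]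
  have h2 : countA G D v = ((nb G D v).filter (IsA G D)).card := by unfold countA; congr
  rw [h2, h, Finset.card_filter, Finset.sum_insert (by simp [hbd.symm, hcd.symm]),
    Finset.sum_pair hbc, add_assoc]

/-- The flow out of `p` is bounded by the number of neighbours outside `D`. -/
lemma outflow_le (hG : G.IsRegularOfDegree 3) {p d b c : V} {m : ℝ} (hd : G.Adj p d)
    (hb : G.Adj p b) (hc : G.Adj p c) (hbd : b ≠ d) (hcd : c ≠ d) (hbc : b ≠ c) (hdD : d ∈ D)
    (hm : ∀ g, request G D g p ≤ m) :
    outflow G D p ≤ (if b ∈ D then 0 else m) + (if c ∈ D then 0 else m) := by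
  have h : outflow G D p = ∑ g ∈ ({d, b, c} : Finset V), request G D g p := by
    refine (Finset.sum_subset (Finset.subset_univ _) fun g _ hg => ?_).symm
    have : ¬ G.Adj g p := fun hgp => hg (by
      simpa using eq_of_adj_of_ne hG hd hb hc hbd.symm hcd.symm hbc hgp.symm)
    unfold request
    rw [if_neg (by tauto)]
  rw [h, Finset.sum_insert (by simp [hbd.symm, hcd.symm]), Finset.sum_pair hbc,
    request_eq_zero (Or.inl hdD), zero_add]
  refine add_le_add ?_ ?_ <;> split_ifs with h1
  exacts [(request_eq_zero (Or.inl h1)).le, hm _, (request_eq_zero (Or.inl h1)).le, hm _]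

lemma request_le (g p : V) : request G D g p ≤ 1 / 6 := by
  unfold request
  split_ifs <;> norm_num

lemma request_le_of_not_eligible {p : V} (hp : ¬ Eligible G D p) (g : V) :
    request G D g p ≤ 108 / 1000 := by
  unfold request
  split_ifs with h1 h2 <;> first | exact absurd h2.2 hp | norm_num

lemma request_le_of_not_granted {p : V} (hp : ¬ Eligible G D p) (hp' : ¬ Granted G D p) (g : V) :
    request G D g p ≤ 54 / 1000 := by
  unfold request
  split_ifs with h1 h2 h3 <;> first | exact absurd h2.2 hp | exact absurd h3.2 hp' | norm_num

lemma request_le_zero {p : V} (hp : ¬ Eligible G D p) (hp' : ¬ TwinGranted G D p) (g : V) :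
    request G D g p ≤ 0 := by
  unfold request
  split_ifs with h1 h2 h3 h4 <;> first
    | exact absurd h2.2 hp | exact absurd (Or.inl h3.2) hp' | exact absurd h4.2 hp' | norm_num

end CubicDomination

/-! ### The weight of type A vertices. -/

namespace CubicDomination
variable {V : Type*} [Fintype V] [DecidableEq V] {G : SimpleGraph V} [DecidableRel G.Adj]
variable {D : Finset V}

lemma card_nb_le (hG : G.IsRegularOfDegree 3) (v : V) : (nb G D v).card ≤ 3 := by
  have h := hG v
  rw [← G.card_neighborFinset_eq_degree] at h
  exact h ▸ Finset.card_filter_le _ _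

lemma mem_of_card_nb (hG : G.IsRegularOfDegree 3) {v w : V} (h3 : (nb G D v).card = 3)
    (hw : G.Adj v w) : w ∈ D := by
  have h := hG v
  rw [← G.card_neighborFinset_eq_degree] at h
  have := Finset.eq_of_subset_of_card_le (Finset.filter_subset (· ∈ D) (G.neighborFinset v))
    (by rw [h]; exact h3.ge)
  have hw' : w ∈ G.neighborFinset v := by simpa using hw
  rw [← this] at hw'
  exact (Finset.mem_filter.1 hw').2

lemma two_le_card_nb {v d d' : V} (hd : d ∈ D) (hd' : d' ∈ D) (hv : G.Adj v d) (hv' : G.Adj v d')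
    (hne : d' ≠ d) : 2 ≤ (nb G D v).card :=
  Finset.one_lt_card.2 ⟨d, mem_nb.2 ⟨hv, hd⟩, d', mem_nb.2 ⟨hv', hd'⟩, hne.symm⟩

lemma outflow_le_mul (hG : G.IsRegularOfDegree 3) {p d : V} {m : ℝ} (hd : G.Adj p d) (hdD : d ∈ D)
    (hm : ∀ g, request G D g p ≤ m) :
    outflow G D p ≤ (3 - ((nb G D p).card : ℝ)) * m := by
  obtain ⟨b, c, hbc, hbd, hcd, hb, hc, -⟩ := exists_two_adj hG hd
  refine (outflow_le hG hd hb hc hbd hcd hbc hdD hm).trans (le_of_eq ?_)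
  rw [card_nb_eq hG hd hb hc hbd hcd hbc hdD]
  split_ifs <;> push_cast <;> ring

lemma countA_le_two (hG : G.IsRegularOfDegree 3) (h : LocallyOptimal G D) (v : V) :
    countA G D v ≤ 2 := by
  classical
  by_contra hlt
  have h2 : 2 < ((nb G D v).filter (IsA G D)).card := by
    have : countA G D v = ((nb G D v).filter (IsA G D)).card := by unfold countA; congr
    omega
  obtain ⟨a, b, c, ha, hb, hc, hab, hac, hbc⟩ := Finset.two_lt_card_iff.1 h2
  simp only [Finset.mem_filter, mem_nb] at ha hb hc
  exact hbc (ha.2.pair_unique hG h hb.2 hc.2 hab hac ha.1.1 hb.1.1 ha.1.1 hc.1.1)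

lemma countA_lt {v d : V} (hdD : d ∈ D) (hd : ¬ IsA G D d) (hv : G.Adj v d) :
    countA G D v < (nb G D v).card := by
  classical
  unfold countA
  refine Finset.card_lt_card ((Finset.ssubset_iff_of_subset (Finset.filter_subset _ _)).2
    ⟨d, mem_nb.2 ⟨hv, hdD⟩, fun hh => hd (Finset.mem_filter.1 hh).2⟩)

lemma exists_isA_of_countA_pos {v : V} (hv : countA G D v ≠ 0) : ∃ a, IsA G D a ∧ G.Adj v a := by
  classical
  unfold countA at hv
  obtain ⟨a, ha⟩ := Finset.card_pos.1 (Nat.pos_of_ne_zero hv)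
  simp only [Finset.mem_filter, mem_nb] at ha
  exact ⟨a, ha.2, ha.1.1⟩

lemma countA_eq_zero {v : V} (hv : ∀ a, G.Adj v a → ¬ IsA G D a) : countA G D v = 0 := by
  by_contra hne
  obtain ⟨a, ha, hva⟩ := exists_isA_of_countA_pos hne
  exact hv a hva ha

lemma countA_eq_one {v d : V} (hd : IsA G D d) (hv : G.Adj v d)
    (h : ∀ a, G.Adj v a → a ≠ d → ¬ IsA G D a) : countA G D v = 1 := by
  classical
  unfold countA
  refine Finset.card_eq_one.2 ⟨d, ?_⟩
  ext a
  simp only [Finset.mem_filter, mem_nb, Finset.mem_singleton]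
  constructor
  · rintro ⟨⟨h1, -⟩, h2⟩
    by_contra hne
    exact h a h1 hne h2
  · rintro rfl; exact ⟨⟨hv, hd.1⟩, hd⟩

lemma split_nonneg (v d : V) : 0 ≤ split G D v d := by
  unfold split
  split_ifs <;> positivity

lemma outflow_of_card_three (hG : G.IsRegularOfDegree 3) {v d : V} (hd : G.Adj v d) (hdD : d ∈ D)
    (h3 : (nb G D v).card = 3) : outflow G D v ≤ 0 := by
  have := outflow_le_mul hG hd hdD (fun g => request_le (G := G) (D := D) g v)
  rw [h3] at this
  norm_num at this
  exact this

lemma not_eligible_of_isA {v d : V} (hd : IsA G D d) (hv : G.Adj v d) : ¬ Eligible G D v :=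
  fun h => (h d hd.1 hv).1 hd

/-- All neighbours of `v` are in `D`, so nobody requests weight from it. -/
lemma base_le_share (hG : G.IsRegularOfDegree 3) {v d : V} (hv : G.Adj v d) (hdD : d ∈ D)
    (h3 : (nb G D v).card = 3) : base G D v d ≤ share G D v d := by
  have h1 := outflow_of_card_three hG hv hdD h3
  have h2 := inflow_nonneg (G := G) (D := D) v
  have := mul_nonneg (sub_nonneg.2 (h1.trans h2)) (split_nonneg (G := G) (D := D) v d)
  unfold share
  linarith

/-! ### Vertices without external private neighbours -/

lemma share_of_countA_one (hG : G.IsRegularOfDegree 3) (h : LocallyOptimal G D) {v d : V}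
    (hd : IsA G D d) (hv : G.Adj v d) (h1 : ∀ a, G.Adj v a → a ≠ d → ¬ IsA G D a) :
    527 / 1000 ≤ share G D v d := by
  obtain ⟨d', hd', hvd', hne⟩ := hd.shared h hv.symm
  have hc := countA_eq_one hd hv h1
  rcases (by have := two_le_card_nb hd.1 hd' hv hvd' hne; have := card_nb_le (D := D) hG v; omega :
    (nb G D v).card = 2 ∨ (nb G D v).card = 3) with h2 | h3
  · simp [share, base, split, h2, hc, hd]
  · refine le_trans ?_ (base_le_share hG hv hd.1 h3)
    simp [base, h3, hc, hd]

/-- All neighbours of `v` in `D` are of type A, so `v` grants nothing; its weight and its inflow are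
halved between `x` and `z`. -/
lemma share_of_pair {v x z : V} (hG : G.IsRegularOfDegree 3) (hx : IsA G D x) (hz : IsA G D z)
    (hne : x ≠ z) (hv : nb G D v = {x, z}) {m : ℝ} (hm : m ≤ inflow G D v) :
    1 / 2 + m / 2 ≤ share G D v x := by
  classical
  obtain ⟨h1, h2, h3⟩ := adj_iff_of_nb_eq_pair hv
  have hk : (nb G D v).card = 2 := by rw [hv, Finset.card_pair hne]
  have hc : countA G D v = 2 := by
    unfold countA
    rw [hv, Finset.filter_true_of_mem (by simp [hx, hz]), Finset.card_pair hne]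
  have hA : ∀ d ∈ D, G.Adj v d → IsA G D d := fun d hd hvd => by
    rcases h3 d hd hvd with rfl | rfl
    exacts [hx, hz]
  have hT : ¬ TwinGranted G D v := by
    rintro (⟨d, hd, hvd, hnA, -⟩ | ⟨d, hd, -⟩)
    · exact hnA (hA d hd hvd)
    · exact hd.not_isA (hA d hd.1 hd.spec.1.symm)
  have ho := outflow_le_mul hG h1 hx.1 (request_le_zero (not_eligible_of_isA hx h1) hT)
  rw [mul_zero] at ho
  simp only [share, base, split, hk, hc]
  norm_num
  linarith

lemma base_of_gadget {x z v₁ v₂ v₃ u : V} (hG : G.IsRegularOfDegree 3) (h : LocallyOptimal G D)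
    (g : Gadget G D x z v₁ v₂ v₃ u) :
    base G D v₃ x = open Classical in 3 / 8 + (if Special G D v₃ then 11 / 160 else 0) := by
  classical
  have hk : (nb G D v₃).card = 3 := by
    rw [card_nb_eq hG g.adj_left g.adj_right g.adj g.ne.symm g.ne_left g.ne_right.symm g.left.1,
      if_pos g.right.1, if_pos g.mem]
  have hc : countA G D v₃ = 2 := by
    rw [countA_eq hG g.adj_left g.adj_right g.adj g.ne.symm g.ne_left g.ne_right.symm,
      if_pos g.left, if_pos g.right, if_neg (g.not_isA hG h)]
  simp only [base, hk, hc, g.left]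
  norm_num

lemma Gadget.le_share_mid {x z v₁ v₂ v₃ u : V} (hG : G.IsRegularOfDegree 3)
    (h : LocallyOptimal G D) (g : Gadget G D x z v₁ v₂ v₃ u) :
    (open Classical in 3 / 8 + (if Special G D v₃ then 11 / 160 else 0)) ≤ share G D v₃ x := by
  have hk : (nb G D v₃).card = 3 := by
    rw [card_nb_eq hG g.adj_left g.adj_right g.adj g.ne.symm g.ne_left g.ne_right.symm g.left.1,
      if_pos g.right.1, if_pos g.mem]
  exact base_of_gadget hG h g ▸ base_le_share hG g.adj_left g.left.1 hk

lemma Gadget.le_inflow {x z v₁ v₂ v₃ u t : V} (h : LocallyOptimal G D)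
    (g : Gadget G D x z v₁ v₂ v₃ u) (ht : G.Adj v₁ t) (htD : t ∉ D) (he : Eligible G D t) :
    1 / 6 ≤ inflow G D v₁ := by
  refine le_trans (le_of_eq ?_) (request_le_inflow v₁ t)
  unfold request
  rw [if_pos ⟨ht, g.notMem₁ h, htD⟩, if_pos ⟨⟨_, _, _, _, _, g⟩, he⟩]

lemma Needy.le_inflow {g p : V} (hn : Needy G D g) (hgp : G.Adj g p) (hg : g ∉ D) (hp : p ∉ D)
    (h : Granted G D p) : 108 / 1000 ≤ inflow G D g := by
  refine le_trans ?_ (request_le_inflow g p)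
  unfold request
  rw [if_pos ⟨hgp, hg, hp⟩]
  split_ifs with h1 h2 <;> first | exact absurd ⟨hn, h⟩ h2 | norm_num

lemma Twins.le_inflow {x z v₁ v₂ v₃ t : V} (h : LocallyOptimal G D)
    (g : Twins G D x z v₁ v₂ v₃) (ht : G.Adj v₁ t) (htD : t ∉ D) (he : TwinGranted G D t) :
    54 / 1000 ≤ inflow G D v₁ := by
  refine le_trans ?_ (request_le_inflow v₁ t)
  unfold request
  rw [if_pos ⟨ht, g.left.isolated h _ g.adj₁.1.symm, htD⟩]
  split_ifs with h1 h2 h3 <;> first | exact absurd ⟨⟨_, _, _, _, g⟩, he⟩ h3 | norm_num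

/-- Three halves, and half of one granted request of 0.054, make exactly 1.527. -/
lemma Twins.le_total {x z v₁ v₂ v₃ : V} (hG : G.IsRegularOfDegree 3) (h : LocallyOptimal G D)
    (g : Twins G D x z v₁ v₂ v₃) : 2527 / 1000 ≤ total G D x := by
  obtain ⟨v, t, hv, hvt, htD, ht⟩ := g.exists_granted hG h
  have key : ∀ {w₁ w₂ w₃}, Twins G D x z w₁ w₂ w₃ → G.Adj w₁ t → 2527 / 1000 ≤ total G D x := by
    intro w₁ w₂ w₃ g hw
    have hi := g.le_inflow h hw htD ht
    have s1 := share_of_pair hG g.left g.right g.ne g.nb₁ hi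
    have s2 := share_of_pair hG g.left g.right g.ne g.nb₂ (inflow_nonneg w₂)
    have s3 := share_of_pair hG g.left g.right g.ne g.nb₃ (inflow_nonneg w₃)
    have a1 := g.adj₁.1.symm
    have a2 := g.rotate.adj₁.1.symm
    have a3 := g.rotate.rotate.adj₁.1.symm
    rw [total_eq hG a1 a2 a3 g.ne₁₂ g.ne₁₃ g.ne₂₃ (g.left.isolated h _ a1) (g.left.isolated h _ a2)
      (g.left.isolated h _ a3)]
    linarith
  rcases hv with rfl | rfl | rfl
  exacts [key g hvt, key g.rotate hvt, key g.rotate.rotate hvt]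

/-- Two granted requests give `2(1/2 + 1/12) + 3/8`. If one is refused, the middle is special and
the sum is `1/2 + 1/12 + 1/2 + 3/8 + 11/160`, slightly more than 1.527. Two refusals are excluded by
`not_adj_both`. -/
lemma Gadget.le_total {x z v₁ v₂ v₃ u : V} (hG : G.IsRegularOfDegree 3) (h : LocallyOptimal G D)
    (g : Gadget G D x z v₁ v₂ v₃ u) : 2527 / 1000 ≤ total G D x := by
  classical
  have a1 := g.adj₁.1.symm
  have a2 := g.adj₂.1.symm
  have a3 := g.adj_left.symm
  rw [total_eq hG a1 a2 a3 g.ne₁₂ g.ne₃₁.symm g.ne₃₂.symm (g.left.isolated h _ a1)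
    (g.left.isolated h _ a2) (g.left.isolated h _ a3)]
  have s3 := g.le_share_mid hG h
  obtain ⟨t, htx, htz, ht, -⟩ := exists_third_adj hG g.adj₁.1 g.adj₁.2.1 g.ne
  obtain ⟨t', htx', htz', ht', -⟩ := exists_third_adj hG g.adj₂.1 g.adj₂.2.1 g.ne
  have key : ∀ {w₁ w₂ t t'}, Gadget G D x z w₁ w₂ v₃ u → G.Adj w₁ t → t ≠ x → t ≠ z →
      G.Adj w₂ t' → t' ≠ x → t' ≠ z → IsB G D u t →
      Special G D v₃ ∧ 1 / 6 ≤ inflow G D w₂ := by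
    intro w₁ w₂ t t' g ht htx htz ht' htx' htz' hB
    refine ⟨⟨_, _, _, _, _, _, g, hB, ht⟩, ?_⟩
    refine g.swap.le_inflow h ht' (g.swap.third_notMem ht' htx' htz') ?_
    refine (g.swap.eligible_or_isB hG h ht' htx' htz').resolve_right fun hB' => ?_
    have : t = t' := by
      have := hB.2.2.symm.trans hB'.2.2
      simpa using this
    exact g.not_adj_both hG h hB ht (this ▸ ht')
  have P1 := fun {m} (hm : m ≤ inflow G D v₁) => share_of_pair hG g.left g.right g.ne g.nb₁ hm
  have P2 := fun {m} (hm : m ≤ inflow G D v₂) => share_of_pair hG g.left g.right g.ne g.nb₂ hm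
  rcases g.eligible_or_isB hG h ht htx htz with he | hB
  · have i1 := P1 (g.le_inflow h ht (g.third_notMem ht htx htz) he)
    rcases g.swap.eligible_or_isB hG h ht' htx' htz' with he' | hB'
    · have i2 := P2 (g.swap.le_inflow h ht' (g.swap.third_notMem ht' htx' htz') he')
      have : (0 : ℝ) ≤ if Special G D v₃ then 11 / 160 else 0 := by split_ifs <;> norm_num
      linarith
    · obtain ⟨hs, -⟩ := key g.swap ht' htx' htz' ht htx htz hB'
      have i2 := P2 (inflow_nonneg v₂)
      rw [if_pos hs] at s3
      linarith
  · obtain ⟨hs, hi⟩ := key g ht htx htz ht' htx' htz' hB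
    have i1 := P1 (inflow_nonneg v₁)
    have i2 := P2 hi
    rw [if_pos hs] at s3
    linarith

/-- Without a partner, `x` gets 0.527 three times. With a partner it gets 1/2 twice, and 0.527 from
the third neighbour unless the partner is adjacent to that one too, which makes twins or a gadget.
-/
lemma IsA.le_total (hG : G.IsRegularOfDegree 3) (h : LocallyOptimal G D) {x : V}
    (hx : IsA G D x) : 2527 / 1000 ≤ total G D x := by
  by_cases hz : ∃ z v, IsA G D z ∧ x ≠ z ∧ G.Adj v x ∧ G.Adj v z
  · obtain ⟨z, v, hz, hne, hv, hv'⟩ := hz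
    obtain ⟨w, w', hww, hw, hw'⟩ := hx.pair_pair h hz hne hv hv'
    obtain ⟨a1, b1, c1⟩ := adj_iff_of_nb_eq_pair hw
    obtain ⟨a2, b2, c2⟩ := adj_iff_of_nb_eq_pair hw'
    obtain ⟨w₃, h31, h32, h3, -⟩ := exists_third_adj hG a1.symm a2.symm hww
    by_cases h3z : G.Adj w₃ z
    · by_cases h3' : nb G D w₃ = {x, z}
      · exact Twins.le_total hG h ⟨hx, hz, hne, hw, hw', h3', hww, h31.symm, h32.symm⟩
      · obtain ⟨u, hux, huz, hu, -⟩ := exists_third_adj hG h3.symm h3z hne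
        refine Gadget.le_total hG h ⟨hx, hz, hne, hw, hw', hww, h31, h32, h3.symm, h3z, hu, ?_,
          hux, huz⟩
        by_contra huD
        refine h3' ?_
        ext a
        simp only [mem_nb, Finset.mem_insert, Finset.mem_singleton]
        constructor
        · rintro ⟨h1, h2⟩
          rcases eq_of_adj_of_ne hG h3.symm h3z hu hne hux.symm huz.symm h1 with e | e | e
          exacts [Or.inl e, Or.inr e, absurd (e ▸ h2) huD]
        · rintro (rfl | rfl)
          exacts [⟨h3.symm, hx.1⟩, ⟨h3z, hz.1⟩]
    · have s1 := share_of_pair hG hx hz hne hw (inflow_nonneg w)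
      have s2 := share_of_pair hG hx hz hne hw' (inflow_nonneg w')
      have s3 := share_of_countA_one hG h hx h3.symm fun a ha hax hA =>
        h3z (hx.pair_unique hG h hz hA hne hax.symm hv hv' h3.symm ha ▸ ha)
      rw [total_eq hG a1.symm a2.symm h3 hww h31.symm h32.symm (hx.isolated h _ a1.symm)
        (hx.isolated h _ a2.symm) (hx.isolated h _ h3)]
      linarith
  · push Not at hz
    have hs : ∀ v, G.Adj x v → 527 / 1000 ≤ share G D v x := fun v hv =>
      share_of_countA_one hG h hx hv.symm fun a ha hax hA => hz a v hA hax.symm hv.symm ha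
    obtain ⟨v, hv⟩ : ∃ v, G.Adj x v := by
      have := hG x
      obtain ⟨v, hv⟩ := Finset.card_pos.1 (by
        rw [G.card_neighborFinset_eq_degree, this]; norm_num : 0 < (G.neighborFinset x).card)
      exact ⟨v, by simpa using hv⟩
    obtain ⟨b, c, hbc, hbv, hcv, hb, hc, -⟩ := exists_two_adj hG hv
    rw [total_eq hG hv hb hc hbv.symm hcv.symm hbc (hx.isolated h _ hv) (hx.isolated h _ hb)
        (hx.isolated h _ hc)]
    have := hs _ hv; have := hs _ hb; have := hs _ hc
    linarith

end CubicDomination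

namespace CubicDomination
variable {V : Type*} [Fintype V] [DecidableEq V] {G : SimpleGraph V} [DecidableRel G.Adj]
variable {D : Finset V}

/-! ### Vertices with external private neighbours -/

lemma Special.exists_gadget (hG : G.IsRegularOfDegree 3) {v d : V} (hs : Special G D v)
    (hd : ¬ IsA G D d) (hv : G.Adj v d) :
    ∃ x z v₁ v₂ y, Gadget G D x z v₁ v₂ v d ∧ IsB G D d y ∧ G.Adj v₁ y := by
  obtain ⟨x, z, v₁, v₂, u, y, g, hu, h1⟩ := hs
  rcases g.eq_of_adj_mid hG hv with rfl | rfl | rfl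
  exacts [absurd g.left hd, absurd g.right hd, ⟨x, z, v₁, v₂, y, g, hu, h1⟩]

/-- The possible shares before inflow are 1/3, 473/2000, 1/4 and, at a special middle, 9/80. -/
lemma share_of_card_three (hG : G.IsRegularOfDegree 3) (h : LocallyOptimal G D) {v d : V}
    (hdD : d ∈ D) (hd : ¬ IsA G D d) (hv : G.Adj v d) (h3 : (nb G D v).card = 3) :
    9 / 80 ≤ share G D v d ∧ (¬ Special G D v → 473 / 2000 ≤ share G D v d) ∧
      (countA G D v = 0 → 1 / 3 ≤ share G D v d) := by
  have hb := base_le_share hG hv hdD h3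
  have hc := countA_le_two hG h v
  suffices 9 / 80 ≤ base G D v d ∧ (¬ Special G D v → 473 / 2000 ≤ base G D v d) ∧
      (countA G D v = 0 → 1 / 3 ≤ base G D v d) from
    ⟨this.1.trans hb, fun h1 => (this.2.1 h1).trans hb, fun h1 => (this.2.2 h1).trans hb⟩
  have : countA G D v = 0 ∨ countA G D v = 1 ∨ countA G D v = 2 := by omega
  rcases this with h0 | h0 | h0
  · simp only [base, h3, h0]; norm_num
  · simp only [base, h3, h0, hd]; norm_num
  · simp only [base, h3, h0, hd]
    by_cases hs : Special G D v <;> simp [hs] <;> norm_num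

/-- One neighbour of `v` lies outside `D` and can request at most 1/6, of which `d` pays half. If
there is a type A neighbour, `v` is not eligible: the request is at most 0.108, and `d` pays all of
it out of 0.473. -/
lemma share_of_card_two (hG : G.IsRegularOfDegree 3) {v d : V}
    (hdD : d ∈ D) (hd : ¬ IsA G D d) (hv : G.Adj v d) (h2 : (nb G D v).card = 2) :
    365 / 1000 ≤ share G D v d ∧ (countA G D v = 0 → 5 / 12 ≤ share G D v d) := by
  have hc := countA_lt hdD hd hv
  rw [h2] at hc
  have hi := inflow_nonneg (G := G) (D := D) v
  have : countA G D v = 0 ∨ countA G D v = 1 := by omega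
  rcases this with h0 | h0
  · have ho := outflow_le_mul hG hv hdD (fun g => request_le (G := G) (D := D) g v)
    rw [h2] at ho
    simp only [share, base, split, h2, h0]
    norm_num at ho ⊢
    constructor <;> linarith
  · obtain ⟨a, ha, hva⟩ := exists_isA_of_countA_pos (by rw [h0]; norm_num : countA G D v ≠ 0)
    have ho := outflow_le_mul hG hv hdD (request_le_of_not_eligible (not_eligible_of_isA ha hva))
    rw [h2] at ho
    simp only [share, base, split, h2, h0, hd]
    norm_num at ho ⊢
    linarith

lemma share_of_shared (hG : G.IsRegularOfDegree 3) (h : LocallyOptimal G D) {v d d' : V}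
    (hdD : d ∈ D) (hd : ¬ IsA G D d) (hv : G.Adj v d) (hd' : d' ∈ D) (hv' : G.Adj v d')
    (hne : d' ≠ d) (hs : ¬ Special G D v) : 473 / 2000 ≤ share G D v d := by
  rcases (by have := two_le_card_nb hdD hd' hv hv' hne; have := card_nb_le (D := D) hG v; omega :
    (nb G D v).card = 2 ∨ (nb G D v).card = 3) with h2 | h3
  · exact le_trans (by norm_num) (share_of_card_two hG hdD hd hv h2).1
  · exact (share_of_card_three hG h hdD hd hv h3).2.1 hs

lemma share_of_nb_eq_singleton (hG : G.IsRegularOfDegree 3) {y d : V} {m : ℝ}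
    (hy : nb G D y = {d}) (hm : ∀ g, request G D g y ≤ m) :
    1 + inflow G D y - 2 * m ≤ share G D y d := by
  have hyd : d ∈ nb G D y := by rw [hy]; simp
  rw [mem_nb] at hyd
  have hk : (nb G D y).card = 1 := by rw [hy, Finset.card_singleton]
  have ho := outflow_le_mul hG hyd.1 hyd.2 hm
  rw [hk] at ho
  simp only [share, base, split, hk]
  norm_num at ho ⊢
  linarith

lemma IsB.not_eligible {d y : V} (hd : IsB G D d y) : ¬ Eligible G D y := fun he =>
  (he d hd.1 hd.spec.1.symm).2.1 hd

lemma IsB.not_granted {d y : V} (hd : IsB G D d y) : ¬ Granted G D y := by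
  rintro ⟨e, he, hye, -, hn⟩
  exact hn (hd.eq_of_adj he hye ▸ hd)

/-- A private neighbour of a type B vertex can serve only twins, so it loses at most 0.054 twice; if
the type B vertex is not loose, it loses nothing. -/
lemma IsB.share_epn (hG : G.IsRegularOfDegree 3) {d y : V} (hd : IsB G D d y) :
    892 / 1000 ≤ share G D y d := by
  have := share_of_nb_eq_singleton hG hd.spec.2.2
    (request_le_of_not_granted hd.not_eligible hd.not_granted)
  have := inflow_nonneg (G := G) (D := D) y
  linarith

lemma IsB.share_epn_of_not_loose (hG : G.IsRegularOfDegree 3) {d y : V} (hd : IsB G D d y)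
    (hl : ¬ Loose G D d) : 1 + inflow G D y ≤ share G D y d := by
  have hT : ¬ TwinGranted G D y := by
    rintro (hg | ⟨e, he, hel⟩)
    · exact hd.not_granted hg
    · exact hl (hd.eq_of_adj he.1 he.spec.1.symm ▸ hel)
  have := share_of_nb_eq_singleton hG hd.spec.2.2 (request_le_zero hd.not_eligible hT)
  linarith

lemma not_loose_of_card_three (hG : G.IsRegularOfDegree 3) {d v : V} (hv : G.Adj d v)
    (h3 : (nb G D v).card = 3) : ¬ Loose G D d := fun hl => by
  obtain ⟨c, hc, hvc⟩ := hl v hv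
  exact hc (mem_of_card_nb hG h3 hvc)

/-- The external private neighbour of the third vertex of a gadget that refuses a request and has
no neighbour with a further neighbour outside `D` receives weight. -/
lemma IsB.inflow_of_special (hG : G.IsRegularOfDegree 3) (h : LocallyOptimal G D) {d y v w : V}
    (hd : IsB G D d y) (hv : G.Adj d v) (hw : G.Adj d w) (hvw : w ≠ v) (hwy : w ≠ y)
    (hn : Needy G D y) (hw3 : (nb G D w).card = 3) (hs : Special G D v) :
    108 / 1000 ≤ inflow G D y := by
  obtain ⟨x, z, v₁, v₂, y', g, hd', h1⟩ := hs.exists_gadget hG hd.not_isA hv.symm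
  obtain rfl : y' = y := by
    have := hd.2.2.symm.trans hd'.2.2
    simpa using this.symm
  have hdv : d ≠ v₁ := fun hh => g.notMem₁ h (hh ▸ hd.1)
  obtain ⟨q, hqd, hqv, hq, -⟩ := exists_third_adj hG hd.spec.1.symm h1.symm hdv
  exact hn.le_inflow hq hd.spec.2.1 (fun hqD => hqd (hd.eq_of_adj hqD hq))
    (g.granted_of_special hG h hd' h1 hw hvw hwy (fun e he => mem_of_card_nb hG hw3 he) hq hqd hqv)

lemma Special.countA_eq_zero (hG : G.IsRegularOfDegree 3) (h : LocallyOptimal G D) {d v w : V}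
    (hd : ¬ IsA G D d) (hv : G.Adj d v) (hw : G.Adj d w) (hvw : w ≠ v)
    (hs : Special G D v) : countA G D w = 0 := by
  obtain ⟨x, z, v₁, v₂, y, g, hd', h1⟩ := hs.exists_gadget hG hd hv.symm
  exact CubicDomination.countA_eq_zero fun a ha => g.not_isA_of_special hG h hd' h1 hw hvw ha

/-- Here `y` grants nothing. If both other neighbours give only 473/2000, a granted request of 0.108
is needed, and `granted_or_granted` provides it. If one is special and gives 9/80, then the other
gives 1/3 and `y` receives 0.108 as well. -/
lemma IsB.sum_share_of_card_three (hG : G.IsRegularOfDegree 3) (h : LocallyOptimal G D)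
    {d y v u : V} (hd : IsB G D d y) (hv : G.Adj d v) (hu : G.Adj d u) (hvu : v ≠ u) (hvy : v ≠ y)
    (huy : u ≠ y) (hv3 : (nb G D v).card = 3) (hu3 : (nb G D u).card = 3) :
    1527 / 1000 ≤ share G D y d + share G D v d + share G D u d := by
  have hn : Needy G D y := ⟨d, hd, fun w hw hwy e he => by
    rcases hd.eq_of_adj_of_ne hG hv hu hvu hvy huy w hw with rfl | rfl | rfl
    exacts [absurd rfl hwy, mem_of_card_nb hG hv3 he, mem_of_card_nb hG hu3 he]⟩
  have hy := hd.share_epn_of_not_loose hG (not_loose_of_card_three hG hv hv3)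
  have hi := inflow_nonneg (G := G) (D := D) y
  obtain ⟨v1, v2, v3⟩ := share_of_card_three hG h hd.1 hd.not_isA hv.symm hv3
  obtain ⟨u1, u2, u3⟩ := share_of_card_three hG h hd.1 hd.not_isA hu.symm hu3
  by_cases hsv : Special G D v
  · have := hd.inflow_of_special hG h hv hu hvu.symm huy hn hu3 hsv
    have := u3 (hsv.countA_eq_zero hG h hd.not_isA hv hu hvu.symm)
    linarith
  by_cases hsu : Special G D u
  · have := hd.inflow_of_special hG h hu hv hvu hvy hn hv3 hsu
    have := v3 (hsu.countA_eq_zero hG h hd.not_isA hu hv hvu)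
    linarith
  have := v2 hsv
  have := u2 hsu
  by_cases hv0 : countA G D v = 0
  · have := v3 hv0; linarith
  by_cases hu0 : countA G D u = 0
  · have := u3 hu0; linarith
  obtain ⟨x, hx, hvx⟩ := exists_isA_of_countA_pos hv0
  obtain ⟨x', hx', hux'⟩ := exists_isA_of_countA_pos hu0
  obtain ⟨p, q, hpq, hpd, hqd, hp, hq, -⟩ := exists_two_adj hG hd.spec.1.symm
  have hi : 108 / 1000 ≤ inflow G D y := by
    rcases granted_or_granted hG h hd hv hu hvu hvy huy (fun e he => mem_of_card_nb hG hv3 he)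
      (fun e he => mem_of_card_nb hG hu3 he) hx hvx hx' hux' hp hq hpq hpd hqd with hg | hg
    · exact hn.le_inflow hp hd.spec.2.1 (fun hD => hpd (hd.eq_of_adj hD hp)) hg
    · exact hn.le_inflow hq hd.spec.2.1 (fun hD => hqd (hd.eq_of_adj hD hq)) hg
  linarith

lemma IsB.sum_share_of_card_two (hG : G.IsRegularOfDegree 3) (h : LocallyOptimal G D)
    {d y v u : V} (hd : IsB G D d y) (hv : G.Adj d v) (hu : G.Adj d u) (hvu : v ≠ u)
    (hv2 : (nb G D v).card = 2) (hu2 : 2 ≤ (nb G D u).card) :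
    1527 / 1000 ≤ share G D y d + share G D v d + share G D u d := by
  obtain ⟨v1, v2⟩ := share_of_card_two hG hd.1 hd.not_isA hv.symm hv2
  rcases (by have := card_nb_le (D := D) hG u; omega :
    (nb G D u).card = 2 ∨ (nb G D u).card = 3) with h2 | h3
  · have := (share_of_card_two hG hd.1 hd.not_isA hu.symm h2).1
    have := hd.share_epn hG
    linarith
  · have hy := hd.share_epn_of_not_loose hG (not_loose_of_card_three hG hu h3)
    have hi := inflow_nonneg (G := G) (D := D) y
    obtain ⟨u1, u2, u3⟩ := share_of_card_three hG h hd.1 hd.not_isA hu.symm h3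
    by_cases hsu : Special G D u
    · have := v2 (hsu.countA_eq_zero hG h hd.not_isA hu hv hvu)
      linarith
    · have := u2 hsu
      linarith

lemma IsB.le_total (hG : G.IsRegularOfDegree 3) (h : LocallyOptimal G D) {d y : V}
    (hd : IsB G D d y) : 2527 / 1000 ≤ total G D d := by
  obtain ⟨v, u, hvu, hvy, huy, hv, hu, -⟩ := exists_two_adj hG hd.spec.1
  have hk : ∀ w, G.Adj d w → w ≠ y → 2 ≤ (nb G D w).card := fun w hw hwy => by
    obtain ⟨d', hd', hwd', hne⟩ := hd.opener.shared w hw hwy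
    exact two_le_card_nb hd.1 hd' hw.symm hwd' hne
  rw [total_eq hG hd.spec.1 hv hu hvy.symm huy.symm hvu hd.spec.2.1 (hd.isolated v hv)
    (hd.isolated u hu)]
  have hv2 := hk v hv hvy
  have hu2 := hk u hu huy
  rcases hv2.eq_or_lt with hv' | hv'
  · have := hd.sum_share_of_card_two hG h hv hu hvu hv'.symm hu2
    linarith
  rcases hu2.eq_or_lt with hu' | hu'
  · have := hd.sum_share_of_card_two hG h hu hv hvu.symm hu'.symm hv2
    linarith
  have := hd.sum_share_of_card_three hG h hv hu hvu hvy huy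
    (le_antisymm (card_nb_le hG v) hv') (le_antisymm (card_nb_le hG u) hu')
  linarith

lemma mem_epn_iff {d y : V} : y ∈ epn G D d ↔ G.Adj d y ∧ y ∉ D ∧ nb G D y = {d} := by
  simp [epn]

lemma le_total_of_two_epn (hG : G.IsRegularOfDegree 3) (h : LocallyOptimal G D) {d a b : V}
    (hdD : d ∈ D) (hd : nb G D d = ∅) (hab : a ≠ b) (ha : a ∈ epn G D d) (hb : b ∈ epn G D d) :
    2527 / 1000 ≤ total G D d := by
  have hnA : ¬ IsA G D d := fun hA => by
    have := hA.2 ▸ ha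
    simp at this
  have hiso : ∀ w, G.Adj d w → w ∉ D := fun w hw hwD => by
    have : w ∈ nb G D d := mem_nb.2 ⟨hw, hwD⟩
    simp [hd] at this
  have hs : ∀ w ∈ epn G D d, 2 / 3 ≤ share G D w d := fun w hw => by
    have h1 := share_of_nb_eq_singleton hG (mem_epn_iff.1 hw).2.2
      (fun g => request_le (G := G) (D := D) g w)
    have := inflow_nonneg (G := G) (D := D) w
    linarith
  obtain ⟨a1, a2, -⟩ := mem_epn_iff.1 ha
  obtain ⟨b1, b2, -⟩ := mem_epn_iff.1 hb
  obtain ⟨c, hca, hcb, hc, -⟩ := exists_third_adj hG a1 b1 hab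
  rw [total_eq hG a1 b1 hc hab hca.symm hcb.symm a2 b2 (hiso c hc)]
  have := hs a ha
  have := hs b hb
  have : 473 / 2000 ≤ share G D c d := by
    by_cases hce : c ∈ epn G D d
    · have := hs c hce; linarith
    obtain ⟨d', hd', hcd', hne⟩ := exists_shared_of_notMem_epn hdD hc (hiso c hc) hce
    -- A special middle would make `d` a type B vertex, against its two private neighbours.
    refine share_of_shared hG h hdD hnA hc.symm hd' hcd' hne fun hsp => ?_
    obtain ⟨_, _, _, _, y, -, hB, -⟩ := hsp.exists_gadget hG hnA hc.symm
    have e1 := hB.2.2 ▸ ha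
    have e2 := hB.2.2 ▸ hb
    simp only [Finset.mem_singleton] at e1 e2
    exact hab (e1.trans e2.symm)
  linarith

lemma le_total_of_adj_mem (hG : G.IsRegularOfDegree 3) (h : LocallyOptimal G D) {d e : V}
    (hdD : d ∈ D) (heD : e ∈ D) (hde : G.Adj d e) : 2527 / 1000 ≤ total G D d := by
  obtain ⟨t, -, -, hte, -, ht, -, -⟩ := exists_two_adj hG hde
  obtain ⟨ht1, t', htt, ht', hall⟩ := exists_epn_of_adj_mem hG h hdD heD hde ht hte
  have hs : ∀ w ∈ epn G D d, 784 / 1000 ≤ share G D w d := fun w hw => by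
    have hw' := mem_epn_iff.1 hw
    -- Since `d` is not isolated in `D`, its private neighbours are not eligible and lose at most
    -- 0.108 twice each.
    have hE : ¬ Eligible G D w := fun hE => by
      have h1 : e ∈ nb G D d := mem_nb.2 ⟨hde, heD⟩
      simp [(hE d hdD hw'.1.symm).2.2] at h1
    have h1 := share_of_nb_eq_singleton hG hw'.2.2 (request_le_of_not_eligible hE)
    have := inflow_nonneg (G := G) (D := D) w
    linarith
  have hf : (G.neighborFinset d).filter (· ∉ D) = {t, t'} := by
    ext w
    simp only [Finset.mem_filter, SimpleGraph.mem_neighborFinset, Finset.mem_insert,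
      Finset.mem_singleton]
    constructor
    · rintro ⟨h1, h2⟩
      exact (hall w h1).resolve_left fun hh => h2 (hh ▸ heD)
    · rintro (rfl | rfl)
      exacts [⟨ht, (mem_epn_iff.1 ht1).2.1⟩, ⟨(mem_epn_iff.1 ht').1, (mem_epn_iff.1 ht').2.1⟩]
  rw [total, hf, Finset.sum_pair htt.symm]
  have := hs t ht1
  have := hs t' ht'
  linarith

lemma LocallyOptimal.le_total (hG : G.IsRegularOfDegree 3) (h : LocallyOptimal G D) {d : V}
    (hd : d ∈ D) : 2527 / 1000 ≤ total G D d := by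
  by_cases hA : IsA G D d
  · exact hA.le_total hG h
  by_cases hn : nb G D d = ∅
  · have hne : (epn G D d).Nonempty := Finset.nonempty_iff_ne_empty.2 fun hh => hA ⟨hd, hh⟩
    obtain ⟨a, ha⟩ := hne
    by_cases hB : epn G D d = {a}
    · exact IsB.le_total hG h ⟨hd, hn, hB⟩
    · obtain ⟨b, hb, hba⟩ : ∃ b ∈ epn G D d, b ≠ a := by
        by_contra hh
        push Not at hh
        exact hB (Finset.eq_singleton_iff_unique_mem.2 ⟨ha, hh⟩)
      exact le_total_of_two_epn hG h hd hn hba.symm ha hb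
  · obtain ⟨e, he⟩ := Finset.nonempty_iff_ne_empty.2 hn
    rw [mem_nb] at he
    exact le_total_of_adj_mem hG h hd he.2 he.1

/-- A locally optimal dominating set of a cubic graph contains fewer than two fifths of the
vertices. -/
theorem LocallyOptimal.card_le (hG : G.IsRegularOfDegree 3) (h : LocallyOptimal G D) :
    2527 * D.card ≤ 1000 * Fintype.card V := by
  have h1 : ∑ d ∈ D, (2527 / 1000 : ℝ) ≤ ∑ d ∈ D, total G D d :=
    Finset.sum_le_sum fun d hd => h.le_total hG hd
  rw [sum_total h.dom, Finset.sum_const, nsmul_eq_mul] at h1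
  have : (2527 * D.card : ℝ) ≤ 1000 * Fintype.card V := by linarith
  exact_mod_cast this

end CubicDomination

namespace CubicDomination
variable {V : Type*} [Fintype V] [DecidableEq V] {G : SimpleGraph V} [DecidableRel G.Adj]
variable {D : Finset V}

/-! ### Local search for dominating sets -/

lemma innerDeg_mono {D D' : Finset V} (h : D ⊆ D') : innerDeg G D ≤ innerDeg G D' := by
  rw [innerDeg_eq_card, innerDeg_eq_card]
  exact Finset.card_le_card (Finset.filter_subset_filter _ (Finset.product_subset_product h h))

lemma innerDeg_insert_le (hG : G.IsRegularOfDegree 3) (v : V) (D : Finset V) :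
    innerDeg G (insert v D) ≤ innerDeg G D + 6 := by
  have h : ((insert v D ×ˢ insert v D).filter fun e => G.Adj e.1 e.2) ⊆
      ((D ×ˢ D).filter fun e => G.Adj e.1 e.2) ∪
        ((G.neighborFinset v).image (fun w => (v, w)) ∪
          (G.neighborFinset v).image fun w => (w, v)) := by
    rintro ⟨a, b⟩ he
    simp only [Finset.mem_filter, Finset.mem_product, Finset.mem_insert] at he
    simp only [Finset.mem_union, Finset.mem_filter, Finset.mem_product, Finset.mem_image,
      SimpleGraph.mem_neighborFinset, Prod.mk.injEq]
    obtain ⟨⟨rfl | ha, rfl | hb⟩, hab⟩ := he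
    exacts [absurd hab (G.irrefl), Or.inr (Or.inl ⟨b, hab, rfl, rfl⟩),
      Or.inr (Or.inr ⟨a, hab.symm, rfl, rfl⟩), Or.inl ⟨⟨ha, hb⟩, hab⟩]
  have hc : (G.neighborFinset v).card = 3 := by rw [G.card_neighborFinset_eq_degree, hG v]
  rw [innerDeg_eq_card, innerDeg_eq_card]
  refine (Finset.card_le_card h).trans ((Finset.card_union_le _ _).trans ?_)
  have h1 := Finset.card_union_le ((G.neighborFinset v).image fun w => (v, w))
    ((G.neighborFinset v).image fun w => (w, v))
  have h2 := Finset.card_image_le (s := G.neighborFinset v) (f := fun w => (v, w))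
  have h3 := Finset.card_image_le (s := G.neighborFinset v) (f := fun w => (w, v))
  omega

lemma innerDeg_union_le (hG : G.IsRegularOfDegree 3) (D Q : Finset V) :
    innerDeg G (D ∪ Q) ≤ innerDeg G D + 6 * Q.card := by
  induction Q using Finset.induction_on with
  | empty => simp
  | insert a Q ha ih =>
    rw [Finset.union_insert, Finset.card_insert_of_notMem ha]
    have := innerDeg_insert_le hG a (D ∪ Q)
    omega

/-- The vertices outside `D` without neighbours in `D`. -/
def uncovered (G : SimpleGraph V) [DecidableRel G.Adj] (D : Finset V) : Finset V :=
  Finset.univ.filter fun v => v ∉ D ∧ (nb G D v).card = 0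

lemma mem_uncovered {v : V} : v ∈ uncovered G D ↔ ¬ Covered G D v := by
  simp only [uncovered, Finset.mem_filter, Finset.mem_univ, true_and, Covered, not_or,
    Finset.card_eq_zero, Finset.eq_empty_iff_forall_notMem, mem_nb]
  push Not
  exact and_congr_right fun _ => forall_congr' fun _ => by tauto

lemma dominates_iff : Dominates G D ↔ (uncovered G D).card = 0 := by
  rw [Finset.card_eq_zero, Finset.eq_empty_iff_forall_notMem]
  exact forall_congr' fun v => by rw [mem_uncovered, not_not]

/-- The objective of the local search: it counts the vertices of `D`, the edges inside `D` and the
vertices that `D` does not cover. -/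
def weight (G : SimpleGraph V) [DecidableRel G.Adj] (D : Finset V) : ℕ :=
  -- A new vertex raises `innerDeg` by at most 6. At most three are added when `D` shrinks, and `18
  -- < 20` makes this an improvement; covering a vertex by adding it pays because `20 + 6 < 30`.
  20 * D.card + innerDeg G D + 30 * (uncovered G D).card

lemma weight_of_dominates (h : Dominates G D) : weight G D = 20 * D.card + innerDeg G D := by
  rw [weight, dominates_iff.1 h, mul_zero, add_zero]

lemma dominates_of_weight_le (hG : G.IsRegularOfDegree 3)
    (h : ∀ v, weight G D ≤ weight G (insert v D)) : Dominates G D := by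
  by_contra hD
  rw [dominates_iff] at hD
  obtain ⟨v, hv⟩ := Finset.card_pos.1 (Nat.pos_of_ne_zero hD)
  have hlt : (uncovered G (insert v D)).card < (uncovered G D).card := by
    refine Finset.card_lt_card ((Finset.ssubset_iff_of_subset fun w hw => ?_).2 ⟨v, hv, ?_⟩)
    · rw [mem_uncovered] at hw ⊢
      rintro (hwD | ⟨d, hd, hwd⟩)
      exacts [hw (Or.inl (Finset.mem_insert_of_mem hwD)),
        hw (Or.inr ⟨d, Finset.mem_insert_of_mem hd, hwd⟩)]
    · rw [mem_uncovered, not_not]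
      exact Or.inl (Finset.mem_insert_self _ _)
  have h1 := h v
  have h2 := innerDeg_insert_le hG v D
  have h3 := Finset.card_insert_le v D
  unfold weight at h1
  omega

/-- The radius 7 allows the deletion of four vertices and the insertion of three. -/
lemma locallyOptimal_of_weight_le (hG : G.IsRegularOfDegree 3)
    (h : ∀ D', (symmDiff D D').card ≤ 7 → weight G D ≤ weight G D') : LocallyOptimal G D := by
  have hs : ∀ R Q : Finset V, (symmDiff D (D \ R ∪ Q)).card ≤ R.card + Q.card := fun R Q => by
    refine (Finset.card_le_card (t := R ∪ Q) fun w hw => ?_).trans (Finset.card_union_le _ _)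
    simp only [Finset.mem_symmDiff, Finset.mem_union, Finset.mem_sdiff] at hw ⊢
    tauto
  have hc : ∀ R Q : Finset V, R ⊆ D → (D \ R ∪ Q).card + R.card ≤ D.card + Q.card :=
    fun R Q hR => by
      have h1 := Finset.card_union_le (D \ R) Q
      have h2 := Finset.card_sdiff_add_card_eq_card hR
      omega
  have hdom : Dominates G D := dominates_of_weight_le hG fun v => h _ (by
    refine (Finset.card_le_card (t := {v}) fun w hw => ?_).trans (by simp)
    simp only [Finset.mem_symmDiff, Finset.mem_insert, Finset.mem_singleton] at hw ⊢
    tauto)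
  refine ⟨hdom, fun R Q hR hR4 hQ hd => ?_, fun R Q hR hR3 hQ hi hd => ?_⟩
  · have h1 := h _ ((hs R Q).trans (by omega))
    rw [weight_of_dominates hdom, weight_of_dominates hd] at h1
    have h2 := innerDeg_union_le hG (D \ R) Q
    have h3 := innerDeg_mono (G := G) (Finset.sdiff_subset : D \ R ⊆ D)
    have h4 := hc R Q hR
    omega
  · have h1 := h _ ((hs R Q).trans (by omega))
    rw [weight_of_dominates hdom, weight_of_dominates hd] at h1
    have h4 := hc R Q hR
    omega

lemma weight_le (hG : G.IsRegularOfDegree 3) (D : Finset V) :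
    weight G D ≤ 60 * Fintype.card V := by
  have h1 := Finset.card_le_univ D
  have h2 := Finset.card_le_univ (uncovered G D)
  have h3 : innerDeg G D ≤ D.card * 3 := by
    unfold innerDeg
    exact Finset.sum_le_card_nsmul _ _ _ fun v _ => card_nb_le hG v
  unfold weight
  omega

/-! ### Solutions to MDD(max) -/

/-- The degree of `v` after the deletion of `S`. -/
def keep (G : SimpleGraph V) [DecidableRel G.Adj] (S : Finset V) (v : V) : ℕ :=
  ((G.neighborFinset v).filter (· ∉ S)).card

lemma isMDDMaxSolution_iff {p : V} {S : Finset V} :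
    IsMDDMaxSolution G p S ↔ p ∉ S ∧ ∀ v, v ∉ S → v ≠ p → keep G S v < keep G S p := by
  classical
  have h : ∀ v (hv : v ∉ S), (∀ inst : Fintype ((G.induce {u | u ∉ S}).neighborSet ⟨v, hv⟩),
      @SimpleGraph.degree _ (G.induce {u | u ∉ S}) ⟨v, hv⟩ inst = keep G S v) := fun v hv inst => by
    unfold SimpleGraph.degree keep
    rw [← Finset.card_map (Function.Embedding.subtype _)]
    congr 1
    ext w
    simp only [Finset.mem_map, SimpleGraph.mem_neighborFinset, SimpleGraph.comap_adj,
      Function.Embedding.subtype_apply, Subtype.exists, Set.mem_ofPred_eq, Finset.mem_filter]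
    constructor
    · rintro ⟨a, ha, hva, rfl⟩; exact ⟨hva, ha⟩
    · rintro ⟨hva, ha⟩; exact ⟨w, ha, hva, rfl⟩
  unfold IsMDDMaxSolution
  constructor
  · rintro ⟨hp, hv⟩
    refine ⟨hp, fun v hvS hvp => ?_⟩
    have := hv v hvS hvp
    rwa [h, h] at this
  · rintro ⟨hp, hv⟩
    refine ⟨hp, fun v hvS hvp => ?_⟩
    rw [h, h]
    exact hv v hvS hvp

lemma nb_add_keep (hG : G.IsRegularOfDegree 3) (S : Finset V) (v : V) :
    (nb G S v).card + keep G S v = 3 := by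
  have h := hG v
  rw [← G.card_neighborFinset_eq_degree] at h
  rw [← h]
  exact Finset.card_filter_add_card_filter_not _

lemma card_mul_le (hG : G.IsRegularOfDegree 3) {A T : Finset V} {m : ℕ}
    (h : ∀ v ∈ A, m ≤ (nb G T v).card) : A.card * m ≤ T.card * 3 := by
  refine Finset.card_mul_le_card_mul G.Adj (fun a ha => (h a ha).trans (le_of_eq ?_)) fun b _ => ?_
  · congr 1
    ext w
    simp [nb, Finset.bipartiteAbove, and_comm]
  · have h3 := hG b
    rw [← G.card_neighborFinset_eq_degree] at h3
    refine (Finset.card_le_card fun w hw => ?_).trans h3.le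
    simp only [Finset.bipartiteBelow, Finset.mem_filter] at hw
    simpa using hw.2.symm

/-- The `n - |T| - 1` kept vertices other than `p` send at least `m` edges each to `T`, and `T`
receives at most three per vertex. -/
lemma mul_card_le_of_nb (hG : G.IsRegularOfDegree 3) {p : V} {T : Finset V} {m : ℕ} (hp : p ∉ T)
    (h : ∀ v, v ∉ T → v ≠ p → m ≤ (nb G T v).card) :
    m * Fintype.card V ≤ (m + 3) * T.card + m := by
  have h1 : ((insert p T)ᶜ).card * m ≤ T.card * 3 := card_mul_le hG fun v hv => by
    simp only [Finset.mem_compl, Finset.mem_insert, not_or] at hv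
    exact h v hv.2 hv.1
  have h2 := Finset.card_add_card_compl (insert p T)
  rw [Finset.card_insert_of_notMem hp] at h2
  rw [← h2]
  nlinarith

lemma card_le_of_isMDDMaxSolution (hG : G.IsRegularOfDegree 3) {p : V} {T : Finset V}
    (hT : IsMDDMaxSolution G p T) : Fintype.card V ≤ 4 * T.card + 1 := by
  rw [isMDDMaxSolution_iff] at hT
  have := mul_card_le_of_nb (m := 1) hG hT.1 fun v hv hvp => by
    have h1 := hT.2 v hv hvp
    have h2 := nb_add_keep hG T v
    have h3 := nb_add_keep hG T p
    omega
  omega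

/-- Every neighbour of `p` has a neighbour that is neither `p` nor adjacent to `p`. -/
def Feasible (G : SimpleGraph V) (p : V) : Prop :=
  ∀ u, G.Adj p u → ∃ w, G.Adj u w ∧ w ≠ p ∧ ¬ G.Adj p w

/-- The dominating set `D` is turned into a solution: all neighbours of `p` are kept and all
vertices at distance two from `p` are deleted. -/
def repair (G : SimpleGraph V) [DecidableRel G.Adj] (p : V) (D : Finset V) : Finset V :=
  Finset.univ.filter fun v => v ≠ p ∧ ¬ G.Adj p v ∧ (v ∈ D ∨ ∃ u, G.Adj p u ∧ G.Adj u v)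

lemma mem_repair {p v : V} : v ∈ repair G p D ↔
    v ≠ p ∧ ¬ G.Adj p v ∧ (v ∈ D ∨ ∃ u, G.Adj p u ∧ G.Adj u v) := by
  simp [repair]

/-- All neighbours of `p` are kept, so every other kept vertex only has to lose one. A neighbour of
`p` does so by feasibility; a kept vertex farther away loses its neighbour in `D`, which cannot be
close enough to `p` to be spared. -/
lemma isMDDMaxSolution_repair (hG : G.IsRegularOfDegree 3) {p : V} (hp : Feasible G p)
    (hD : Dominates G D) : IsMDDMaxSolution G p (repair G p D) := by
  have h0 : (nb G (repair G p D) p).card = 0 := by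
    rw [Finset.card_eq_zero, Finset.eq_empty_iff_forall_notMem]
    intro w hw
    rw [mem_nb, mem_repair] at hw
    exact hw.2.2.1 hw.1
  rw [isMDDMaxSolution_iff]
  refine ⟨fun hh => (mem_repair.1 hh).1 rfl, fun v hv hvp => ?_⟩
  have h1 := nb_add_keep hG (repair G p D) p
  have h2 := nb_add_keep hG (repair G p D) v
  suffices 0 < (nb G (repair G p D) v).card by omega
  obtain ⟨w, hvw, hw⟩ : ∃ w, G.Adj v w ∧ w ∈ repair G p D := by
    by_cases hpv : G.Adj p v
    · obtain ⟨w, hvw, hwp, hpw⟩ := hp v hpv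
      exact ⟨w, hvw, mem_repair.2 ⟨hwp, hpw, Or.inr ⟨v, hpv, hvw⟩⟩⟩
    · have hv' : v ∉ D ∧ ∀ u, G.Adj p u → ¬ G.Adj u v := by
        constructor
        · exact fun hvD => hv (mem_repair.2 ⟨hvp, hpv, Or.inl hvD⟩)
        · exact fun u hu huv => hv (mem_repair.2 ⟨hvp, hpv, Or.inr ⟨u, hu, huv⟩⟩)
      obtain ⟨d, hd, hvd⟩ := (hD v).resolve_left hv'.1
      exact ⟨d, hvd, mem_repair.2 ⟨fun hdp => hpv (hdp ▸ hvd.symm),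
        fun hpd => hv'.2 d hpd hvd.symm, Or.inl hd⟩⟩
  exact Finset.card_pos.2 ⟨w, mem_nb.2 ⟨hvw, hw⟩⟩

lemma card_second_neighbors_le (hG : G.IsRegularOfDegree 3) (p : V) :
    ((G.neighborFinset p).biUnion fun u => G.neighborFinset u).card ≤ 9 := by
  have h : ∀ u, (G.neighborFinset u).card = 3 := fun u => by
    rw [G.card_neighborFinset_eq_degree, hG u]
  have := Finset.card_biUnion_le_card_mul (G.neighborFinset p) (fun u => G.neighborFinset u) 3
    fun u _ => (h u).le
  rw [h p] at this
  omega

lemma card_repair_le (hG : G.IsRegularOfDegree 3) (p : V) : (repair G p D).card ≤ D.card + 9 := by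
  have h : repair G p D ⊆ D ∪ (G.neighborFinset p).biUnion fun u => G.neighborFinset u := by
    intro v hv
    rw [mem_repair] at hv
    simpa using hv.2.2
  have := Finset.card_le_card h
  have := Finset.card_union_le D ((G.neighborFinset p).biUnion fun u => G.neighborFinset u)
  have := card_second_neighbors_le hG p
  omega

/-- If `p` kept degree three, all its neighbours would be kept. A neighbour that is adjacent only to
`p` and to neighbours of `p` would then keep degree three as well. -/
lemma keep_le_two_of_not_feasible (hG : G.IsRegularOfDegree 3) {p : V} {T : Finset V}
    (hT : IsMDDMaxSolution G p T) (hp : ¬ Feasible G p) : keep G T p ≤ 2 := by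
  rw [isMDDMaxSolution_iff] at hT
  by_contra hk
  unfold Feasible at hp
  push Not at hp
  obtain ⟨u, hpu, hu⟩ := hp
  have hT0 : nb G T p = ∅ := by
    rw [← Finset.card_eq_zero]
    have := nb_add_keep hG T p
    omega
  have hN : ∀ w, G.Adj p w → w ∉ T := fun w hw hwT => by
    have : w ∈ nb G T p := mem_nb.2 ⟨hw, hwT⟩
    simp [hT0] at this
  have h1 := hT.2 u (hN u hpu) hpu.ne'
  have h2 := nb_add_keep hG T u
  have h3 := nb_add_keep hG T p
  have h4 : (nb G T u).card = 0 := by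
    rw [Finset.card_eq_zero, Finset.eq_empty_iff_forall_notMem]
    intro w hw
    rw [mem_nb] at hw
    by_cases hwp : w = p
    · exact hT.1 (hwp ▸ hw.2)
    · exact hN w (hu w hw.1 hwp) hw.2
  omega

lemma card_le_of_not_feasible (hG : G.IsRegularOfDegree 3) {p : V} {T : Finset V}
    (hT : IsMDDMaxSolution G p T) (hp : ¬ Feasible G p) :
    2 * Fintype.card V ≤ 5 * T.card + 2 := by
  have h2 := keep_le_two_of_not_feasible hG hT hp
  rw [isMDDMaxSolution_iff] at hT
  have := mul_card_le_of_nb (m := 2) hG hT.1 fun v hv hvp => by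
    have h1 := hT.2 v hv hvp
    have h3 := nb_add_keep hG T v
    omega
  omega

end CubicDomination

namespace CubicDomination
variable {V : Type*} [Fintype V] [DecidableEq V] {G : SimpleGraph V} [DecidableRel G.Adj]
variable {p : V} {S : Finset V}

/-! ### Local search for solutions -/

/-- `S` is a solution that no solution which differs from it in at most three vertices improves. -/
structure LocallyMinimal (G : SimpleGraph V) (p : V) (S : Finset V) : Prop where
  sol : IsMDDMaxSolution G p S
  le : ∀ S', IsMDDMaxSolution G p S' → (symmDiff S S').card ≤ 3 → S.card ≤ S'.card

/-- A kept neighbour of `p` has degree at least one, because of `p`. -/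
lemma keep_ne_one (hS : IsMDDMaxSolution G p S) : keep G S p ≠ 1 := fun h1 => by
  rw [isMDDMaxSolution_iff] at hS
  obtain ⟨u, hu⟩ := Finset.card_pos.1 (by unfold keep at h1; omega :
    0 < ((G.neighborFinset p).filter (· ∉ S)).card)
  simp only [Finset.mem_filter, SimpleGraph.mem_neighborFinset] at hu
  have h2 := hS.2 u hu.2 hu.1.ne'
  have h3 : 0 < keep G S u := Finset.card_pos.2 ⟨p, by simp [hu.1.symm, hS.1]⟩
  omega

lemma forall_mem_of_keep_eq_zero (hS : IsMDDMaxSolution G p S) (h0 : keep G S p = 0) {v : V}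
    (hv : v ≠ p) : v ∈ S := by
  rw [isMDDMaxSolution_iff] at hS
  by_contra hvS
  have := hS.2 v hvS hv
  omega

/-- In this case only `p` is kept. Two nonadjacent neighbours could be restored, with `p` then
having degree two and both of them degree one. -/
lemma LocallyMinimal.adj_of_keep_eq_zero (hS : LocallyMinimal G p S) (h0 : keep G S p = 0)
    {u v : V} (hu : G.Adj p u) (hv : G.Adj p v) (huv : u ≠ v) : G.Adj u v := by
  by_contra hn
  have hmem := fun {w} => forall_mem_of_keep_eq_zero hS.sol h0 (v := w)
  have hp := (isMDDMaxSolution_iff.1 hS.sol).1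
  set S' := S \ {u, v} with hS'
  have hS'm : ∀ w, w ∉ S' ↔ w = p ∨ w = u ∨ w = v := fun w => by
    simp only [hS', Finset.mem_sdiff, Finset.mem_insert, Finset.mem_singleton, not_and, not_not]
    constructor
    · intro h
      by_cases hw : w = p
      · exact Or.inl hw
      · exact Or.inr (h (hmem hw))
    · rintro (rfl | h) hwS
      exacts [absurd hwS hp, h]
  have hsol : IsMDDMaxSolution G p S' := by
    have h2 : 2 ≤ keep G S' p :=
      Finset.one_lt_card.2 ⟨u, by simp [hS'm, hu], v, by simp [hS'm, hv], huv⟩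
    have h1 : ∀ a b, G.Adj p a → (∀ w, w ∉ S' → w = p ∨ w = a ∨ w = b) → ¬ G.Adj a b →
        keep G S' a ≤ 1 := fun a b hpa hw hab => by
      refine (Finset.card_le_card (t := {p}) fun w hw' => ?_).trans (by simp)
      simp only [Finset.mem_filter, SimpleGraph.mem_neighborFinset] at hw'
      rcases hw w hw'.2 with rfl | rfl | rfl
      exacts [Finset.mem_singleton_self _, absurd hw'.1 G.irrefl, absurd hw'.1 hab]
    rw [isMDDMaxSolution_iff]
    refine ⟨(hS'm p).2 (Or.inl rfl), fun w hw hwp => lt_of_le_of_lt ?_ h2⟩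
    rcases (hS'm w).1 hw with rfl | rfl | rfl
    · exact absurd rfl hwp
    · exact h1 w v hu (fun a ha => (hS'm a).1 ha) hn
    · exact h1 w u hv (fun a ha => by have := (hS'm a).1 ha; tauto) fun h => hn h.symm
  have h2 := hS.le S' hsol (by
    refine (Finset.card_le_card (t := {u, v}) fun w hw => ?_).trans (Finset.card_le_two.trans
      (by norm_num))
    simp only [hS', Finset.mem_symmDiff, Finset.mem_sdiff, Finset.mem_insert,
      Finset.mem_singleton] at hw ⊢
    tauto)
  have h3 : S'.card < S.card := by
    refine Finset.card_lt_card ((Finset.ssubset_iff_of_subset Finset.sdiff_subset).2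
      ⟨u, hmem hu.ne', by simp⟩)
  omega

/-- The neighbours of `p` are pairwise adjacent, so a kept neighbour has at least the degree of `p`.
No solution can therefore keep anything besides `p`. -/
lemma LocallyMinimal.card_le_of_keep_eq_zero
    (hS : LocallyMinimal G p S) (h0 : keep G S p = 0)
    {T : Finset V} (hT : IsMDDMaxSolution G p T) : S.card ≤ T.card := by
  refine Finset.card_le_card fun v hv => ?_
  have hvp : v ≠ p := fun h => (isMDDMaxSolution_iff.1 hS.sol).1 (h ▸ hv)
  rw [isMDDMaxSolution_iff] at hT
  by_contra hvT
  have hlt := hT.2 v hvT hvp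
  obtain ⟨u, hu⟩ := Finset.card_pos.1 (by unfold keep at hlt; omega :
    0 < ((G.neighborFinset p).filter (· ∉ T)).card)
  simp only [Finset.mem_filter, SimpleGraph.mem_neighborFinset] at hu
  have h1 := hT.2 u hu.2 hu.1.ne'
  have hpu : p ∈ (G.neighborFinset u).filter (· ∉ T) := by simp [hu.1.symm, hT.1]
  have h2 : keep G T p ≤ (((G.neighborFinset u).filter (· ∉ T)).erase p).card + 1 := by
    refine (Finset.card_le_card fun w hw => ?_).trans (Finset.card_insert_le u _)
    simp only [Finset.mem_filter, SimpleGraph.mem_neighborFinset, Finset.mem_insert,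
      Finset.mem_erase] at hw ⊢
    by_cases hwu : w = u
    · exact Or.inl hwu
    · exact Or.inr ⟨hw.1.ne', hS.adj_of_keep_eq_zero h0 hu.1 hw.1 (Ne.symm hwu), hw.2⟩
  rw [Finset.card_erase_add_one hpu] at h2
  exact absurd h1 (not_lt.2 h2)

/-- The vertices at distance at most two from `p`. -/
def near (G : SimpleGraph V) [DecidableRel G.Adj] (p : V) : Finset V :=
  insert p (G.neighborFinset p ∪ (G.neighborFinset p).biUnion fun u => G.neighborFinset u)

lemma card_near_le (hG : G.IsRegularOfDegree 3) (p : V) : (near G p).card ≤ 13 := by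
  have h : (G.neighborFinset p).card = 3 := by rw [G.card_neighborFinset_eq_degree, hG p]
  have h1 := Finset.card_insert_le p
    (G.neighborFinset p ∪ (G.neighborFinset p).biUnion fun u => G.neighborFinset u)
  have h2 := Finset.card_union_le (G.neighborFinset p)
    ((G.neighborFinset p).biUnion fun u => G.neighborFinset u)
  have h3 := card_second_neighbors_le hG p
  unfold near
  omega

lemma notMem_near {v : V} (hv : v ∉ near G p) :
    v ≠ p ∧ ¬ G.Adj p v ∧ ∀ u, G.Adj p u → ¬ G.Adj u v := by
  simpa [near] using hv

/-- A vertex that cannot be kept has two kept neighbours, or one that has a kept neighbour. -/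
lemma LocallyMinimal.exists_kept (hS : LocallyMinimal G p S) (h2 : keep G S p = 2) {s : V}
    (hs : s ∈ S) (hsZ : s ∉ near G p) (h1 : keep G S s ≤ 1) :
    ∃ a, a ∉ S ∧ G.Adj s a ∧ 1 ≤ keep G S a := by
  by_contra hn
  push Not at hn
  have hsol := isMDDMaxSolution_iff.1 hS.sol
  obtain ⟨hsp, hps, -⟩ := notMem_near hsZ
  have hm : ∀ w, w ∉ S.erase s ↔ w = s ∨ w ∉ S := fun w => by
    rw [Finset.mem_erase, not_and_or, not_not]
  have hkeep : ∀ v, ¬ G.Adj v s → keep G (S.erase s) v = keep G S v := fun v hv => by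
    unfold keep
    congr 1
    ext w
    simp only [Finset.mem_filter, SimpleGraph.mem_neighborFinset, hm]
    constructor
    · rintro ⟨h, rfl | h'⟩
      exacts [absurd h hv, ⟨h, h'⟩]
    · exact fun h => ⟨h.1, Or.inr h.2⟩
  -- If all kept neighbours of `s` had degree zero, `s` could be restored: it would have degree at
  -- most one and they would have degree one, below the two of `p`. As `s` is far from `p`, the
  -- degree of `p` does not change.
  have hsol' : IsMDDMaxSolution G p (S.erase s) := by
    rw [isMDDMaxSolution_iff]
    refine ⟨fun h => hsol.1 (Finset.mem_of_mem_erase h), fun v hv hvp => ?_⟩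
    rw [hkeep p hps, h2]
    by_cases hvs : G.Adj v s
    · have hvS : v ∉ S := ((hm v).1 hv).resolve_left hvs.ne
      have h3 := hn v hvS hvs.symm
      have h4 : keep G (S.erase s) v ≤ (insert s ((G.neighborFinset v).filter (· ∉ S))).card := by
        refine Finset.card_le_card fun w hw => ?_
        simp only [Finset.mem_filter, SimpleGraph.mem_neighborFinset, Finset.mem_insert, hm] at hw ⊢
        tauto
      have h5 := h4.trans (Finset.card_insert_le _ _)
      unfold keep at h3 h5 ⊢
      omega
    · rw [hkeep v hvs]
      rcases (hm v).1 hv with rfl | hvS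
      · omega
      · have := hsol.2 v hvS hvp
        omega
  have h3 := hS.le _ hsol' (by
    refine (Finset.card_le_card (t := {s}) fun w hw => ?_).trans (by simp)
    simp only [Finset.mem_symmDiff, Finset.mem_erase, Finset.mem_singleton] at hw ⊢
    tauto)
  have := Finset.card_erase_lt_of_mem hs
  omega

/-- Two vertices that cannot be kept have different only kept neighbours. -/
lemma LocallyMinimal.eq_of_kept (hS : LocallyMinimal G p S) (h2 : keep G S p = 2) {s s' a : V}
    (hs : s ∈ S) (hsZ : s ∉ near G p) (hs' : s' ∈ S) (hsZ' : s' ∉ near G p)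
    (hsa : G.Adj s a) (hsa' : G.Adj s' a) (h1 : ∀ w, w ∉ S → G.Adj s w → w = a)
    (h1' : ∀ w, w ∉ S → G.Adj s' w → w = a) : s = s' := by
  by_contra hne
  have hsol := isMDDMaxSolution_iff.1 hS.sol
  obtain ⟨hsp, hps, hps2⟩ := notMem_near hsZ
  obtain ⟨hsp', hps', -⟩ := notMem_near hsZ'
  have hap : a ≠ p := by rintro rfl; exact hps hsa.symm
  have hpa : ¬ G.Adj p a := fun h => hps2 a h hsa.symm
  set S' := insert a ((S.erase s).erase s') with hS'
  have hm : ∀ w, w ∉ S' ↔ w ≠ a ∧ (w = s ∨ w = s' ∨ w ∉ S) := fun w => by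
    simp only [hS', Finset.mem_insert, Finset.mem_erase]
    tauto
  have hsub : ∀ v, v ∉ S → v ≠ a → keep G S' v ≤ keep G S v := fun v hv hva => by
    refine Finset.card_le_card fun w hw => ?_
    simp only [Finset.mem_filter, SimpleGraph.mem_neighborFinset, hm] at hw ⊢
    obtain ⟨hvw, -, rfl | rfl | hwS⟩ := hw
    exacts [absurd (h1 v hv hvw.symm) hva, absurd (h1' v hv hvw.symm) hva, ⟨hvw, hwS⟩]
  have hone : ∀ r r', (∀ w, w ∉ S → G.Adj r w → w = a) → (∀ w, w ∉ S' → w ∉ S ∨ w = r ∨ w = r') →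
      keep G S' r ≤ 1 := fun r r' hr hrr => by
    refine (Finset.card_le_card (t := {r'}) fun w hw => ?_).trans (by simp)
    simp only [Finset.mem_filter, SimpleGraph.mem_neighborFinset] at hw
    rw [Finset.mem_singleton]
    rcases hrr w hw.2 with h | rfl | h
    exacts [absurd (hr w h hw.1) ((hm w).1 hw.2).1, absurd hw.1 G.irrefl, h]
  have hkp : 2 ≤ keep G S' p := by
    rw [← h2]
    refine Finset.card_le_card fun w hw => ?_
    simp only [Finset.mem_filter, SimpleGraph.mem_neighborFinset, hm] at hw ⊢
    exact ⟨hw.1, fun h => hpa (h ▸ hw.1), Or.inr (Or.inr hw.2)⟩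
  -- Deleting `a` instead of `s` and `s'` would save a vertex: without `a`, both have degree at most
  -- one, from a possible edge between them.
  have hsol' : IsMDDMaxSolution G p S' := by
    rw [isMDDMaxSolution_iff]
    refine ⟨(hm p).2 ⟨hap.symm, Or.inr (Or.inr hsol.1)⟩, fun v hv hvp => lt_of_lt_of_le ?_ hkp⟩
    obtain ⟨hva, rfl | rfl | hvS⟩ := (hm v).1 hv
    · have := hone v s' h1 fun w hw => by have := (hm w).1 hw; tauto
      omega
    · have := hone v s h1' fun w hw => by have := (hm w).1 hw; tauto
      omega
    · have := hsub v hvS hva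
      have := hsol.2 v hvS hvp
      omega
  have h3 := hS.le _ hsol' (by
    refine (Finset.card_le_card (t := {a, s, s'}) fun w hw => ?_).trans Finset.card_le_three
    simp only [hS', Finset.mem_symmDiff, Finset.mem_erase, Finset.mem_insert,
      Finset.mem_singleton] at hw ⊢
    tauto)
  have h4 := Finset.card_insert_le a ((S.erase s).erase s')
  rw [← hS'] at h4
  have h5 := Finset.card_erase_lt_of_mem (Finset.mem_erase.2 ⟨Ne.symm hne, hs'⟩)
  have h6 := Finset.card_erase_lt_of_mem hs
  omega

/-- The edges between `F` and the kept vertices are counted twice. Each vertex of `F` has at least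
two kept neighbours, except those of `L`, which have one. Each kept vertex sends at most three such
edges, and one fewer if it is in `K₁`. The map to the only kept neighbour injects `L` into `K₁`, so
the corrections cancel in the right direction and `2|F| ≤ 3(n - |S|)`; at most 13 vertices of `S`
are missing from `F`. -/
lemma LocallyMinimal.card_le_of_keep_eq_two (hG : G.IsRegularOfDegree 3)
    (hS : LocallyMinimal G p S) (h2 : keep G S p = 2) :
    5 * S.card ≤ 3 * Fintype.card V + 26 := by
  set F := S \ near G p with hF
  set L := F.filter fun s => keep G S s ≤ 1 with hL
  set K₁ := Sᶜ.filter fun a => 1 ≤ keep G S a with hK₁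
  have hFS : ∀ s ∈ F, s ∈ S ∧ s ∉ near G p := fun s hs => by simpa [hF] using hs
  have hex : ∀ s, ∃ a, s ∈ L → a ∈ K₁ ∧ G.Adj s a ∧ ∀ w, w ∉ S → G.Adj s w → w = a := fun s => by
    by_cases hs : s ∈ L
    · have hs' := Finset.mem_filter.1 hs
      obtain ⟨hsS, hsZ⟩ := hFS s hs'.1
      obtain ⟨a, ha, hsa, hka⟩ := hS.exists_kept h2 hsS hsZ hs'.2
      refine ⟨a, fun _ => ⟨by simp [hK₁, ha, hka], hsa, fun w hw hsw => ?_⟩⟩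
      exact Finset.card_le_one.1 hs'.2 w (by simp [hw, hsw]) a (by simp [ha, hsa])
    · exact ⟨s, fun h => absurd h hs⟩
  choose f hf using hex
  have hcard : L.card ≤ K₁.card := by
    refine Finset.card_le_card_of_injOn f (fun s hs => (hf s hs).1) fun s hs s' hs' he => ?_
    obtain ⟨-, h3, h4⟩ := hf s hs
    obtain ⟨-, h3', h4'⟩ := hf s' hs'
    rw [← he] at h3' h4'
    obtain ⟨hsS, hsZ⟩ := hFS s (Finset.mem_filter.1 hs).1
    obtain ⟨hsS', hsZ'⟩ := hFS s' (Finset.mem_filter.1 hs').1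
    exact hS.eq_of_kept h2 hsS hsZ hsS' hsZ' h3 h3' h4 h4'
  have hlow : 2 * F.card ≤ ∑ s ∈ F, keep G S s + L.card := by
    rw [hL, Finset.card_filter, ← Finset.sum_add_distrib, mul_comm, ← smul_eq_mul,
      ← Finset.sum_const]
    refine Finset.sum_le_sum fun s hs => ?_
    split_ifs with hk
    · obtain ⟨hsS, hsZ⟩ := hFS s hs
      obtain ⟨a, ha, hsa, -⟩ := hS.exists_kept h2 hsS hsZ hk
      have : 0 < keep G S s := Finset.card_pos.2 ⟨a, by simp [ha, hsa]⟩
      omega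
    · omega
  have hswap : ∑ s ∈ F, keep G S s = ∑ a ∈ Sᶜ, (nb G F a).card := by
    have h3 := Finset.sum_card_bipartiteAbove_eq_sum_card_bipartiteBelow (s := F) (t := Sᶜ) G.Adj
    refine (Finset.sum_congr rfl fun s _ => ?_).trans (h3.trans (Finset.sum_congr rfl fun a _ => ?_))
    · unfold keep Finset.bipartiteAbove
      congr 1
      ext w
      simp [and_comm]
    · unfold nb Finset.bipartiteBelow
      congr 1
      ext w
      simp [and_comm, G.adj_comm]
  have hup : ∑ a ∈ Sᶜ, (nb G F a).card + K₁.card ≤ 3 * Sᶜ.card := by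
    rw [hK₁, Finset.card_filter, ← Finset.sum_add_distrib, mul_comm, ← smul_eq_mul]
    refine Finset.sum_le_card_nsmul _ _ _ fun a _ => ?_
    have h3 := nb_add_keep hG S a
    have h4 : (nb G F a).card ≤ (nb G S a).card := Finset.card_le_card fun w hw => by
      rw [mem_nb] at hw ⊢
      exact ⟨hw.1, (hFS w hw.2).1⟩
    split_ifs <;> omega
  have h3 := Finset.card_add_card_compl S
  have h4 : S.card ≤ F.card + (near G p).card := by
    have := Finset.le_card_sdiff (near G p) S
    rw [← hF] at this
    omega
  have h5 := card_near_le hG p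
  omega

lemma LocallyMinimal.card_le_of_not_feasible (hG : G.IsRegularOfDegree 3)
    (hS : LocallyMinimal G p S) (hp : ¬ Feasible G p) (hn : 1000 ≤ Fintype.card V) {T : Finset V}
    (hT : IsMDDMaxSolution G p T) : 1000 * S.card ≤ 1583 * T.card := by
  have h1 := keep_le_two_of_not_feasible hG hS.sol hp
  have h2 := keep_ne_one hS.sol
  rcases (by omega : keep G S p = 0 ∨ keep G S p = 2) with h | h
  · have := hS.card_le_of_keep_eq_zero h hT
    omega
  · have h3 := hS.card_le_of_keep_eq_two hG h
    have h4 := CubicDomination.card_le_of_not_feasible hG hT hp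
    omega

/-! ### The objective of the algorithm -/

/-- The number of vertices from which the dominating set is used. -/
def threshold : ℕ := 500000

open Classical in
/-- The objective of the local search. -/
noncomputable def objective (G : SimpleGraph V) [DecidableRel G.Adj] (p : V) (S : Finset V) : ℕ :=
  if threshold < Fintype.card V ∧ Feasible G p then weight G S
  -- The penalty `n + 1` exceeds the size of every solution.
  else if IsMDDMaxSolution G p S then S.card else Fintype.card V + 1

open Classical in
/-- The solution that is made from a local optimum. -/
noncomputable def result (G : SimpleGraph V) [DecidableRel G.Adj] (p : V) (S : Finset V) :
    Finset V :=
  if threshold < Fintype.card V ∧ Feasible G p then repair G p S else S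

lemma isMDDMaxSolution_erase (p : V) : IsMDDMaxSolution G p (Finset.univ.erase p) := by
  rw [isMDDMaxSolution_iff]
  exact ⟨by simp, fun v hv hvp => absurd (Finset.mem_erase.2 ⟨hvp, Finset.mem_univ v⟩) hv⟩

lemma objective_le (hG : G.IsRegularOfDegree 3) (p : V) (S : Finset V) :
    objective G p S ≤ 60 * Fintype.card V + 1 := by
  have h1 := weight_le hG S
  have h2 := Finset.card_le_univ S
  unfold objective
  split_ifs <;> omega

/-- A local optimum that is not worse than the solution which keeps only `p` gives an
approximation. -/
theorem result_spec (hG : G.IsRegularOfDegree 3)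
    (hle : objective G p S ≤ objective G p (Finset.univ.erase p))
    (hloc : ∀ S', (symmDiff S S').card ≤ threshold → objective G p S ≤ objective G p S') :
    IsMDDMaxSolution G p (result G p S) ∧
      ∀ T, IsMDDMaxSolution G p T → 1000 * (result G p S).card ≤ 1583 * T.card := by
  by_cases hf : threshold < Fintype.card V ∧ Feasible G p
  · have hD : LocallyOptimal G S := locallyOptimal_of_weight_le hG fun D' hD' => by
      have := hloc D' (hD'.trans (by norm_num [threshold]))
      simpa only [objective, if_pos hf] using this
    rw [result, if_pos hf]
    refine ⟨isMDDMaxSolution_repair hG hf.2 hD.dom, fun T hT => ?_⟩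
    -- The coefficients `1583/4` and `1000000/2527` of `n` differ by more than 0.0238; for `n >
    -- 500000` this outweighs the error `9000 + 1583/4` from the repair and from the lower bound.
    have h1 := hD.card_le hG
    have h2 := card_repair_le hG p (D := S)
    have h3 := card_le_of_isMDDMaxSolution hG hT
    have h4 := hf.1
    unfold threshold at h4
    omega
  · have hob : ∀ S', IsMDDMaxSolution G p S' → objective G p S' = S'.card := fun S' hS' => by
      rw [objective, if_neg hf, if_pos hS']
    have hS : IsMDDMaxSolution G p S := by
      by_contra hS
      rw [hob _ (isMDDMaxSolution_erase p), objective, if_neg hf, if_neg hS] at hle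
      have := Finset.card_le_univ (Finset.univ.erase p)
      omega
    have hmin : ∀ S', IsMDDMaxSolution G p S' → (symmDiff S S').card ≤ threshold →
        S.card ≤ S'.card := fun S' hS' hd => by
      have := hloc S' hd
      rwa [hob _ hS, hob _ hS'] at this
    rw [result, if_neg hf]
    refine ⟨hS, fun T hT => ?_⟩
    by_cases hn : threshold < Fintype.card V
    · refine LocallyMinimal.card_le_of_not_feasible hG ⟨hS, fun S' hS' hd => hmin S' hS'
        (hd.trans (by norm_num [threshold]))⟩ (fun h => hf ⟨hn, h⟩) ?_ hT
      unfold threshold at hn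
      omega
    -- With at most `threshold` vertices every set is within the search radius, so the local optimum
    -- is global.
    · have := hmin T hT ((Finset.card_le_univ _).trans (not_lt.1 hn))
      omega

end CubicDomination

/-! ### Running time bounds for programs, and evaluation of terms with bounded sums. -/

namespace RAM

/-- `Runs c s B Q`: the program `c`, started on `s`, halts after at most `B` steps with a store that
satisfies `Q`. -/
def Runs (c : Cmd) (s : Store) (B : ℕ) (Q : Store → Prop) : Prop :=
  ∃ t s', Exec c s t s' ∧ t ≤ B ∧ Q s'

namespace Runs
variable {c d : Cmd} {s : Store} {B B' : ℕ} {Q R : Store → Prop}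

lemma mono (h : Runs c s B R) (hB : B ≤ B') (hQ : ∀ s', R s' → Q s') : Runs c s B' Q := by
  obtain ⟨t, s', h1, h2, h3⟩ := h
  exact ⟨t, s', h1, h2.trans hB, hQ s' h3⟩

lemma of_le (h : Runs c s B Q) (hB : B ≤ B') : Runs c s B' Q := h.mono hB fun _ h => h

lemma assign {r : ℕ} {e : Expr} (h : Q (s.setReg r (e.eval s))) :
    Runs (.assign r e) s (e.cost + 1) Q := ⟨_, _, .assign r e s, le_rfl, h⟩

lemma write {a : ℕ} {i e : Expr} (h : Q (s.setArr a (i.eval s) (e.eval s))) :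
    Runs (.write a i e) s (i.cost + e.cost + 1) Q := ⟨_, _, .write a i e s, le_rfl, h⟩

lemma skip (h : Q s) : Runs .skip s 1 Q := ⟨_, _, .skip s, le_rfl, h⟩

lemma seq (h : Runs c s B R) (h' : ∀ s', R s' → Runs d s' B' Q) :
    Runs (.seq c d) s (B + B') Q := by
  obtain ⟨t, s', h1, h2, h3⟩ := h
  obtain ⟨t', s'', h1', h2', h3'⟩ := h' s' h3
  exact ⟨_, _, .seq h1 h1', add_le_add h2 h2', h3'⟩

lemma cond {e : Expr} (h : e.eval s ≠ 0 → Runs c s B Q) (h' : e.eval s = 0 → Runs d s B' Q) :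
    Runs (.cond e c d) s (e.cost + 1 + (B + B')) Q := by
  by_cases he : e.eval s = 0
  · obtain ⟨t, s', h1, h2, h3⟩ := h' he
    exact ⟨_, _, .cond_false he h1, by omega, h3⟩
  · obtain ⟨t, s', h1, h2, h3⟩ := h he
    exact ⟨_, _, .cond_true he h1, by omega, h3⟩

/-- The invariant `J` comes with a measure `μ` that decreases in every pass, so `N` bounds the
number of passes; the last summand pays for the final test of the guard. -/
lemma loop {e : Expr} (J : Store → Prop) (μ : Store → ℕ)
    (h : ∀ s, J s → e.eval s ≠ 0 → Runs c s B fun s' => J s' ∧ μ s' < μ s) {N : ℕ} (hs : J s)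
    (hN : μ s ≤ N) :
    Runs (.loop e c) s (N * (e.cost + 1 + B) + (e.cost + 1)) fun s' => J s' ∧ e.eval s' = 0 := by
  induction N generalizing s with
  | zero =>
    by_cases he : e.eval s = 0
    · exact ⟨_, _, .loop_false he, by omega, hs, he⟩
    · obtain ⟨t, s', -, -, -, h4⟩ := h s hs he
      omega
  | succ N ih =>
    by_cases he : e.eval s = 0
    · exact ⟨_, _, .loop_false he, by omega, hs, he⟩
    · obtain ⟨t, s', h1, h2, h3, h4⟩ := h s hs he
      obtain ⟨t', s'', h1', h2', h3'⟩ := ih h3 (by omega)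
      refine ⟨_, _, .loop_true he h1 h1', ?_, h3'⟩
      rw [add_mul, one_mul]
      omega

end Runs

@[simp] lemma Store.setReg_reg (s : Store) (r v q : ℕ) :
    (s.setReg r v).reg q = if q = r then v else s.reg q := by
  simp [Store.setReg, Function.update_apply]

@[simp] lemma Store.setReg_arr (s : Store) (r v : ℕ) : (s.setReg r v).arr = s.arr := rfl

@[simp] lemma Store.setArr_reg (s : Store) (a i v : ℕ) : (s.setArr a i v).reg = s.reg := rfl

lemma Store.setArr_arr (s : Store) (a i v b j : ℕ) :
    (s.setArr a i v).arr b j = if b = a ∧ j = i then v else s.arr b j := by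
  by_cases hb : b = a
  · subst hb; simp [Store.setArr, Function.update_apply]
  · simp [Store.setArr, hb]

lemma Store.setArr_arr_of_ne (s : Store) (a i v : ℕ) {b : ℕ} (h : b ≠ a) :
    (s.setArr a i v).arr b = s.arr b := by
  simp [Store.setArr, h]

/-- Terms with bounded sums; `var i` is the variable of the `i`-th enclosing sum. -/
inductive Term : Type
  | const (k : ℕ) : Term
  | var (i : ℕ) : Term
  | read (a : ℕ) (t : Term) : Term
  | add (t u : Term) : Term
  | sub (t u : Term) : Term
  | ite (t u v : Term) : Term
  | sum (t : Term) : Term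

/-- The value of a term for the bound `n` of the sums, the arrays `m` and the values `ρ` of the
variables. -/
def Term.eval (n : ℕ) (m : ℕ → ℕ → ℕ) : Term → List ℕ → ℕ
  | const k, _ => k
  | var i, ρ => ρ.getD i 0
  | read a t, ρ => m a (t.eval n m ρ)
  | add t u, ρ => t.eval n m ρ + u.eval n m ρ
  | sub t u, ρ => t.eval n m ρ - u.eval n m ρ
  | ite t u v, ρ => if t.eval n m ρ ≠ 0 then u.eval n m ρ else v.eval n m ρ
  | sum t, ρ => ∑ i ∈ Finset.range n, t.eval n m (i :: ρ)

/-- Every term is evaluated in polynomial time, with the variables in the registers `env` and the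
result in the register `r`. -/
theorem Term.exists_cmd (T : Term) : ∀ (env : List ℕ) (r : ℕ), (∀ q ∈ env, q < r) → 0 < r →
    ∃ (c : Cmd) (P : Polynomial ℕ), ∀ (n : ℕ) (s : Store), s.reg 0 = n →
      Runs c s (P.eval n) fun s' =>
        s'.reg r = T.eval n s.arr (env.map s.reg) ∧ (∀ q < r, s'.reg q = s.reg q) ∧
          s'.arr = s.arr := by
  have henv : ∀ {env : List ℕ} {r : ℕ} {s s' : Store}, (∀ q ∈ env, q < r) →
      (∀ q < r, s'.reg q = s.reg q) → env.map s'.reg = env.map s.reg := fun h h' =>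
    List.map_congr_left fun q hq => h' q (h q hq)
  have hsucc : ∀ {env : List ℕ} {r : ℕ}, (∀ q ∈ env, q < r) → ∀ q ∈ env, q < r + 1 := fun h q hq =>
    (h q hq).trans (Nat.lt_succ_self _)
  induction T with
  | const k =>
    intro env r _ _
    refine ⟨.assign r (.const k), Polynomial.C 2, fun n s hn => ?_⟩
    refine (Runs.assign ⟨?h1, fun q hq => ?h2, rfl⟩).of_le ?hb
    case h1 => simp [Expr.eval, eval]
    case h2 => simp [hq.ne]
    case hb => simp [Expr.cost]
  | var i =>
    intro env r _ _
    refine ⟨.assign r (if i < env.length then .reg (env.getD i 0) else .const 0), Polynomial.C 2,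
      fun n s hn => ?_⟩
    refine (Runs.assign ⟨?h1, fun q hq => ?h2, rfl⟩).of_le ?hb
    case h1 => split_ifs with hi <;> simp [Expr.eval, eval, hi]
    case h2 => simp [hq.ne]
    case hb => split_ifs <;> simp [Expr.cost]
  | read a t ih =>
    intro env r h hr
    obtain ⟨c, P, hc⟩ := ih env r h hr
    refine ⟨.seq c (.assign r (.read a (.reg r))), P + Polynomial.C 3, fun n s hn => ?_⟩
    refine ((hc n s hn).seq fun s' hs' => Runs.assign ⟨?h1, fun q hq => ?h2, ?h3⟩).of_le ?hb
    case h1 => simp [Expr.eval, eval, hs'.1, hs'.2.2]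
    case h2 => simp [hq.ne, hs'.2.1 q hq]
    case h3 => simp [hs'.2.2]
    case hb => simp [Expr.cost]
  | add t u iht ihu =>
    intro env r h hr
    obtain ⟨c, P, hc⟩ := iht env r h hr
    obtain ⟨d, P', hd⟩ := ihu env (r + 1) (hsucc h) r.succ_pos
    refine ⟨.seq c (.seq d (.assign r (.add (.reg r) (.reg (r + 1))))), P + (P' + Polynomial.C 4),
      fun n s hn => ?_⟩
    refine ((hc n s hn).seq fun s' hs' => (hd n s' ((hs'.2.1 0 hr).trans hn)).seq fun s'' hs'' =>
      Runs.assign ⟨?h1, fun q hq => ?h2, ?h3⟩).of_le ?hb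
    case h1 =>
      simp [Expr.eval, eval, hs''.2.1 r, hs'.1, hs''.1, hs'.2.2, henv h hs'.2.1]
    case h2 => simp [hq.ne, hs''.2.1 q (by omega), hs'.2.1 q hq]
    case h3 => simp [hs'.2.2, hs''.2.2]
    case hb => simp [Expr.cost]
  | sub t u iht ihu =>
    intro env r h hr
    obtain ⟨c, P, hc⟩ := iht env r h hr
    obtain ⟨d, P', hd⟩ := ihu env (r + 1) (hsucc h) r.succ_pos
    refine ⟨.seq c (.seq d (.assign r (.sub (.reg r) (.reg (r + 1))))), P + (P' + Polynomial.C 4),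
      fun n s hn => ?_⟩
    refine ((hc n s hn).seq fun s' hs' => (hd n s' ((hs'.2.1 0 hr).trans hn)).seq fun s'' hs'' =>
      Runs.assign ⟨?h1, fun q hq => ?h2, ?h3⟩).of_le ?hb
    case h1 =>
      simp [Expr.eval, eval, hs''.2.1 r, hs'.1, hs''.1, hs'.2.2, henv h hs'.2.1]
    case h2 => simp [hq.ne, hs''.2.1 q (by omega), hs'.2.1 q hq]
    case h3 => simp [hs'.2.2, hs''.2.2]
    case hb => simp [Expr.cost]
  | ite t u v iht ihu ihv =>
    intro env r h hr
    obtain ⟨c, P, hc⟩ := iht env r h hr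
    obtain ⟨d, P', hd⟩ := ihu env r h hr
    obtain ⟨e, P'', he⟩ := ihv env r h hr
    refine ⟨.seq c (.cond (.reg r) d e), P + (Polynomial.C 2 + (P' + P'')), fun n s hn => ?_⟩
    refine ((hc n s hn).seq fun s' hs' => Runs.cond (B := P'.eval n) (B' := P''.eval n)
      (fun h0 => ?h1) fun h0 => ?h2).of_le ?hb
    case h1 =>
      refine (hd n s' ((hs'.2.1 0 hr).trans hn)).mono le_rfl fun s'' hs'' => ⟨?_, fun q hq => ?_, ?_⟩
      · rw [hs''.1, hs'.2.2, henv h hs'.2.1, eval, if_pos (hs'.1 ▸ h0)]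
      · rw [hs''.2.1 q hq, hs'.2.1 q hq]
      · rw [hs''.2.2, hs'.2.2]
    case h2 =>
      refine (he n s' ((hs'.2.1 0 hr).trans hn)).mono le_rfl fun s'' hs'' => ⟨?_, fun q hq => ?_, ?_⟩
      · rw [hs''.1, hs'.2.2, henv h hs'.2.1, eval, if_neg (not_not.2 (hs'.1 ▸ h0))]
      · rw [hs''.2.1 q hq, hs'.2.1 q hq]
      · rw [hs''.2.2, hs'.2.2]
    case hb => simp [Expr.cost]
  | sum t ih =>
    intro env r h hr
    obtain ⟨c, P, hc⟩ := ih (r :: env) (r + 2) (by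
      intro q hq
      rcases List.mem_cons.1 hq with rfl | hq
      · omega
      · have := h q hq; omega) (by omega)
    -- Register `r` holds the summation variable, `r + 1` the partial sum and `r + 2` the value of
    -- the summand.
    refine ⟨.seq (.assign r (.const 0)) (.seq (.assign (r + 1) (.const 0))
      (.seq (.loop (.sub (.reg 0) (.reg r)) (.seq c (.seq
        (.assign (r + 1) (.add (.reg (r + 1)) (.reg (r + 2))))
        (.assign r (.add (.reg r) (.const 1))))))
      (.assign r (.reg (r + 1))))),
      Polynomial.C 2 + (Polynomial.C 2 + (Polynomial.X * (Polynomial.C 4 + (P + Polynomial.C 8)) +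
        Polynomial.C 4 + Polynomial.C 2)), fun n s hn => ?_⟩
    let J : Store → Prop := fun s' => s'.reg r ≤ n ∧
      s'.reg (r + 1) = ∑ i ∈ Finset.range (s'.reg r), t.eval n s.arr (i :: env.map s.reg) ∧
      (∀ q < r, s'.reg q = s.reg q) ∧ s'.arr = s.arr
    have hloop := fun s' (hs' : J s') => Runs.loop (c := .seq c (.seq
        (.assign (r + 1) (.add (.reg (r + 1)) (.reg (r + 2))))
        (.assign r (.add (.reg r) (.const 1))))) (B := P.eval n + 8)
        (e := .sub (.reg 0) (.reg r)) J (fun s' => n - s'.reg r) (fun s' hs' he => by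
      obtain ⟨h1, h2, h3, h4⟩ := hs'
      have h0 : s'.reg 0 = n := (h3 0 hr).trans hn
      simp only [Expr.eval, h0] at he
      refine ((hc n s' h0).seq fun s₁ hs₁ => Runs.seq (B' := 4) (R := fun s₂ =>
        s₂ = s₁.setReg (r + 1) (s₁.reg (r + 1) + s₁.reg (r + 2))) (Runs.assign rfl)
        fun s₂ hs₂ => Runs.assign ?_).of_le ?hb
      case hb => simp [Expr.cost]
      obtain ⟨h5, h6, h7⟩ := hs₁
      subst hs₂
      have hr1 : s₁.reg r = s'.reg r := h6 r (by omega)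
      refine ⟨⟨?_, ?_, fun q hq => ?_, ?_⟩, ?_⟩
      · simp [Expr.eval, hr1]; omega
      · simp [Expr.eval, hr1, Finset.sum_range_succ, h6 (r + 1), h5, h2, h4, henv h h3]
      · simp [hq.ne, (show q ≠ r + 1 by omega), h6 q (by omega), h3 q hq]
      · simp [h7, h4]
      · simp [Expr.eval, hr1]; omega) hs' (Nat.sub_le _ _)
    refine Runs.of_le (Runs.seq (B' := _) (R := fun s₁ => s₁ = s.setReg r 0) (Runs.assign rfl)
      fun s₁ hs₁ => Runs.seq (B' := _) (R := fun s₂ => s₂ = s₁.setReg (r + 1) 0) (Runs.assign rfl)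
      fun s₂ hs₂ => (hloop s₂ ?hJ).seq fun s₃ hs₃ => Runs.assign ⟨?h1, fun q hq => ?h2, ?h3⟩) ?hb
    case hJ =>
      subst hs₁ hs₂
      refine ⟨by simp, by simp, fun q hq => ?_, rfl⟩
      simp [hq.ne, (show q ≠ r + 1 by omega)]
    all_goals try obtain ⟨⟨h1, h2, h3, h4⟩, h5⟩ := hs₃
    case h1 =>
      simp only [Expr.eval, h3 0 hr, hn] at h5
      have hrn : s₃.reg r = n := by omega
      simp [Expr.eval, eval, h2, hrn]
    case h2 => simp [hq.ne, h3 q hq]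
    case h3 => simp [h4]
    case hb => simp [Expr.cost]

end RAM

/-! ### Local search as a program. -/

namespace RAM

/-- The vertices whose cells are nonzero. -/
def cells (n : ℕ) (m : ℕ → ℕ) : Finset (Fin n) := Finset.univ.filter fun v => m v ≠ 0

lemma mem_cells {n : ℕ} {m : ℕ → ℕ} {v : Fin n} : v ∈ cells n m ↔ m v ≠ 0 := by simp [cells]

/-- A program that fills the array `b` with the values of a term in the index and in register `1`. -/
lemma exists_fill (T : Term) (b r : ℕ) (hr : 2 ≤ r) :
    ∃ (c : Cmd) (P : Polynomial ℕ), ∀ (n : ℕ) (s : Store) (R : ℕ → Prop), s.reg 0 = n →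
      (∀ m : ℕ → ℕ → ℕ, (∀ a, a ≠ b → m a = s.arr a) → ∀ i < n,
        (T.eval n m [i, s.reg 1] ≠ 0 ↔ R i)) →
      Runs c s (P.eval n) fun s' => (∀ i < n, s'.arr b i ≠ 0 ↔ R i) ∧
        (∀ q < r, s'.reg q = s.reg q) ∧ ∀ a, a ≠ b → s'.arr a = s.arr a := by
  obtain ⟨c, P, hc⟩ := T.exists_cmd [r, 1] (r + 1) (by simp; omega) (by omega)
  refine ⟨.seq (.assign r (.const 0)) (.loop (.sub (.reg 0) (.reg r)) (.seq c (.seq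
      (.write b (.reg r) (.reg (r + 1))) (.assign r (.add (.reg r) (.const 1)))))),
    Polynomial.C 2 + (Polynomial.X * (Polynomial.C 4 + (P + Polynomial.C 7)) + Polynomial.C 4),
    fun n s R hn hR => ?_⟩
  let J : Store → Prop := fun s' => s'.reg r ≤ n ∧ (∀ i < s'.reg r, s'.arr b i ≠ 0 ↔ R i) ∧
    (∀ q < r, s'.reg q = s.reg q) ∧ ∀ a, a ≠ b → s'.arr a = s.arr a
  refine Runs.of_le (Runs.seq (B' := _) (R := fun s₁ => s₁ = s.setReg r 0) (Runs.assign rfl)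
    fun s₁ hs₁ => (Runs.loop (B := P.eval n + 7) J (fun s' => n - s'.reg r) (N := n)
      (fun s' hs' he => ?hstep) ?hJ (Nat.sub_le _ _)).mono le_rfl fun s' hs' => ?hfin) ?hb
  case hb => simp [Expr.cost]
  case hJ =>
    subst hs₁
    exact ⟨by simp, by simp, fun q hq => by simp [hq.ne], fun a _ => rfl⟩
  case hfin =>
    obtain ⟨⟨h1, h2, h3, h4⟩, h5⟩ := hs'
    simp only [Expr.eval, h3 0 (by omega), hn] at h5
    exact ⟨fun i hi => h2 i (by omega), h3, h4⟩
  case hstep =>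
    obtain ⟨h1, h2, h3, h4⟩ := hs'
    have h0 : s'.reg 0 = n := (h3 0 (by omega)).trans hn
    simp only [Expr.eval, h0] at he
    refine ((hc n s' h0).seq fun s₁ hs₁ => Runs.seq (B' := 4) (R := fun s₂ =>
      s₂ = s₁.setArr b (s₁.reg r) (s₁.reg (r + 1))) (Runs.write rfl)
      fun s₂ hs₂ => Runs.assign ?_).of_le ?hb
    case hb => simp [Expr.cost]
    obtain ⟨h5, h6, h7⟩ := hs₁
    subst hs₂
    have hr1 : s₁.reg r = s'.reg r := h6 r (by omega)
    -- The array `b` is already partly overwritten, which is why the hypothesis on the term is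
    -- required for every content of `b`.
    have hv := hR s'.arr h4 (s'.reg r) (by omega)
    have hv' : s₁.reg (r + 1) ≠ 0 ↔ R (s'.reg r) := by
      rw [h5, ← hv]
      simp [h3 1 (by omega)]
    refine ⟨⟨?_, fun i hi => ?_, fun q hq => ?_, fun a ha => ?_⟩, ?_⟩
    · simp [Expr.eval, hr1]; omega
    · rw [Store.setReg_arr, Store.setArr_arr, hr1, h7]
      simp only [Expr.eval, Store.setReg_reg, Store.setArr_reg, hr1, if_true] at hi
      by_cases hir : i = s'.reg r
      · simp only [hir, and_self, if_true]; exact hv'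
      · simp only [hir, and_false, if_false]; exact h2 i (by omega)
    · simp [hq.ne, h6 q (by omega), h3 q hq]
    · rw [Store.setReg_arr, Store.setArr_arr_of_ne _ _ _ _ ha, h7, h4 a ha]
    · simp [Expr.eval, hr1]; omega

/-- A program that copies the array `a` to the array `b`. -/
lemma exists_copy (a b r : ℕ) (hr : 2 ≤ r) (hab : a ≠ b) :
    ∃ (c : Cmd) (P : Polynomial ℕ), ∀ (n : ℕ) (s : Store), s.reg 0 = n →
      Runs c s (P.eval n) fun s' => cells n (s'.arr b) = cells n (s.arr a) ∧
        (∀ q < r, s'.reg q = s.reg q) ∧ ∀ a, a ≠ b → s'.arr a = s.arr a := by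
  obtain ⟨c, P, hc⟩ := exists_fill (.read a (.var 0)) b r hr
  refine ⟨c, P, fun n s hn => (hc n s (fun i => s.arr a i ≠ 0) hn fun m hm i _ => ?_).mono le_rfl
    fun s' hs' => ⟨?_, hs'.2⟩⟩
  · simp [Term.eval, hm a hab]
  · ext v
    rw [mem_cells, mem_cells, hs'.1 v v.2]

/-- The term `T` computes `W` for the set in array `2`. -/
def Computes (T : Term) (n p : ℕ) (A : ℕ → ℕ) (W : Finset (Fin n) → ℕ) : Prop :=
  ∀ m : ℕ → ℕ → ℕ, m 0 = A → T.eval n m [p] = W (cells n (m 2))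

/-- The vertex with the number `i`, if there is one. -/
def single (n i : ℕ) : Finset (Fin n) := Finset.univ.filter fun v => (v : ℕ) = i

/-- Truncated subtraction sends every nonzero cell to 0 and a zero cell to 1, so the assignment
toggles membership. -/
lemma cells_update (n : ℕ) (m : ℕ → ℕ) (i : ℕ) :
    cells n (Function.update m i (1 - m i)) = symmDiff (cells n m) (single n i) := by
  ext v
  simp only [Finset.mem_symmDiff, mem_cells, single, Finset.mem_filter, Finset.mem_univ, true_and,
    Function.update_apply]
  by_cases hv : (v : ℕ) = i
  · subst hv; simp; omega
  · simp [hv]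

/-- The conditions that hold before and after every pass of the search: the array `3` holds the best
set, and register `2` its value. -/
structure Inv (n p : ℕ) (A : ℕ → ℕ) (W : Finset (Fin n) → ℕ) (s : Store) : Prop where
  size : s.reg 0 = n
  point : s.reg 1 = p
  graph : s.arr 0 = A
  best : W (cells n (s.arr 3)) = s.reg 2

/-- A program that inspects all sets which differ from the set in array `2` in at most `k`
vertices. -/
lemma exists_pass (T : Term) (k : ℕ) : ∀ r : ℕ, 3 ≤ r → ∃ (c : Cmd) (P : Polynomial ℕ),
    ∀ (n p : ℕ) (A : ℕ → ℕ) (W : Finset (Fin n) → ℕ), Computes T n p A W →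
      ∀ s, Inv n p A W s → Runs c s (P.eval n) fun s' => Inv n p A W s' ∧
        cells n (s'.arr 2) = cells n (s.arr 2) ∧ s'.reg 2 ≤ s.reg 2 ∧
        (∀ q < r, q ≠ 2 → s'.reg q = s.reg q) ∧
        ∀ S', (symmDiff (cells n (s.arr 2)) S').card ≤ k → s'.reg 2 ≤ W S' := by
  induction k with
  | zero =>
    intro r hr
    obtain ⟨c, P, hc⟩ := T.exists_cmd [1] r (by simp; omega) (by omega)
    obtain ⟨d, P', hd⟩ := exists_copy 2 3 r (by omega) (by norm_num)
    refine ⟨.seq c (.cond (.sub (.reg 2) (.reg r)) (.seq (.assign 2 (.reg r)) d) .skip),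
      P + (Polynomial.C 4 + (Polynomial.C 2 + P' + Polynomial.C 1)), fun n p A W hT s hs => ?_⟩
    refine ((hc n s hs.size).seq fun s₁ hs₁ => Runs.cond (B := 2 + P'.eval n) (B' := 1)
      (fun he => Runs.of_le (Runs.seq (B' := P'.eval n)
        (R := fun s₂ => s₂ = s₁.setReg 2 (s₁.reg r)) (Runs.assign rfl)
        fun s₂ hs₂ => (hd n s₂ ?h0).mono le_rfl fun s₃ hs₃ => ?h1) ?hb)
        fun he => Runs.skip ?h2).of_le ?hb'
    case hb => simp [Expr.cost]
    case hb' => simp [Expr.cost]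
    all_goals
      obtain ⟨h1, h2, h3⟩ := hs₁
      have hval : s₁.reg r = W (cells n (s.arr 2)) := by
        rw [h1]; simp [hs.point, hT s.arr hs.graph]
      have hS' : ∀ S', (symmDiff (cells n (s.arr 2)) S').card ≤ 0 → cells n (s.arr 2) = S' :=
        fun S' h => by simpa using h
      simp only [Expr.eval, h2 2 (by omega)] at he
    case h0 => subst hs₂; simp [h2 0 (by omega), hs.size]
    case h1 =>
      obtain ⟨h4, h5, h6⟩ := hs₃
      subst hs₂
      have hb : s₃.reg 2 = s₁.reg r := by rw [h5 2 (by omega)]; simp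
      refine ⟨⟨?_, ?_, ?_, ?_⟩, ?_, ?_, fun q hq hq2 => ?_, fun S' hS => ?_⟩
      · rw [h5 0 (by omega)]; simp [h2 0 (by omega), hs.size]
      · rw [h5 1 (by omega)]; simp [h2 1 (by omega), hs.point]
      · rw [h6 0 (by norm_num)]; simp [h3, hs.graph]
      · rw [h4, hb, hval]; simp [h3]
      · rw [h6 2 (by norm_num)]; simp [h3]
      · rw [hb]; omega
      · rw [h5 q hq]; simp [hq2, h2 q hq]
      · rw [hb, hval, hS' S' hS]
    case h2 =>
      refine ⟨⟨(h2 0 (by omega)).trans hs.size, (h2 1 (by omega)).trans hs.point, h3 ▸ hs.graph, ?_⟩,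
        by rw [h3], (h2 2 (by omega)).le, fun q hq _ => h2 q hq, fun S' hS => ?_⟩
      · rw [h3, h2 2 (by omega), hs.best]
      · rw [h2 2 (by omega), ← hS' S' hS, ← hval]; omega
  | succ k ih =>
    intro r hr
    obtain ⟨c, P, hc⟩ := ih (r + 1) (by omega)
    set tog : Cmd := .write 2 (.reg r) (.sub (.const 1) (.read 2 (.reg r))) with htog
    -- Each level toggles a vertex, runs the pass of radius `k` and toggles back. The counter runs
    -- through `0, …, n`; the value `n` toggles no vertex and accounts for sets at a smaller
    -- distance.
    refine ⟨.seq (.assign r (.const 0)) (.loop (.sub (.add (.reg 0) (.const 1)) (.reg r))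
      (.seq tog (.seq c (.seq tog (.assign r (.add (.reg r) (.const 1))))))),
      Polynomial.C 2 + ((Polynomial.X + Polynomial.C 1) * (Polynomial.C 6 +
        (P + Polynomial.C 16)) + Polynomial.C 6), fun n p A W hT s hs => ?_⟩
    set X := cells n (s.arr 2) with hX
    let J : Store → Prop := fun s' => s'.reg r ≤ n + 1 ∧ Inv n p A W s' ∧
      cells n (s'.arr 2) = X ∧ s'.reg 2 ≤ s.reg 2 ∧ (∀ q < r, q ≠ 2 → s'.reg q = s.reg q) ∧
      ∀ i < s'.reg r, ∀ S', (symmDiff (symmDiff X (single n i)) S').card ≤ k → s'.reg 2 ≤ W S'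
    have htogR : ∀ s' : Store, Runs tog s' 6 fun s'' => s''.reg = s'.reg ∧
        (∀ a, a ≠ 2 → s''.arr a = s'.arr a) ∧
        cells n (s''.arr 2) = symmDiff (cells n (s'.arr 2)) (single n (s'.reg r)) := fun s' =>
      (Runs.write ⟨rfl, fun a ha => Store.setArr_arr_of_ne _ _ _ _ ha, by
        rw [← cells_update]; simp [Store.setArr, Expr.eval]⟩).of_le (by simp [Expr.cost])
    refine Runs.of_le (Runs.seq (B' := _) (R := fun s₁ => s₁ = s.setReg r 0) (Runs.assign rfl)
      fun s₁ hs₁ => (Runs.loop (B := P.eval n + 16) J (fun s' => n + 1 - s'.reg r) (N := n + 1)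
        (fun s' hs' he => ?hstep) ?hJ (Nat.sub_le _ _)).mono le_rfl fun s' hs' => ?hfin) ?hb
    case hb => simp [Expr.cost]
    case hJ =>
      subst hs₁
      refine ⟨by simp, ⟨?_, ?_, hs.graph, ?_⟩, rfl, ?_, fun q hq _ => by simp [hq.ne], by simp⟩
      · simp [(show 0 ≠ r by omega), hs.size]
      · simp [(show 1 ≠ r by omega), hs.point]
      · simp [(show 2 ≠ r by omega), hs.best]
      · simp [(show 2 ≠ r by omega)]
    case hfin =>
      obtain ⟨⟨h1, h2, h3, h4, h5, h6⟩, h7⟩ := hs'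
      simp only [Expr.eval, h2.size] at h7
      refine ⟨h2, h3, h4, h5, fun S' hS' => ?_⟩
      by_cases hne : (symmDiff X S').Nonempty
      · obtain ⟨v, hv⟩ := hne
        refine h6 v (by omega) S' ?_
        have : symmDiff (symmDiff X (single n v)) S' = (symmDiff X S').erase v := by
          ext w
          simp only [Finset.mem_symmDiff, Finset.mem_erase, single, Finset.mem_filter,
            Finset.mem_univ, true_and, Fin.val_inj] at hv ⊢
          by_cases hw : w = v
          · subst hw; tauto
          · tauto
        rw [this, Finset.card_erase_of_mem hv]
        omega
      · refine h6 n (by omega) S' ?_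
        rw [Finset.not_nonempty_iff_eq_empty] at hne
        have h0 : single n n = ∅ := by
          ext w
          simp [single, w.2.ne]
        rw [h0, ← Finset.bot_eq_empty, symmDiff_bot, hne]
        simp
    case hstep =>
      obtain ⟨h1, h2, h3, h4, h5, h6⟩ := hs'
      simp only [Expr.eval, h2.size] at he
      refine ((htogR s').seq fun s₁ hs₁ => (hc n p A W hT s₁ ?hi).seq fun s₂ hs₂ =>
        (htogR s₂).seq fun s₃ hs₃ => Runs.assign ?_).of_le ?hb
      case hb => simp [Expr.cost]; omega
      case hi =>
        refine ⟨?_, ?_, ?_, ?_⟩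
        · rw [hs₁.1, h2.size]
        · rw [hs₁.1, h2.point]
        · rw [hs₁.2.1 0 (by norm_num), h2.graph]
        · rw [hs₁.2.1 3 (by norm_num), hs₁.1, h2.best]
      obtain ⟨a1, a2, a3⟩ := hs₁
      obtain ⟨b1, b2, b3, b4, b5⟩ := hs₂
      obtain ⟨c1, c2, c3⟩ := hs₃
      have hr2 : s₂.reg r = s'.reg r := by rw [b4 r (by omega) (by omega), a1]
      rw [a1] at b3
      rw [a3, h3] at b2 b5
      rw [hr2, b2, symmDiff_symmDiff_cancel_right] at c3
      simp only [Expr.eval, c1, hr2]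
      refine ⟨⟨?_, ⟨?_, ?_, ?_, ?_⟩, ?_, ?_, fun q hq hq2 => ?_, fun i hi S' hS' => ?_⟩, ?_⟩
      · simp; omega
      · simp [(show 0 ≠ r by omega), c1, b1.size]
      · simp [(show 1 ≠ r by omega), c1, b1.point]
      · simp [c2 0 (by norm_num), b1.graph]
      · simp [(show 2 ≠ r by omega), c1, c2 3 (by norm_num), b1.best]
      · simp [c3]
      · simp [(show 2 ≠ r by omega), c1]; omega
      · simp [hq.ne, c1, b4 q (by omega) hq2, a1, h5 q hq hq2]
      · simp only [Store.setReg_reg, if_true, (show 2 ≠ r by omega), if_false, c1] at hi ⊢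
        rcases Nat.lt_succ_iff_lt_or_eq.1 hi with hi | rfl
        · exact b3.trans (h6 i hi S' hS')
        · exact b5 S' hS'
      · simp; omega

/-- Local search in polynomial time. -/
theorem exists_search (T out : Term) (k : ℕ) (M : Polynomial ℕ) :
    ∃ (c : Cmd) (P : Polynomial ℕ), ∀ (n : ℕ) (p : Fin n) (A : ℕ → ℕ) (W : Finset (Fin n) → ℕ)
      (res : Finset (Fin n) → Finset (Fin n)), Computes T n p A W →
      (∀ m : ℕ → ℕ → ℕ, m 0 = A → ∀ i : Fin n,
        (out.eval n m [i, p] ≠ 0 ↔ i ∈ res (cells n (m 2)))) →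
      (∀ S, W S ≤ M.eval n) → ∀ s : Store, s.reg 0 = n → s.reg 1 = p → s.arr 0 = A →
      Runs c s (P.eval n) fun s' => ∃ S, cells n (s'.arr 1) = res S ∧
        W S ≤ W (Finset.univ.erase p) ∧
        ∀ S', (symmDiff S S').card ≤ k → W S ≤ W S' := by
  obtain ⟨c₁, P₁, h₁⟩ := exists_fill (.add (.sub (.var 0) (.var 1)) (.sub (.var 1) (.var 0))) 2 4
    (by norm_num)
  obtain ⟨c₂, P₂, h₂⟩ := exists_copy 2 3 4 (by norm_num) (by norm_num)
  obtain ⟨c₃, P₃, h₃⟩ := T.exists_cmd [1] 4 (by simp) (by norm_num)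
  obtain ⟨c₄, P₄, h₄⟩ := exists_copy 3 2 4 (by norm_num) (by norm_num)
  obtain ⟨c₅, P₅, h₅⟩ := exists_pass T k 4 (by norm_num)
  obtain ⟨c₆, P₆, h₆⟩ := exists_fill out 1 4 (by norm_num)
  -- The search starts from the complement of `p`. Array 2 is the current set, array 3 the best one;
  -- register 2 holds the best value, and register 3 the value before the last pass, initially one
  -- more so that a pass takes place.
  refine ⟨.seq c₁ (.seq c₂ (.seq c₃ (.seq (.assign 2 (.reg 4)) (.seq
    (.assign 3 (.add (.reg 2) (.const 1))) (.seq
    (.loop (.sub (.reg 3) (.reg 2)) (.seq c₄ (.seq (.assign 3 (.reg 2)) c₅))) c₆))))),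
    P₁ + (P₂ + (P₃ + (Polynomial.C 2 + (Polynomial.C 4 + (((M + Polynomial.C 1) * (Polynomial.C 4 +
      (P₄ + (Polynomial.C 2 + P₅))) + Polynomial.C 4) + P₆))))),
    fun n p A W res hT hout hM s h0 h1 hA => ?_⟩
  let J : Store → Prop := fun s' => Inv n p A W s' ∧ s'.reg 2 ≤ W (Finset.univ.erase p) ∧
    (s'.reg 2 < s'.reg 3 ∨ (W (cells n (s'.arr 2)) = s'.reg 2 ∧
      ∀ S', (symmDiff (cells n (s'.arr 2)) S').card ≤ k → s'.reg 2 ≤ W S'))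
  refine Runs.of_le ((h₁ n s (fun i => i ≠ p) h0 ?g1).seq fun s₁ hs₁ =>
    (h₂ n s₁ ?g2).seq fun s₂ hs₂ => (h₃ n s₂ ?g3).seq fun s₃ hs₃ =>
    Runs.seq (B' := _) (R := fun s₄ => s₄ = s₃.setReg 2 (s₃.reg 4)) (Runs.assign rfl)
    fun s₄ hs₄ => Runs.seq (B' := _) (R := fun s₅ => s₅ = s₄.setReg 3 (s₄.reg 2 + 1))
      (Runs.assign rfl) fun s₅ hs₅ =>
    (Runs.loop (B := P₄.eval n + (2 + P₅.eval n)) J (fun s' => s'.reg 3) (N := M.eval n + 1)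
      (fun s' hs' he => ?hstep) ?hJ ?hN).seq fun s₆ hs₆ =>
    (h₆ n s₆ (fun i => ∃ v : Fin n, (v : ℕ) = i ∧ v ∈ res (cells n (s₆.arr 2)))
      hs₆.1.1.size ?g6).mono le_rfl fun s₇ hs₇ => ?hfin) ?hb
  case hb => simp [Expr.cost]
  case g1 =>
    intro m _ i _
    simp [Term.eval, h1]
    omega
  case g2 => rw [hs₁.2.1 0 (by norm_num), h0]
  case g3 => rw [hs₂.2.1 0 (by norm_num), hs₁.2.1 0 (by norm_num), h0]
  case hstep =>
    obtain ⟨a1, a2, a3⟩ := hs'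
    simp only [Expr.eval] at he
    refine (h₄ n s' a1.size).seq fun t₁ ht₁ => Runs.seq (B := 2)
      (R := fun t₂ => t₂ = t₁.setReg 3 (t₁.reg 2)) (Runs.assign rfl) fun t₂ ht₂ =>
      (h₅ n p A W hT t₂ ?hi).mono le_rfl fun t₃ ht₃ => ?_
    case hi =>
      subst ht₂
      refine ⟨?_, ?_, ?_, ?_⟩
      · simp [ht₁.2.1 0, a1.size]
      · simp [ht₁.2.1 1, a1.point]
      · simp [ht₁.2.2 0, a1.graph]
      · simp [ht₁.2.2 3, ht₁.2.1 2, a1.best]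
    obtain ⟨b1, b2, b3⟩ := ht₁
    obtain ⟨d1, d2, d3, d4, d5⟩ := ht₃
    subst ht₂
    have e2 := b2 2 (by norm_num)
    have e3 := d4 3 (by norm_num) (by norm_num)
    simp only [Store.setReg_reg, Store.setReg_arr, if_true, e2, b1,
      (by norm_num : (2 : ℕ) ≠ 3), if_false] at d2 d3 d5 e3
    -- Register 3 receives the old best value, which the guard makes smaller than its previous
    -- content; this bounds the number of passes. If the pass finds nothing better, the current set
    -- is a local optimum.
    refine ⟨⟨d1, d3.trans a2, ?_⟩, by omega⟩
    rcases d3.lt_or_eq with hlt | heq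
    · exact Or.inl (by omega)
    · refine Or.inr ⟨?_, fun S' hS' => d5 S' (d2 ▸ hS')⟩
      rw [d2, heq, a1.best]
  case hfin =>
    obtain ⟨⟨a1, a2, a3⟩, a4⟩ := hs₆
    simp only [Expr.eval] at a4
    obtain ⟨b1, b2⟩ := a3.resolve_left (by omega)
    refine ⟨cells n (s₆.arr 2), ?_, b1.le.trans a2, fun S' hS' => b1.le.trans (b2 S' hS')⟩
    ext v
    rw [mem_cells, hs₇.1 v v.2]
    constructor
    · rintro ⟨w, hw, hw'⟩
      rwa [← Fin.ext hw]
    · exact fun hv => ⟨v, rfl, hv⟩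
  case g6 =>
    intro m hm i hi
    have := hout m ((hm 0 (by norm_num)).trans hs₆.1.1.graph) ⟨i, hi⟩
    rw [hm 2 (by norm_num)] at this
    rw [hs₆.1.1.point, this]
    constructor
    · exact fun h => ⟨_, rfl, h⟩
    · rintro ⟨v, rfl, hv⟩; exact hv
  all_goals
    obtain ⟨b1, b2, b3⟩ := hs₁
    obtain ⟨c1, c2, c3⟩ := hs₂
    obtain ⟨d1, d2, d3⟩ := hs₃
    have hstart : cells n (s₁.arr 2) = Finset.univ.erase p := by
      ext v
      rw [mem_cells, b1 v v.2]
      simp [Fin.val_inj]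
    have e0 : s₂.reg 0 = n := by rw [c2 0 (by norm_num), b2 0 (by norm_num), h0]
    have e1 : s₂.reg 1 = p := by rw [c2 1 (by norm_num), b2 1 (by norm_num), h1]
    have eA : s₂.arr 0 = A := by rw [c3 0 (by norm_num), b3 0 (by norm_num), hA]
    have eW : s₃.reg 4 = W (Finset.univ.erase p) := by
      rw [d1]
      simp only [List.map_cons, List.map_nil, e1]
      rw [hT _ eA, c3 2 (by norm_num), hstart]
    subst hs₄ hs₅
  case hJ =>
    refine ⟨⟨?_, ?_, ?_, ?_⟩, ?_, Or.inl ?_⟩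
    · simp [d2 0, e0]
    · simp [d2 1, e1]
    · simp [d3, eA]
    · simp [d3, eW, c1, hstart]
    · simp [eW]
    · simp
  case hN =>
    have := hM (Finset.univ.erase p)
    simp [eW]
    omega

end RAM

/-! ### Terms for the objective and for the output. -/

namespace RAM

namespace Term

/-- The value of the term is nonzero. -/
def Holds (n : ℕ) (m : ℕ → ℕ → ℕ) (t : Term) (ρ : List ℕ) : Prop := t.eval n m ρ ≠ 0

/-- Negation. -/
def not (t : Term) : Term := sub (const 1) t

/-- Conjunction. -/
def and (t u : Term) : Term := ite t u (const 0)

/-- Inequality of two variables. -/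
def ne (i j : ℕ) : Term := add (sub (var i) (var j)) (sub (var j) (var i))

/-- Adjacency of two variables. -/
def adj (i j : ℕ) : Term := read 0 (add (sum (var (i + 1))) (var j))

/-- Membership in the set in array `2`. -/
def mem (i : ℕ) : Term := read 2 (var i)

/-- The number of values of a variable for which `t` holds. -/
def count (t : Term) : Term := sum (ite t (const 1) (const 0))

variable {n : ℕ} {m : ℕ → ℕ → ℕ} {ρ : List ℕ} {t u v : Term}

lemma holds_not : Holds n m t.not ρ ↔ ¬ Holds n m t ρ := by
  simp only [Holds, not, eval]
  omega

lemma holds_and : Holds n m (t.and u) ρ ↔ Holds n m t ρ ∧ Holds n m u ρ := by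
  simp [Holds, and, eval]

lemma holds_add : Holds n m (t.add u) ρ ↔ Holds n m t ρ ∨ Holds n m u ρ := by
  simp only [Holds, eval]
  omega

lemma holds_sub : Holds n m (t.sub u) ρ ↔ u.eval n m ρ < t.eval n m ρ := by
  simp only [Holds, eval]
  omega

lemma holds_ite : Holds n m (t.ite u v) ρ ↔
    (Holds n m t ρ ∧ Holds n m u ρ) ∨ (¬ Holds n m t ρ ∧ Holds n m v ρ) := by
  simp only [Holds, eval]
  split_ifs <;> tauto

lemma holds_sum : Holds n m t.sum ρ ↔ ∃ a : Fin n, Holds n m t (a :: ρ) := by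
  simp [Holds, eval, Finset.sum_range]

lemma eval_ite [Decidable (Holds n m t ρ)] : eval n m (t.ite u v) ρ =
    if Holds n m t ρ then eval n m u ρ else eval n m v ρ := by
  by_cases h : Holds n m t ρ
  · rw [if_pos h]; exact if_pos h
  · rw [if_neg h]; exact if_neg h

lemma eval_sum : eval n m t.sum ρ = ∑ a : Fin n, eval n m t (a :: ρ) := by
  simp [eval, Finset.sum_range]

lemma eval_count [DecidablePred fun a : Fin n => Holds n m t (a :: ρ)] : eval n m t.count ρ =
    (Finset.univ.filter fun a : Fin n => Holds n m t (a :: ρ)).card := by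
  rw [Finset.card_filter, count, eval_sum]
  exact Finset.sum_congr rfl fun a _ => eval_ite

lemma holds_ne {i j : ℕ} : Holds n m (ne i j) ρ ↔ ρ.getD i 0 ≠ ρ.getD j 0 := by
  simp only [Holds, ne, eval]
  omega

lemma holds_mem {i : ℕ} {a : Fin n} (ha : ρ.getD i 0 = a) :
    Holds n m (mem i) ρ ↔ a ∈ cells n (m 2) := by
  rw [mem_cells, Holds, mem, eval, eval, ha]

lemma mddInput_arr_zero (G : SimpleGraph (Fin n)) (p a b : Fin n) :
    (mddInput G p).arr 0 (n * a + b) ≠ 0 ↔ G.Adj a b := by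
  classical
  simp only [mddInput, ne_eq, ite_eq_right_iff, one_ne_zero, imp_false, not_not, true_and]
  constructor
  · rintro ⟨i, j, hij, h⟩
    have hn : 0 < n := a.pos
    have h1 : (i : ℕ) = a := by
      have := congrArg (· / n) h
      simpa [Nat.mul_add_div hn, mul_comm (i : ℕ) n, Nat.div_eq_of_lt i.2, Nat.div_eq_of_lt j.2,
        Nat.div_eq_of_lt a.2, Nat.div_eq_of_lt b.2] using this.symm
    have h2 : (j : ℕ) = b := by
      rw [h1, mul_comm] at h
      omega
    rwa [Fin.ext h1, Fin.ext h2] at hij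
  · exact fun h => ⟨a, b, h, by ring⟩

/-- Without multiplication, the row offset `n * a` is obtained as a sum of `n` copies of `a`; the
variable index is shifted by one because the sum binds a variable. -/
lemma holds_adj {G : SimpleGraph (Fin n)} {p : Fin n} (hm : m 0 = (mddInput G p).arr 0) {i j : ℕ}
    {a b : Fin n} (ha : ρ.getD i 0 = a) (hb : ρ.getD j 0 = b) :
    Holds n m (adj i j) ρ ↔ G.Adj a b := by
  rw [← mddInput_arr_zero G p, Holds, adj, eval, hm]
  simp only [eval, List.getD_cons_succ, ha, hb, Finset.sum_const, Finset.card_range, smul_eq_mul]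

end Term

open Term CubicDomination

variable {n : ℕ} {m : ℕ → ℕ → ℕ} {G : SimpleGraph (Fin n)} {p : Fin n}

/-- The condition under which a dominating set is used; `q` is the variable for `p`. -/
def flagTerm (q : ℕ) : Term :=
  and (sub (sum (const 1)) (const threshold))
    (not (sum (and (adj (q + 1) 0)
      (not (sum (and (adj 1 0) (and (ne 0 (q + 2)) (not (adj (q + 2) 0)))))))))

/-- The number of neighbours of the variable `i` that satisfy `t`. -/
def degTerm (i : ℕ) (t : Term) : Term := count (and t (adj (i + 1) 0))

/-- The term for `weight`. -/
def weightTerm : Term :=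
  sum (ite (mem 0) (add (const 20) (degTerm 0 (mem 0)))
    (ite (degTerm 0 (mem 0)) (const 0) (const 30)))

/-- The term for `IsMDDMaxSolution`. -/
def solTerm : Term :=
  and (not (mem 0)) (not (sum (and (not (mem 0)) (and (ne 0 1)
    (not (sub (degTerm 1 (not (mem 0))) (degTerm 0 (not (mem 0)))))))))

/-- The term for `objective`. -/
def objectiveTerm : Term :=
  ite (flagTerm 0) weightTerm (ite solTerm (count (mem 0)) (add (sum (const 1)) (const 1)))

/-- The term for `result`. -/
def resultTerm : Term :=
  ite (flagTerm 1) (and (ne 0 1) (and (not (adj 1 0))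
    (add (mem 0) (sum (and (adj 2 0) (adj 0 1)))))) (mem 0)

lemma holds_flagTerm (hm : m 0 = (mddInput G p).arr 0) {q : ℕ} {ρ : List ℕ}
    (hp : ρ.getD q 0 = p) :
    Holds n m (flagTerm q) ρ ↔ threshold < Fintype.card (Fin n) ∧ Feasible G p := by
  have h1 : ∀ u : Fin n, Holds n m (adj (q + 1) 0) (u :: ρ) ↔ G.Adj p u := fun u =>
    holds_adj hm (by simpa using hp) (by simp)
  have h2 : ∀ u w : Fin n, Holds n m (adj (q + 2) 0) (w :: u :: ρ) ↔ G.Adj p w := fun u w =>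
    holds_adj hm (by simpa using hp) (by simp)
  have h3 : ∀ u w : Fin n, Holds n m (adj 1 0) (w :: u :: ρ) ↔ G.Adj u w := fun u w =>
    holds_adj hm (by simp) (by simp)
  have h4 : ∀ u w : Fin n, Holds n m (ne 0 (q + 2)) (w :: u :: ρ) ↔ w ≠ p := fun u w => by
    rw [holds_ne, List.getD_cons_zero, List.getD_cons_succ, List.getD_cons_succ, hp, ne_eq,
      Fin.val_inj]
  have h5 : Holds n m (sub (sum (const 1)) (const threshold)) ρ ↔
      threshold < Fintype.card (Fin n) := by
    rw [holds_sub]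
    simp [eval]
  simp only [flagTerm, holds_and, holds_not, holds_sum, h1, h2, h3, h4, h5, Feasible]
  push Not
  rfl

lemma eval_degTerm [DecidableRel G.Adj] (hm : m 0 = (mddInput G p).arr 0) {i : ℕ} {t : Term}
    {ρ : List ℕ} {a : Fin n} (ha : ρ.getD i 0 = a) {Q : Fin n → Prop} [DecidablePred Q]
    (hQ : ∀ w : Fin n, Holds n m t (w :: ρ) ↔ Q w) :
    eval n m (degTerm i t) ρ = ((G.neighborFinset a).filter Q).card := by
  classical
  rw [degTerm, eval_count]
  congr 1
  ext w
  have h1 : Holds n m (adj (i + 1) 0) (w :: ρ) ↔ G.Adj a w :=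
    holds_adj hm (by simpa using ha) (by simp)
  simp [holds_and, hQ, h1, and_comm]

lemma eval_weightTerm [DecidableRel G.Adj] (hm : m 0 = (mddInput G p).arr 0) {ρ : List ℕ} :
    eval n m weightTerm ρ = weight G (cells n (m 2)) := by
  classical
  set D := cells n (m 2) with hD
  have h1 : ∀ (ρ : List ℕ) (a : Fin n), Holds n m (mem 0) (a :: ρ) ↔ a ∈ D := fun ρ a =>
    holds_mem (by simp)
  have h2 : ∀ a : Fin n, eval n m (degTerm 0 (mem 0)) (a :: ρ) = (nb G D a).card := fun a =>
    eval_degTerm hm (by simp) fun w => h1 _ w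
  -- The weight is a sum of contributions of single vertices, each of which depends only on
  -- membership and on the number of neighbours in `D`.
  have h3 : weight G D = ∑ a, ((if a ∈ D then 20 + (nb G D a).card else 0) +
      (if a ∉ D ∧ (nb G D a).card = 0 then 30 else 0)) := by
    rw [Finset.sum_add_distrib, ← Finset.sum_filter, ← Finset.sum_filter, Finset.sum_const,
      Finset.filter_mem_eq_inter, Finset.univ_inter, Finset.sum_add_distrib, Finset.sum_const,
      weight, innerDeg, uncovered]
    simp only [smul_eq_mul]
    ring
  rw [weightTerm, eval_sum, h3]
  refine Finset.sum_congr rfl fun a _ => ?_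
  have h4 : Holds n m (degTerm 0 (mem 0)) (a :: ρ) ↔ (nb G D a).card ≠ 0 := by rw [← h2]; rfl
  have h5 : eval n m (add (const 20) (degTerm 0 (mem 0))) (a :: ρ) = 20 + (nb G D a).card := by
    rw [← h2]; rfl
  simp only [eval_ite, h1, h4, h5]
  simp only [eval]
  split_ifs <;> first | omega | simp_all

lemma holds_solTerm [DecidableRel G.Adj] (hm : m 0 = (mddInput G p).arr 0) :
    Holds n m solTerm [(p : ℕ)] ↔ IsMDDMaxSolution G p (cells n (m 2)) := by
  have h1 : ∀ (ρ : List ℕ) (a : Fin n), Holds n m (mem 0) (a :: ρ) ↔ a ∈ cells n (m 2) :=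
    fun ρ a => holds_mem (by simp)
  have h2 : ∀ a : Fin n, eval n m (degTerm 0 (not (mem 0))) [(a : ℕ), (p : ℕ)] =
      keep G (cells n (m 2)) a := fun a =>
    eval_degTerm hm (by simp) fun w => by rw [holds_not, h1]
  have h3 : ∀ a : Fin n, eval n m (degTerm 1 (not (mem 0))) [(a : ℕ), (p : ℕ)] =
      keep G (cells n (m 2)) p := fun a =>
    eval_degTerm hm (by simp) fun w => by rw [holds_not, h1]
  have h4 : ∀ a : Fin n, Holds n m (ne 0 1) [(a : ℕ), (p : ℕ)] ↔ a ≠ p := fun a => by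
    rw [holds_ne]
    simp [Fin.val_inj]
  rw [isMDDMaxSolution_iff]
  simp only [solTerm, holds_and, holds_not, holds_sum, holds_sub, h1, h2, h3, h4]
  push Not
  rfl

lemma computes_objectiveTerm [DecidableRel G.Adj] :
    Computes objectiveTerm n p ((mddInput G p).arr 0) (objective G p) := by
  classical
  intro m hm
  rw [objectiveTerm, eval_ite, eval_ite, eval_weightTerm hm, eval_count, objective]
  simp only [holds_flagTerm hm (ρ := [(p : ℕ)]) (q := 0) (by simp), holds_solTerm hm]
  congr 2
  · congr 1
    ext a
    simp [holds_mem (ρ := [(a : ℕ), (p : ℕ)]) (i := 0) (a := a) (by simp)]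
  · simp [eval]

lemma holds_resultTerm [DecidableRel G.Adj] (hm : m 0 = (mddInput G p).arr 0) (i : Fin n) :
    Holds n m resultTerm [(i : ℕ), (p : ℕ)] ↔ i ∈ result G p (cells n (m 2)) := by
  have h1 : Holds n m (mem 0) [(i : ℕ), (p : ℕ)] ↔ i ∈ cells n (m 2) := holds_mem (by simp)
  have h2 : Holds n m (ne 0 1) [(i : ℕ), (p : ℕ)] ↔ i ≠ p := by
    rw [holds_ne]
    simp [Fin.val_inj]
  have h3 : Holds n m (adj 1 0) [(i : ℕ), (p : ℕ)] ↔ G.Adj p i := holds_adj hm (by simp) (by simp)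
  have h4 : ∀ u : Fin n, Holds n m (adj 2 0) [(u : ℕ), (i : ℕ), (p : ℕ)] ↔ G.Adj p u := fun u =>
    holds_adj hm (by simp) (by simp)
  have h5 : ∀ u : Fin n, Holds n m (adj 0 1) [(u : ℕ), (i : ℕ), (p : ℕ)] ↔ G.Adj u i := fun u =>
    holds_adj hm (by simp) (by simp)
  simp only [resultTerm, holds_ite, holds_and, holds_not, holds_add, holds_sum, h1, h2, h3, h4, h5,
    holds_flagTerm hm (ρ := [(i : ℕ), (p : ℕ)]) (q := 1) (by simp), result]
  split_ifs with hf
  · simp only [hf, mem_repair, true_and, not_true, false_and, or_false, and_self]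
  · simp only [hf, false_and, not_false_iff, true_and, false_or]

end RAM

/-- Some program runs in polynomial time on every cubic graph `G` with distinguished vertex `p`, and
its output is a solution to MDD(max) at most `1.583` times as large as any other solution. -/
theorem mainTheorem9 :
    ∃ (c : RAM.Cmd) (P : Polynomial ℕ),
      ∀ (n : ℕ) (G : SimpleGraph (Fin n)) [DecidableRel G.Adj] (p : Fin n),
        G.IsRegularOfDegree 3 →
        ∃ (t : ℕ) (s : RAM.Store),
          RAM.Exec c (mddInput G p) t s ∧
          t ≤ P.eval n ∧
          IsMDDMaxSolution G p (mddOutput n s) ∧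
          ∀ T : Finset (Fin n), IsMDDMaxSolution G p T →
            ((mddOutput n s).card : ℝ) ≤ 1.583 * (T.card : ℝ) := by
  -- The radius `threshold` is a constant, so the running time is a polynomial, of a degree that
  -- grows with this constant; `60 * n + 1` bounds the objective.
  obtain ⟨c, P, hc⟩ := RAM.exists_search RAM.objectiveTerm RAM.resultTerm
    CubicDomination.threshold (Polynomial.C 60 * Polynomial.X + Polynomial.C 1)
  refine ⟨c, P, fun n G _ p hG => ?_⟩
  obtain ⟨t, s, hs, ht, S, hS, hle, hloc⟩ := hc n p ((mddInput G p).arr 0)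
    (CubicDomination.objective G p) (CubicDomination.result G p) RAM.computes_objectiveTerm
    (fun m hm i => RAM.holds_resultTerm hm i)
    (fun S => by simpa using CubicDomination.objective_le hG p S) (mddInput G p)
    (by simp [mddInput]) (by simp [mddInput]) rfl
  have hout : mddOutput n s = CubicDomination.result G p S := hS
  obtain ⟨h1, h2⟩ := CubicDomination.result_spec hG hle hloc
  refine ⟨t, s, hs, ht, hout ▸ h1, fun T hT => ?_⟩
  have h3 : (1000 * (CubicDomination.result G p S).card : ℝ) ≤ 1583 * T.card := by
    exact_mod_cast h2 T hT
  rw [hout]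
  norm_num
  linarith
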